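/- **Setting.** Let $A$ be a finite totally ordered alphabet with an involution $\iota:A\to A$, extended to words by $\iota(x_1\cdots x_p)=\iota(x_p)\cdots\iota(x_1)$. Order the set $A^*$ of words by the short-lex order (first by length, then lexicographically). Let $SL_2$ be the set of pairs $(u,v)$ of words such that $u>v$, $|u|\le|v|+2$, and $u,v$ have no common first letter. Let $R\subset SL_2$ be a finite set and let $G$ be the group generated by $A$ with relations $x\,\iota(x)=1$ $(x\in A)$ and $l=r$ $((l,r)\in R)$; write $\overline w\in G$ for the element represented by $w$. For a set $S$ of pairs of words (rules), an elementary reduction by $(\lambda,\rho)\in S$ replaces $\alpha\lambda\beta$ by $\alpha\rho\beta$; Thue equivalence is the equivalence relation generated by these; a word is $S$-irreducible if it contains no left-hand side of $S$ as a subword. A *rule automaton* here is a finite automaton over pairs of padded letters with one state $s_0$ that is the unique initial and unique final state, and with a word attached to each state. For such an automaton $M$, let $\mathrm{Set}(M)$ be the set of pairs $(u,v)\in SL_2$ such that $M$ accepts the padded word $(u,v)^+$. *Welding* means identifying states, until it is no longer possible, so that $M$ and its reversal become deterministic and every arrow labelled $(x,x)$ with source or target $s_0$ becomes a loop; these loops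 are then omitted, and each resulting state keeps the word of one of the states identified to it ($s_0$ keeps the empty word $\epsilon$). *Incorporating* a rule $r=(u,v)$ means adjoining a path from $s_0$ to $s_0$ through new states labelled by $r^+$ (the state reached after reading $(p,q)^+$ receives the word $\iota(p)q$), welding, and marking the states and arrows of this path as needed. **The procedure.** The data are a finite set $S$ of rules, which is the disjoint union of Considered, Now, New and Delete, and two rule automata, Rules (constant during each pass) and WDiff. At time $0$, New consists of $R$ and of all $(x\,\iota(x),\epsilon)$, $x\in A$, the other three sets are empty, and Rules $=$ WDiff is obtained by incorporating all these rules, with the attached words reduced by $\mathrm{Set}(\text{Rules})$. *Aut-reduction* of a word $w$: as long as possible, choose a subword $\lambda$ of $w$ that contains a left-hand side of $\mathrm{Set}(\text{Rules})$ while none of its proper subwords does, and replace it by the least $\rho$ with $(\lambda,\rho)\in S$; if $S$ has no rule with left-hand side $\lambda$, use the least $\rho$ with $(\lambda,\rho)\in\mathrm{Set}(\text{Rules})$, and insert $(\lambda,\rho)$ into New. A word is Aut-reducible if it contains a left-hand side of $\mathrm{Set}(\text{Rules})$. *Minimization* of a rule $(u,v)$, where the current words are written $u=u_1\cdots u_p$,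 $v=v_1\cdots v_q$. (1) Aut-reduce $u_1\cdots u_{p-1}$; if it changes, go to (3). (2) Aut-reduce $u_2\cdots u_p$. (3) If $u$ is no longer the original left-hand side, Aut-reduce $u$. (4) Aut-reduce $v$. (5) If $v>u$, interchange $u$ and $v$. (6) As long as $p>q+2$, or $p=q+2$, $q>0$ and $u_1>v_1$, or $p=2$, $q=0$ and $u_1>\iota(u_2)$, replace $(u,v)$ by $(u_1\cdots u_{p-1},v\,\iota(u_p))$. (7) If $p=q+2$ and $u_2>\iota(u_1)$, replace $(u,v)$ by $(u_2\cdots u_p,\iota(u_1)v)$. (8) Cancel common first letters. (9) Cancel common last letters. (10) If $(u,v)$ has changed since (4) was last executed, go to (4); otherwise output $(u,v)$. *Handling* the output $(\lambda_1,\rho_1)$ of the minimization of $(\lambda,\rho)$: if it is not $(\epsilon,\epsilon)$, incorporate it into WDiff (reducing the attached words by $\mathrm{Set}(\text{Rules})$), insert it into Now unless it is in Now or Considered, and remove it from New. Then, if some proper subword of $\lambda$ is Aut-reducible, delete $(\lambda,\rho)$ from $S$; otherwise, if $(\lambda_1,\rho_1)\ne(\lambda,\rho)$, move $(\lambda,\rho)$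 to Delete. Each *pass*, in any order where none is given: (i) minimizes each rule in Considered and handles the output; (ii) does the same with rules in New until New is empty; (iii) until Now is empty, moves a rule $(\lambda,\rho)$ from Now to Considered and, for each rule $(\lambda',\rho')$ in Considered and each overlap $\lambda=s_1z$, $\lambda'=zs_2$ or $\lambda'=s_1z$, $\lambda=zs_2$ with $z\ne\epsilon$, Aut-reduces the two words obtained from $s_1zs_2$ by the two rules, and, if the results differ, inserts into New the rule formed by them (larger word on the left) unless it is in $S$; (iv) repeatedly reduces the words attached to the states of WDiff by $\mathrm{Set}(\mathrm{WDiff})$, identifies states with equal words and welds, until the words are distinct and irreducible, then deletes all states and arrows not marked as needed, lets Rules be the resulting WDiff, and unmarks everything; (v) deletes the rules in Delete. The passes are repeated without end. Let $S_t$ be the set $S$ at time $t$, that is, after $t$ elementary steps (for any choices made along the run). A word is *permanently irreducible* if it is $S_t$-irreducible for arbitrarily large $t$. A rule $(\lambda,\rho)$ is *permanent* if $\rho$ and every proper subword of $\lambda$ are permanently irreducible. **Theorem.** Let $u\in A^*$, and let $v$ be the short-lex least word in the Thue equivalence class of $u$ with respect to $S_s$, for some time $s\ge0$. Then: 1. there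 is a time $t_0$ such that for every $t\ge t_0$ there is a chain of elementary reductions from $u$ to $v$, each by a permanent rule belonging to $S_t$; 2. there is a time $t_1$ such that for every $t\ge t_1$, Aut-reduction of $u$ with the data at time $t$ always terminates, and always with the result $v$, whatever choices are made; 3. $v$ is the short-lex normal form of $u$, that is, the short-lex least word $w$ with $\overline w=\overline u$ in $G$. -/

import Mathlib

namespace KnuthBendix

section

variable {A : Type*}

/-! ### Words, rules, rewriting -/

/-- Words over the alphabet `A`. -/
abbrev Word (A : Type*) := List A

/-- A pair (left-hand side, right-hand side). -/
abbrev Rule (A : Type*) := Word A × Word A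

/-- The short-lex order on words. -/
def SLt [LinearOrder A] (u v : Word A) : Prop := List.Shortlex (· < ·) u v

/-- `v` is the short-lex least element of the set `P` of words. -/
def LeastWord [LinearOrder A] (P : Set (Word A)) (v : Word A) : Prop :=
  v ∈ P ∧ ∀ w ∈ P, w = v ∨ SLt v w

/-- The formal inverse of a word, for an involution `inv` of the alphabet. -/
def invWord (inv : A → A) (w : Word A) : Word A := (w.map inv).reverse

/-- `u` goes to `v` by one elementary reduction associated to the rule `r`. -/
def ReducesBy (r : Rule A) (u v : Word A) : Prop :=
  ∃ a b : Word A, u = a ++ r.1 ++ b ∧ v = a ++ r.2 ++ b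

/-- `u` goes to `v` by one elementary reduction by a rule of `R`. -/
def ElemRed (R : Set (Rule A)) (u v : Word A) : Prop := ∃ r ∈ R, ReducesBy r u v

/-- Thue equivalence: the equivalence relation generated by elementary reductions. -/
def ThueEquiv (R : Set (Rule A)) : Word A → Word A → Prop := Relation.EqvGen (ElemRed R)

/-- No left-hand side of `R` is a (contiguous) subword of `w`. -/
def Irreducible (R : Set (Rule A)) (w : Word A) : Prop := ∀ r ∈ R, ¬ r.1 <:+: w

/-- `w'` is a possible result of a full reduction of `w` by the rules `R`. -/
def FullyReduces (R : Set (Rule A)) (w w' : Word A) : Prop :=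
  Relation.ReflTransGen (ElemRed R) w w' ∧ Irreducible R w'

/-- The language of the five-state automaton `SL2`: pairs `(u, v)` without a common first letter,
with `u` short-lex greater than `v` and `|u| ≤ |v| + 2`. -/
def SL2 [LinearOrder A] : Set (Rule A) :=
  {r | SLt r.2 r.1 ∧ r.1.length ≤ r.2.length + 2 ∧ ¬ ∃ x : A, [x] <+: r.1 ∧ [x] <+: r.2}

/-! ### The presented group -/

/-- The relators `x · inv x` (`x ∈ A`) and `l · r⁻¹` (`(l, r) ∈ R`). -/
def relators (inv : A → A) (R : Finset (Rule A)) : Set (FreeGroup A) :=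
  {g | (∃ x : A, g = FreeGroup.of x * FreeGroup.of (inv x)) ∨
    ∃ r ∈ R, g = (r.1.map FreeGroup.of).prod * ((r.2.map FreeGroup.of).prod)⁻¹}

/-- The element of the group `G = ⟨A | x · inv x = 1, l = r for (l, r) ∈ R⟩` represented by `w`. -/
def value (inv : A → A) (R : Finset (Rule A)) (w : Word A) : PresentedGroup (relators inv R) :=
  (w.map PresentedGroup.of).prod

/-- `v` is the short-lex normal form of (the group element represented by) `u`. -/
def IsNormalForm [LinearOrder A] (inv : A → A) (R : Finset (Rule A)) (u v : Word A) : Prop :=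
  LeastWord {w | value inv R w = value inv R u} v

/-! ### Two-variable automata

States are natural numbers; `0` is both the unique initial and the unique final state. The padding
symbol is `none`. The automata in use are trim, so an automaton is given by its set of arrows: the
states are `0` and the end points of arrows. -/

/-- An arrow (source, label, target); the label is a pair of padded letters. -/
abbrev Arrow (A : Type*) := ℕ × (Option A × Option A) × ℕ

/-- The states of an automaton. -/
def states (arr : Finset (Arrow A)) : Finset ℕ :=
  insert 0 (arr.image (fun a => a.1) ∪ arr.image (fun a => a.2.2))

/-- The automaton with a given set of arrows. -/
def toNFA (arr : Finset (Arrow A)) : NFA (Option A × Option A) ℕ where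
  step s x := {t | (s, x, t) ∈ arr}
  start := {0}
  accept := {0}

/-- The padded word `(u, v)⁺`. -/
def pad (r : Rule A) : List (Option A × Option A) := List.zipWithAll Prod.mk r.1 r.2

/-- The set of rules of an automaton: `L(arr) ∩ L(SL2)`. -/
def SetOfRules [LinearOrder A] (arr : Finset (Arrow A)) : Set (Rule A) :=
  {r | pad r ∈ (toNFA arr).accepts ∧ r ∈ SL2}

/-- The automaton `WDiff` in which rules are accumulated: its arrows, the arrows marked as needed,
and the word attached to each state. (A state is marked as needed if it is an end point of a needed
arrow.) -/
structure WDiff (A : Type*) where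
  arrows : Finset (Arrow A)
  needed : Finset (Arrow A)
  label : ℕ → Word A

/-- The identifications of states which welding makes, when the pairs of states in `seed` are
joined by `ε`-arrows, so that the result is deterministic, has a deterministic reversal, and each
arrow labelled `(x, x)` with source or target the state `0` has source equal to target. -/
inductive WeldEq (arr : Finset (Arrow A)) (seed : ℕ → ℕ → Prop) : ℕ → ℕ → Prop
  | seed {s t : ℕ} : seed s t → WeldEq arr seed s t
  | refl (s : ℕ) : WeldEq arr seed s s
  | symm {s t : ℕ} : WeldEq arr seed s t → WeldEq arr seed t s
  | trans {s t q : ℕ} : WeldEq arr seed s t → WeldEq arr seed t q → WeldEq arr seed s q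
  | fwd {s s' t t' : ℕ} {x : Option A × Option A} : WeldEq arr seed s s' →
      (s, x, t) ∈ arr → (s', x, t') ∈ arr → WeldEq arr seed t t'
  | bwd {s s' t t' : ℕ} {x : Option A × Option A} : WeldEq arr seed t t' →
      (s, x, t) ∈ arr → (s', x, t') ∈ arr → WeldEq arr seed s s'
  | baseSource {s t : ℕ} {x : Option A} : WeldEq arr seed s 0 →
      (s, (x, x), t) ∈ arr → WeldEq arr seed s t
  | baseTarget {s t : ℕ} {x : Option A} : WeldEq arr seed t 0 →
      (s, (x, x), t) ∈ arr → WeldEq arr seed s t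

/-- The image of a set of arrows under a renaming of states, without the arrows labelled `(x, x)`
from the state `0` to itself. -/
def mapArrows [DecidableEq A] (f : ℕ → ℕ) (arr : Finset (Arrow A)) : Finset (Arrow A) :=
  (arr.image (fun a => (f a.1, a.2.1, f a.2.2))).filter
    (fun a => ¬ (a.1 = 0 ∧ a.2.2 = 0 ∧ a.2.1.1 = a.2.1.2))

/-- `M'` is obtained from `M` by welding: each class of identified states is named (and labelled)
by one of its members `f s`, and the class of `0` by `0`. -/
def IsWelding [DecidableEq A] (M : WDiff A) (seed : ℕ → ℕ → Prop) (M' : WDiff A) : Prop :=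
  ∃ f : ℕ → ℕ, f 0 = 0 ∧ (∀ s, WeldEq M.arrows seed s (f s)) ∧
    (∀ s t, WeldEq M.arrows seed s t → f s = f t) ∧
    M' = ⟨mapArrows f M.arrows, mapArrows f M.needed, M.label⟩

/-- Adjoin to `M` a path from `0` to `0` through new states, labelled by `r⁺`, with all its arrows
marked as needed. The state reached after reading `(p, q)⁺` is labelled by `p⁻¹q`. -/
def addPath [DecidableEq A] (inv : A → A) (M : WDiff A) (r : Rule A) : WDiff A :=
  let n := (pad r).length
  let m := (states M.arrows).sup id
  let g : ℕ → ℕ := fun i => if i = 0 ∨ i = n then 0 else m + i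
  let path : Finset (Arrow A) :=
    Finset.univ.image (fun i : Fin n => (g i, (pad r).get i, g (i + 1)))
  { arrows := M.arrows ∪ path
    needed := M.needed ∪ path
    label := fun s => if m < s ∧ s < m + n then
        invWord inv (r.1.take (s - m)) ++ r.2.take (s - m)
      else M.label s }

/-- `M'` is `M` with the label of each state fully reduced by the rules `R`. -/
def Relabels (R : Set (Rule A)) (M M' : WDiff A) : Prop :=
  M'.arrows = M.arrows ∧ M'.needed = M.needed ∧
    ∀ s ∈ states M.arrows, FullyReduces R (M.label s) (M'.label s)

/-- Incorporate the rule `r` into `M` by welding; labels are reduced by the rules of `rules`. -/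
def Incorporates [LinearOrder A] (inv : A → A) (rules : Finset (Arrow A)) (r : Rule A)
    (M M' : WDiff A) : Prop :=
  ∃ M₁, IsWelding (addPath inv M r) (fun _ _ => False) M₁ ∧ Relabels (SetOfRules rules) M₁ M'

/-- Distinct states have distinct labels, and labels are irreducible by the rules of `M`. -/
def Settled [LinearOrder A] (M : WDiff A) : Prop :=
  (∀ s ∈ states M.arrows, ∀ t ∈ states M.arrows, M.label s = M.label t → s = t) ∧
    ∀ s ∈ states M.arrows, Irreducible (SetOfRules M.arrows) (M.label s)

/-- One round of reducing all labels of `M` by the rules of `M`, then welding after joining the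
states with equal labels by `ε`-arrows. -/
def Amalgamates [LinearOrder A] (M M' : WDiff A) : Prop :=
  ∃ M₁, Relabels (SetOfRules M.arrows) M M₁ ∧
    IsWelding M₁ (fun s t => s ∈ states M₁.arrows ∧ t ∈ states M₁.arrows ∧
      M₁.label s = M₁.label t) M'

/-! ### The data and `Aut`-reduction -/

/-- The data of the procedure: the four disjoint lists of explicit rules, the automaton `Rules`
(constant during each pass) and the automaton `WDiff`. -/
structure Data (A : Type*) where
  considered : Finset (Rule A)
  now : Finset (Rule A)
  new : Finset (Rule A)
  delete : Finset (Rule A)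
  rules : Finset (Arrow A)
  wdiff : WDiff A

/-- The finite set `S` of explicit rules. -/
def Data.store [DecidableEq A] (d : Data A) : Finset (Rule A) :=
  d.considered ∪ d.now ∪ d.new ∪ d.delete

/-- Insert a rule into `New`, unless it is already in `S`. -/
def Data.addNew [DecidableEq A] (d : Data A) (r : Rule A) : Data A :=
  if r ∈ d.store then d else { d with new := insert r d.new }

/-- `w` contains a left-hand side of a rule of the automaton `rules`. -/
def AutReducible [LinearOrder A] (rules : Finset (Arrow A)) (w : Word A) : Prop :=
  ¬ Irreducible (SetOfRules rules) w

/-- Some proper subword of `w` is `Aut`-reducible. -/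
def ProperSubwordReducible [LinearOrder A] (rules : Finset (Arrow A)) (w : Word A) : Prop :=
  ∃ s, s <:+: w ∧ s ≠ w ∧ AutReducible rules s

/-- One step of `Aut`-reduction. An `Aut`-reducible subword `l` all of whose proper subwords are
`Aut`-irreducible is replaced by the least `ρ` with `(l, ρ) ∈ S`; if there is no rule with left-hand
side `l` in `S`, by the least `ρ` such that `(l, ρ)` is a rule of the automaton `Rules`, and this
rule is inserted into `New`. -/
inductive AutStep [LinearOrder A] : Data A × Word A → Data A × Word A → Prop
  | stored (d : Data A) (a l b ρ : Word A) :
      AutReducible d.rules l → ¬ ProperSubwordReducible d.rules l →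
      LeastWord {σ | (l, σ) ∈ d.store} ρ →
      AutStep (d, a ++ l ++ b) (d, a ++ ρ ++ b)
  | found (d : Data A) (a l b ρ : Word A) :
      AutReducible d.rules l → ¬ ProperSubwordReducible d.rules l →
      (∀ σ, (l, σ) ∉ d.store) →
      LeastWord {σ | (l, σ) ∈ SetOfRules d.rules} ρ →
      AutStep (d, a ++ l ++ b) (d.addNew (l, ρ), a ++ ρ ++ b)

/-- `Aut`-reduction of `w`, started with the data `d`, can end with the `Aut`-irreducible word `w'`
and the data `d'`. -/
def AutReduces [LinearOrder A] (d : Data A) (w : Word A) (d' : Data A) (w' : Word A) : Prop :=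
  Relation.ReflTransGen AutStep (d, w) (d', w') ∧ ¬ AutReducible d'.rules w'

/-- With the data `d`, `Aut`-reduction of `u` always ends, and always with the word `v`, whatever
choices are made. -/
def AutReductionAlwaysGives [LinearOrder A] (d : Data A) (u v : Word A) : Prop :=
  Acc (fun q p => AutStep p q) (d, u) ∧ (∃ d', AutReduces d u d' v) ∧
    ∀ d' w, AutReduces d u d' w → w = v

/-! ### Minimization -/

/-- The lines of the minimization routine. -/
inductive MinLine
  | reducePrefix
  | reduceSuffix
  | reduceLeft
  | reduceRight
  | orient
  | shorten
  | rotate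
  | cancelFirst
  | cancelLast
  | loop
  | output

/-- The condition under which the last letter of the left-hand side is moved to the right. -/
def ShortenCond [LinearOrder A] (inv : A → A) (r : Rule A) : Prop :=
  r.2.length + 2 < r.1.length ∨
  (r.1.length = r.2.length + 2 ∧ ∃ x u y v, r = (x :: u, y :: v) ∧ y < x) ∨
  ∃ x y, r = ([x, y], []) ∧ inv y < x

/-- A position inside the minimization routine: the next line, the current pair of words, and the
pair as it was after the last execution of line `reduceRight`. -/
structure Frame (A : Type*) where
  line : MinLine
  cur : Rule A
  saved : Rule A

/-- The steps of the minimization routine for the rule `input`. -/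
inductive MinStep [LinearOrder A] (inv : A → A) (input : Rule A) :
    Data A × Frame A → Data A × Frame A → Prop
  | prefixSame (d d' : Data A) (s : Rule A) (u v : Word A) (x : A) :
      AutReduces d u d' u →
      MinStep inv input (d, ⟨.reducePrefix, (u ++ [x], v), s⟩)
        (d', ⟨.reduceSuffix, (u ++ [x], v), s⟩)
  | prefixChanged (d d' : Data A) (s : Rule A) (u u' v : Word A) (x : A) :
      AutReduces d u d' u' → u' ≠ u →
      MinStep inv input (d, ⟨.reducePrefix, (u ++ [x], v), s⟩)
        (d', ⟨.reduceLeft, (u' ++ [x], v), s⟩)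
  | suffix (d d' : Data A) (s : Rule A) (u u' v : Word A) (x : A) :
      AutReduces d u d' u' →
      MinStep inv input (d, ⟨.reduceSuffix, (x :: u, v), s⟩)
        (d', ⟨.reduceLeft, (x :: u', v), s⟩)
  | leftSame (d : Data A) (s : Rule A) (u v : Word A) :
      u = input.1 →
      MinStep inv input (d, ⟨.reduceLeft, (u, v), s⟩) (d, ⟨.reduceRight, (u, v), s⟩)
  | leftChanged (d d' : Data A) (s : Rule A) (u u' v : Word A) :
      u ≠ input.1 → AutReduces d u d' u' →
      MinStep inv input (d, ⟨.reduceLeft, (u, v), s⟩) (d', ⟨.reduceRight, (u', v), s⟩)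
  | right (d d' : Data A) (s : Rule A) (u v v' : Word A) :
      AutReduces d v d' v' →
      MinStep inv input (d, ⟨.reduceRight, (u, v), s⟩) (d', ⟨.orient, (u, v'), (u, v')⟩)
  | orientKeep (d : Data A) (s : Rule A) (u v : Word A) :
      ¬ SLt u v →
      MinStep inv input (d, ⟨.orient, (u, v), s⟩) (d, ⟨.shorten, (u, v), s⟩)
  | orientSwap (d : Data A) (s : Rule A) (u v : Word A) :
      SLt u v →
      MinStep inv input (d, ⟨.orient, (u, v), s⟩) (d, ⟨.shorten, (v, u), s⟩)
  | shortenAgain (d : Data A) (s : Rule A) (u v : Word A) (x : A) :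
      ShortenCond inv (u ++ [x], v) →
      MinStep inv input (d, ⟨.shorten, (u ++ [x], v), s⟩) (d, ⟨.shorten, (u, v ++ [inv x]), s⟩)
  | shortenDone (d : Data A) (s r : Rule A) :
      ¬ ShortenCond inv r →
      MinStep inv input (d, ⟨.shorten, r, s⟩) (d, ⟨.rotate, r, s⟩)
  | rotateOnce (d : Data A) (s : Rule A) (u v : Word A) (x y : A) :
      (x :: y :: u).length = v.length + 2 → inv x < y →
      MinStep inv input (d, ⟨.rotate, (x :: y :: u, v), s⟩)
        (d, ⟨.cancelFirst, (y :: u, inv x :: v), s⟩)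
  | rotateDone (d : Data A) (s r : Rule A) :
      (¬ ∃ x y u, r.1 = x :: y :: u ∧ r.1.length = r.2.length + 2 ∧ inv x < y) →
      MinStep inv input (d, ⟨.rotate, r, s⟩) (d, ⟨.cancelFirst, r, s⟩)
  | cancelFirstAgain (d : Data A) (s : Rule A) (u v : Word A) (x : A) :
      MinStep inv input (d, ⟨.cancelFirst, (x :: u, x :: v), s⟩) (d, ⟨.cancelFirst, (u, v), s⟩)
  | cancelFirstDone (d : Data A) (s r : Rule A) :
      (¬ ∃ x u v, r = (x :: u, x :: v)) →
      MinStep inv input (d, ⟨.cancelFirst, r, s⟩) (d, ⟨.cancelLast, r, s⟩)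
  | cancelLastAgain (d : Data A) (s : Rule A) (u v : Word A) (x : A) :
      MinStep inv input (d, ⟨.cancelLast, (u ++ [x], v ++ [x]), s⟩)
        (d, ⟨.cancelLast, (u, v), s⟩)
  | cancelLastDone (d : Data A) (s r : Rule A) :
      (¬ ∃ x u v, r = (u ++ [x], v ++ [x])) →
      MinStep inv input (d, ⟨.cancelLast, r, s⟩) (d, ⟨.loop, r, s⟩)
  | loopAgain (d : Data A) (s r : Rule A) :
      r ≠ s →
      MinStep inv input (d, ⟨.loop, r, s⟩) (d, ⟨.reduceRight, r, s⟩)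
  | loopDone (d : Data A) (s r : Rule A) :
      r = s →
      MinStep inv input (d, ⟨.loop, r, s⟩) (d, ⟨.output, r, s⟩)

/-! ### Handling the output of minimization -/

/-- Insert the output rule `r` into `Now`, unless it is in `Now` or `Considered`, and remove it from
`New`. -/
def Data.record [DecidableEq A] (d : Data A) (W : WDiff A) (r : Rule A) : Data A :=
  { d with
    now := if r ∈ d.now ∪ d.considered then d.now else insert r d.now
    new := d.new.erase r
    wdiff := W }

/-- The non-trivial output is welded into `WDiff` and recorded; `([], [])` is ignored. -/
inductive RecordsOutput [LinearOrder A] (inv : A → A) (out : Rule A) : Data A → Data A → Prop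
  | trivial (d : Data A) : out = ([], []) → RecordsOutput inv out d d
  | weld (d : Data A) (W : WDiff A) : out ≠ ([], []) →
      Incorporates inv d.rules out d.wdiff W → RecordsOutput inv out d (d.record W out)

/-- Immediate deletion of a rule from `S`. -/
def Data.discard [DecidableEq A] (d : Data A) (r : Rule A) : Data A :=
  { d with
    considered := d.considered.erase r
    now := d.now.erase r
    new := d.new.erase r
    delete := d.delete.erase r }

/-- Move a rule of `S` to `Delete`. -/
def Data.postpone [DecidableEq A] (d : Data A) (r : Rule A) : Data A :=
  { d.discard r with delete := insert r d.delete }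

/-- What happens to the input rule: it is deleted at once if a proper subword of its left-hand side
is `Aut`-reducible, otherwise it is moved to `Delete` if it was not minimal. -/
inductive DisposesInput [LinearOrder A] (input out : Rule A) : Data A → Data A → Prop
  | discard (d : Data A) : ProperSubwordReducible d.rules input.1 →
      DisposesInput input out d (d.discard input)
  | postpone (d : Data A) : ¬ ProperSubwordReducible d.rules input.1 → out ≠ input →
      DisposesInput input out d (d.postpone input)
  | keep (d : Data A) : ¬ ProperSubwordReducible d.rules input.1 → out = input →
      DisposesInput input out d d

/-! ### The main loop -/

/-- The pairs of words obtained from `s₁ z s₂` by the two elementary reductions associated to `r`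
and `r'`, where `r.1 = s₁ z`, `r'.1 = z s₂` and `z` is not empty. -/
def critPairs [DecidableEq A] (r r' : Rule A) : Finset (Word A × Word A) :=
  ((Finset.Icc 1 (min r.1.length r'.1.length)).filter
      (fun k => r.1.drop (r.1.length - k) = r'.1.take k)).image
    (fun k => (r.2 ++ r'.1.drop k, r.1.take (r.1.length - k) ++ r'.2))

/-- All critical pairs between `r` and the rules in `C`. -/
def allCritPairs [DecidableEq A] (r : Rule A) (C : Finset (Rule A)) : Finset (Word A × Word A) :=
  C.biUnion (fun r' => critPairs r r' ∪ critPairs r' r)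

/-- Insert the rule with sides `w₁`, `w₂` (if they differ) into `New`, unless it is in `S`. -/
inductive AddsCritical [LinearOrder A] (w₁ w₂ : Word A) (d : Data A) : Data A → Prop
  | eq : w₁ = w₂ → AddsCritical w₁ w₂ d d
  | gt : SLt w₂ w₁ → AddsCritical w₁ w₂ d (d.addNew (w₁, w₂))
  | lt : SLt w₁ w₂ → AddsCritical w₁ w₂ d (d.addNew (w₂, w₁))

/-- The points of the program between elementary steps. `considered todo`: the rules in `todo`, from
`Considered`, are still to be minimized in this pass. `new`: the rules in `New` are being minimized.
`minimize ret input f`: inside the minimization of `input`, with return point `ret`. `now`: the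
rules in `Now` are being moved to `Considered`. `overlaps todo`: the critical pairs in `todo` are
still to be treated. `wdiff`: the new automaton `Rules` is being formed from `WDiff`. `delete`: the
rules in `Delete` are about to be deleted. -/
inductive Control (A : Type*)
  | considered (todo : Finset (Rule A))
  | new
  | minimize (ret : Control A) (input : Rule A) (f : Frame A)
  | now
  | overlaps (todo : Finset (Word A × Word A))
  | wdiff
  | delete

/-- A state of the program. -/
abbrev Config (A : Type*) := Data A × Control A

/-- The set of explicit rules of a program state. -/
def Config.store [DecidableEq A] (c : Config A) : Set (Rule A) := {r | r ∈ Data.store c.1}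

/-- The elementary steps of the procedure. -/
inductive Step [LinearOrder A] (inv : A → A) : Config A → Config A → Prop
  | pickConsidered (d : Data A) (todo : Finset (Rule A)) (r : Rule A) : r ∈ todo →
      Step inv (d, .considered todo)
        (d, .minimize (.considered (todo.erase r)) r ⟨.reducePrefix, r, r⟩)
  | endConsidered (d : Data A) : Step inv (d, .considered ∅) (d, .new)
  | pickNew (d : Data A) (r : Rule A) : r ∈ d.new →
      Step inv (d, .new) (d, .minimize .new r ⟨.reducePrefix, r, r⟩)
  | endNew (d : Data A) : d.new = ∅ → Step inv (d, .new) (d, .now)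
  | minimize (d d' : Data A) (ret : Control A) (input : Rule A) (f f' : Frame A) :
      MinStep inv input (d, f) (d', f') →
      Step inv (d, .minimize ret input f) (d', .minimize ret input f')
  | handle (d d₁ d₂ : Data A) (ret : Control A) (input out s : Rule A) :
      RecordsOutput inv out d d₁ → DisposesInput input out d₁ d₂ →
      Step inv (d, .minimize ret input ⟨.output, out, s⟩) (d₂, ret)
  | pickNow (d : Data A) (r : Rule A) : r ∈ d.now →
      Step inv (d, .now)
        ({ d with now := d.now.erase r, considered := insert r d.considered },
          .overlaps (allCritPairs r (insert r d.considered)))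
  | overlap (d d₁ d₂ d₃ : Data A) (todo : Finset (Word A × Word A)) (p : Word A × Word A)
      (w₁ w₂ : Word A) : p ∈ todo →
      AutReduces d p.1 d₁ w₁ → AutReduces d₁ p.2 d₂ w₂ → AddsCritical w₁ w₂ d₂ d₃ →
      Step inv (d, .overlaps todo) (d₃, .overlaps (todo.erase p))
  | endOverlaps (d : Data A) : Step inv (d, .overlaps ∅) (d, .now)
  | endNow (d : Data A) : d.now = ∅ → Step inv (d, .now) (d, .wdiff)
  | amalgamate (d : Data A) (W : WDiff A) : ¬ Settled d.wdiff → Amalgamates d.wdiff W →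
      Step inv (d, .wdiff) ({ d with wdiff := W }, .wdiff)
  | copy (d : Data A) : Settled d.wdiff →
      Step inv (d, .wdiff)
        ({ d with rules := d.wdiff.needed, wdiff := ⟨d.wdiff.needed, ∅, d.wdiff.label⟩ }, .delete)
  | endPass (d : Data A) :
      Step inv (d, .delete) ({ d with delete := ∅ }, .considered d.considered)

/-- The initial rules: `(x · inv x, ε)` for `x ∈ A`, and the rules in `R`. -/
def initialRules [Fintype A] [DecidableEq A] (inv : A → A) (R : Finset (Rule A)) :
    Finset (Rule A) :=
  R ∪ Finset.univ.image (fun x : A => ([x, inv x], []))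

/-- The initial arrangements. The paths labelled by the initial rules (taken in any order) are
welded together, every arrow is needed, and the labels are reduced by the rules of the resulting
automaton, which is both `WDiff` and the first automaton `Rules`. All initial rules are in `New`. -/
def IsInitial [Fintype A] [LinearOrder A] (inv : A → A) (R : Finset (Rule A)) (c : Config A) :
    Prop :=
  ∃ (l : List (Rule A)) (W₁ W : WDiff A), l.toFinset = initialRules inv R ∧
    IsWelding (l.foldl (addPath inv) ⟨∅, ∅, fun _ => []⟩) (fun _ _ => False) W₁ ∧
    Relabels (SetOfRules W₁.arrows) W₁ W ∧
    c = (⟨∅, ∅, initialRules inv R, ∅, W.arrows, W⟩, .considered ∅)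

/-- A run of the procedure; `c t` is the state of the program at time `t`. -/
def IsRun [Fintype A] [LinearOrder A] (inv : A → A) (R : Finset (Rule A)) (c : ℕ → Config A) :
    Prop :=
  IsInitial inv R (c 0) ∧ ∀ t, Step inv (c t) (c (t + 1))

/-! ### Permanent rules -/

/-- There are arbitrarily large times at which `w` is irreducible by the explicit rules. -/
def PermanentlyIrreducible [DecidableEq A] (c : ℕ → Config A) (w : Word A) : Prop :=
  ∀ T, ∃ t ≥ T, Irreducible (c t).store w

/-- The right-hand side and each proper subword of the left-hand side are permanently irreducible. -/
def Permanent [DecidableEq A] (c : ℕ → Config A) (r : Rule A) : Prop :=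
  PermanentlyIrreducible c r.2 ∧ ∀ s, s <:+: r.1 → s ≠ r.1 → PermanentlyIrreducible c s

/-- An elementary reduction associated to a permanent rule which is in `S` at time `t`. -/
def PermanentRed [DecidableEq A] (c : ℕ → Config A) (t : ℕ) : Word A → Word A → Prop :=
  ElemRed {r | r ∈ (c t).store ∧ Permanent c r}

end

end KnuthBendix

/-!
The theorem is a completeness theorem for the Knuth–Bendix procedure, in which rules are deleted
again and again, so that no single set of rules can be followed from one pass to the next. The words
are well-ordered in type `ω` by the short-lex order, so that each has a rank `rk w : ℕ`, and the
notion which survives the deletions is `Conv S n`: convertibility by the rules of `S` through words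
of rank less than `n`. A rule `(l, r)` is a *consequence* of `S` if `l` and `r` are convertible by `S`
through words up to `l`.

*Soundness.* The words attached to the states of the automata keep track of group elements, so that
all rules ever found hold in the group (`LabelsValid`, `DataSound`). Conversely, the rules present at
the beginning present the group (`thue_of_value_eq`), and each step changes the rules outside
`Delete`, the *live* ones, only to consequences (`Step.conv`): the input of a minimization is a
consequence of its output and of live rules with smaller left-hand sides (`PairInv`). So bounded
conversions, once available, remain available, and Thue equivalence by the explicit rules is equality
in the group at all times (`IsRun.thueEquiv_iff`).

*Liveness.* Each pass ends (`SoundRun.exists_delete`): minimization terminates, it inserts into `New`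
only rules with left-hand sides below that of its input, and each round of amalgamation loses states
or makes labels smaller. A conversion from `l` to `r` through words up to `l` has to begin with a
reduction of `l`; hence a word reducible at some time remains reducible by live rules. When `Rules` is
formed, the rules in `Considered` have been incorporated into `WDiff` in that pass. Although welding
omits loops at the base state and may cut the path of a rule into pieces, one of the pieces remains a
rule of the automaton (`Threads.exists_rule`). So a word reducible at some time is `Aut`-reducible
from some time on (`SoundRun.eventually_autReducible`).

*Stable rules.* A rule which minimization never changes again remains live forever, and it is
permanent, as its right-hand side and the proper subwords of its left-hand side would otherwise become
`Aut`-reducible and be reduced. By induction on rules, each live rule `(l, ρ)` is superseded by a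
stable one, which reduces `l` to a word convertible to `ρ` below `l` (`SoundRun.exists_stable`). Two
stable rules are eventually both in `Considered`, so their critical pairs are resolved; as they are
permanent, neither left-hand side is a proper subword of the other. So two reductions of a word `w` by
stable rules lead to words convertible through words below `w` (`SoundRun.convBelow_of_peak`). By
induction on the bound of a conversion, convertible words have the same normal form by the stable
rules (`SoundRun.fullyReduces_unique`).

Hence the stable rules reduce each word to its short-lex normal form, and each stable rule is present
from some time on.
As to `Aut`-reduction, only finitely many words lie below `u`, so from some time on those which are
not `Aut`-reducible are irreducible by the stable rules (`SoundRun.eventually_irreducible`), and every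
result of `Aut`-reduction is the normal form.
-/

set_option linter.unusedSectionVars false

namespace KnuthBendix

variable {A : Type*}

/-! ### Elementary reductions -/

section Reductions

lemma ElemRed.context {S : Set (Rule A)} {u v : Word A} (a b : Word A) (h : ElemRed S u v) :
    ElemRed S (a ++ u ++ b) (a ++ v ++ b) := by
  obtain ⟨r, hr, x, y, rfl, rfl⟩ := h
  exact ⟨r, hr, a ++ x, y ++ b, by simp, by simp⟩

lemma ElemRed.mono {S T : Set (Rule A)} (h : S ⊆ T) {u v : Word A} (h' : ElemRed S u v) :
    ElemRed T u v := by
  obtain ⟨r, hr, k⟩ := h'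
  exact ⟨r, h hr, k⟩

lemma ElemRed.of_mem {S : Set (Rule A)} {r : Rule A} (h : r ∈ S) : ElemRed S r.1 r.2 :=
  ⟨r, h, [], [], by simp, by simp⟩

lemma not_irreducible_iff {S : Set (Rule A)} {w : Word A} :
    ¬ Irreducible S w ↔ ∃ v, ElemRed S w v := by
  unfold Irreducible
  push Not
  constructor
  · rintro ⟨r, hr, a, b, rfl⟩
    exact ⟨a ++ r.2 ++ b, r, hr, a, b, rfl, rfl⟩
  · rintro ⟨v, r, hr, a, b, rfl, rfl⟩
    exact ⟨r, hr, a, b, rfl⟩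

lemma Irreducible.infix {S : Set (Rule A)} {u w : Word A} (h : Irreducible S w) (hu : u <:+: w) :
    Irreducible S u := fun r hr hru => h r hr (hru.trans hu)

end Reductions

/-! ### The rank of a word in the short-lex order -/

section Rank

variable [LinearOrder A]

lemma slt_iff {u v : Word A} :
    SLt u v ↔ u.length < v.length ∨ u.length = v.length ∧ u < v :=
  List.shortlex_def

lemma SLt.trans {u v w : Word A} (h : SLt u v) (h' : SLt v w) : SLt u w := by
  rw [slt_iff] at *
  rcases h with h | ⟨h, h₁⟩ <;> rcases h' with h' | ⟨h', h₁'⟩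
  · exact Or.inl (h.trans h')
  · exact Or.inl (h' ▸ h)
  · exact Or.inl (h ▸ h')
  · exact Or.inr ⟨h.trans h', h₁.trans h₁'⟩

lemma SLt.irrefl (u : Word A) : ¬ SLt u u := by
  rw [slt_iff]; simp

lemma slt_trichotomy (u v : Word A) : SLt u v ∨ u = v ∨ SLt v u := by
  simp only [slt_iff]
  rcases lt_trichotomy u.length v.length with h | h | h
  · exact Or.inl (Or.inl h)
  · rcases lt_trichotomy u v with h' | h' | h'
    · exact Or.inl (Or.inr ⟨h, h'⟩)
    · exact Or.inr (Or.inl h')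
    · exact Or.inr (Or.inr (Or.inr ⟨h.symm, h'⟩))
  · exact Or.inr (Or.inr (Or.inl h))

lemma SLt.append_left {u v : Word A} (h : SLt u v) (a : Word A) : SLt (a ++ u) (a ++ v) :=
  List.Shortlex.append_left h a

lemma SLt.append_right {u v : Word A} (h : SLt u v) (b : Word A) : SLt (u ++ b) (v ++ b) := by
  rw [slt_iff] at *
  rcases h with h | ⟨h, h'⟩
  · left; simpa using h
  · right
    refine ⟨by simpa using h, ?_⟩
    induction u generalizing v with
    | nil =>
      cases v with
      | nil => exact absurd h' (lt_irrefl _)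
      | cons y v => simp at h
    | cons x u ih =>
      cases v with
      | nil => simp at h
      | cons y v =>
        rw [List.cons_lt_cons_iff] at h'
        rw [List.cons_append, List.cons_append, List.cons_lt_cons_iff]
        rcases h' with h' | ⟨h', h''⟩
        · exact Or.inl h'
        · exact Or.inr ⟨h', ih (by simpa using h) h''⟩

variable [Fintype A]

lemma finite_slt (w : Word A) : {x | SLt x w}.Finite := by
  refine (List.finite_length_le A w.length).subset ?_
  intro x hx
  rcases slt_iff.1 hx with h | h
  · exact h.le
  · exact h.1.le

/-- The number of words which precede `w` in the short-lex order. As the alphabet is finite, this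
identifies the short-lex order with the order of the natural numbers. -/
noncomputable def rk (w : Word A) : ℕ := {x | SLt x w}.ncard

lemma rk_lt_of_slt {u v : Word A} (h : SLt u v) : rk u < rk v := by
  refine Set.ncard_lt_ncard ?_ (finite_slt v)
  refine ⟨fun x hx => SLt.trans hx h, fun hs => SLt.irrefl u (hs h)⟩

lemma rk_lt {u v : Word A} : rk u < rk v ↔ SLt u v := by
  refine ⟨fun h => ?_, rk_lt_of_slt⟩
  rcases slt_trichotomy u v with h' | rfl | h'
  · exact h'
  · exact absurd h (lt_irrefl _)
  · exact absurd (rk_lt_of_slt h') (by omega)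

lemma rk_inj {u v : Word A} : rk u = rk v ↔ u = v := by
  refine ⟨fun h => ?_, fun h => h ▸ rfl⟩
  rcases slt_trichotomy u v with h' | h' | h'
  · exact absurd (rk_lt_of_slt h') (by omega)
  · exact h'
  · exact absurd (rk_lt_of_slt h') (by omega)

lemma rk_lt_of_length {u v : Word A} (h : u.length < v.length) : rk u < rk v :=
  rk_lt.2 (slt_iff.2 (Or.inl h))

lemma rk_context_lt {u v : Word A} (a b : Word A) :
    rk (a ++ u ++ b) < rk (a ++ v ++ b) ↔ rk u < rk v := by
  have key : ∀ {u v : Word A}, rk u < rk v → rk (a ++ u ++ b) < rk (a ++ v ++ b) := fun h =>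
    rk_lt.2 (((rk_lt.1 h).append_left a).append_right b)
  refine ⟨fun h => ?_, key⟩
  by_contra h'
  rcases (not_lt.1 h').lt_or_eq with h' | h'
  · exact absurd (key h') (by omega)
  · rw [rk_inj] at h'
    subst h'
    exact lt_irrefl _ h

lemma rk_context_le {u v : Word A} (a b : Word A) :
    rk (a ++ u ++ b) ≤ rk (a ++ v ++ b) ↔ rk u ≤ rk v := by
  rw [← not_lt, ← not_lt, rk_context_lt]

lemma rk_cons_lt {u v : Word A} (x : A) : rk (x :: u) < rk (x :: v) ↔ rk u < rk v := by
  simpa using rk_context_lt (u := u) (v := v) [x] []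

lemma rk_snoc_lt {u v : Word A} (x : A) : rk (u ++ [x]) < rk (v ++ [x]) ↔ rk u < rk v := by
  simpa using rk_context_lt (u := u) (v := v) [] [x]

lemma rk_cons_le {u v : Word A} (x : A) : rk (x :: u) ≤ rk (x :: v) ↔ rk u ≤ rk v := by
  simpa using rk_context_le (u := u) (v := v) [x] []

lemma rk_snoc_le {u v : Word A} (x : A) : rk (u ++ [x]) ≤ rk (v ++ [x]) ↔ rk u ≤ rk v := by
  simpa using rk_context_le (u := u) (v := v) [] [x]

lemma rk_lt_of_head {x y : A} {u v : Word A} (h : u.length = v.length) (hx : x < y) :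
    rk (x :: u) < rk (y :: v) := by
  refine rk_lt.2 (slt_iff.2 (Or.inr ⟨by simp [h], ?_⟩))
  rw [List.cons_lt_cons_iff]
  exact Or.inl hx

lemma rk_infix {u v : Word A} (h : u <:+: v) : rk u ≤ rk v := by
  rcases h.length_le.lt_or_eq with h' | h'
  · exact (rk_lt_of_length h').le
  · rw [h.eq_of_length h']

lemma rk_infix_lt {u v : Word A} (h : u <:+: v) (h' : u ≠ v) : rk u < rk v :=
  lt_of_le_of_ne (rk_infix h) (fun e => h' (rk_inj.1 e))

lemma finite_rk_le (n : ℕ) : {x : Word A | rk x ≤ n}.Finite :=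
  Set.Finite.preimage (f := rk) (fun _ _ _ _ h => rk_inj.1 h) (Set.finite_Iic n)

end Rank

/-! ### Conversions through words of bounded rank -/

section Conversion

variable [LinearOrder A] [Fintype A]

/-- Every rule of `S` decreases words in the short-lex order. -/
def Oriented (S : Set (Rule A)) : Prop := ∀ r ∈ S, rk r.2 < rk r.1

lemma Oriented.rk_lt {S : Set (Rule A)} (hS : Oriented S) {u v : Word A} (h : ElemRed S u v) :
    rk v < rk u := by
  obtain ⟨r, hr, a, b, rfl, rfl⟩ := h
  exact (rk_context_lt a b).2 (hS r hr)

/-- One elementary reduction by `S` or its inverse, between words of rank less than `n`. -/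
def ConvStep (S : Set (Rule A)) (n : ℕ) (a b : Word A) : Prop :=
  rk a < n ∧ rk b < n ∧ (ElemRed S a b ∨ ElemRed S b a)

/-- Thue equivalence by the rules of `S` along a chain of words of rank less than `n`. -/
def Conv (S : Set (Rule A)) (n : ℕ) : Word A → Word A → Prop :=
  Relation.ReflTransGen (ConvStep S n)

lemma Conv.refl {S : Set (Rule A)} {n : ℕ} (a : Word A) : Conv S n a a := Relation.ReflTransGen.refl

lemma Conv.trans {S : Set (Rule A)} {n : ℕ} {a b c : Word A} (h : Conv S n a b)
    (h' : Conv S n b c) : Conv S n a c := Relation.ReflTransGen.trans h h'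

lemma Conv.symm {S : Set (Rule A)} {n : ℕ} {a b : Word A} (h : Conv S n a b) : Conv S n b a := by
  induction h with
  | refl => exact Conv.refl _
  | tail _ hs ih =>
    obtain ⟨h₁, h₂, h₃⟩ := hs
    exact Relation.ReflTransGen.head ⟨h₂, h₁, h₃.symm⟩ ih

lemma Conv.mono {S T : Set (Rule A)} {n m : ℕ} (hST : S ⊆ T) (hnm : n ≤ m) {a b : Word A}
    (h : Conv S n a b) : Conv T m a b :=
  Relation.ReflTransGen.mono (fun _ _ ⟨h₁, h₂, h₃⟩ =>
    ⟨by omega, by omega, h₃.imp (ElemRed.mono hST) (ElemRed.mono hST)⟩) _ _ h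

lemma Conv.of_elemRed {S : Set (Rule A)} {n : ℕ} {a b : Word A} (h : ElemRed S a b) (ha : rk a < n)
    (hb : rk b < n) : Conv S n a b :=
  Relation.ReflTransGen.single ⟨ha, hb, Or.inl h⟩

lemma Conv.context {S : Set (Rule A)} {n m : ℕ} {u v : Word A} (a b : Word A) (h : Conv S n u v)
    (hm : ∀ x, rk x < n → rk (a ++ x ++ b) < m) : Conv S m (a ++ u ++ b) (a ++ v ++ b) := by
  refine Relation.ReflTransGen.lift (fun x => a ++ x ++ b) ?_ _ _ h
  rintro x y ⟨h₁, h₂, h₃⟩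
  exact ⟨hm x h₁, hm y h₂, h₃.imp (ElemRed.context a b) (ElemRed.context a b)⟩

/-- A conversion through words up to `w` may be carried out inside any context of `w`. -/
lemma Conv.context_le {S : Set (Rule A)} {w u v : Word A} {n : ℕ} (a b : Word A)
    (h : Conv S (rk w + 1) u v) (hn : rk (a ++ w ++ b) < n) :
    Conv S n (a ++ u ++ b) (a ++ v ++ b) := by
  refine h.context a b fun x hx => lt_of_le_of_lt ?_ hn
  exact (rk_context_le a b).2 (by omega)

lemma Conv.context_lt {S : Set (Rule A)} {w u v : Word A} (a b : Word A)
    (h : Conv S (rk w) u v) : Conv S (rk (a ++ w ++ b)) (a ++ u ++ b) (a ++ v ++ b) :=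
  h.context a b fun _ hx => (rk_context_lt a b).2 hx

/-- Replacing rules by conversions which stay below their left-hand sides preserves bounded
convertibility. -/
lemma Conv.subst {S T : Set (Rule A)} {n : ℕ} {u v : Word A}
    (hST : ∀ r ∈ S, rk r.1 < n → Conv T (rk r.1 + 1) r.1 r.2) (h : Conv S n u v) :
    Conv T n u v := by
  have key : ∀ x y, rk x < n → ElemRed S x y → Conv T n x y := by
    rintro x y hx ⟨r, hr, a, b, rfl, rfl⟩
    have : rk r.1 ≤ rk (a ++ r.1 ++ b) := rk_infix ⟨a, b, rfl⟩
    exact (hST r hr (by omega)).context_le a b hx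
  induction h with
  | refl => exact Conv.refl _
  | tail _ hs ih =>
    refine ih.trans ?_
    obtain ⟨h₁, h₂, h₃ | h₃⟩ := hs
    · exact key _ _ h₁ h₃
    · exact (key _ _ h₂ h₃).symm

/-- Only rules with left-hand side below the bound matter. -/
lemma Conv.restrict {S : Set (Rule A)} {n : ℕ} {u v : Word A} (h : Conv S n u v) :
    Conv {r | r ∈ S ∧ rk r.1 < n} n u v := by
  have key : ∀ x y, rk x < n → ElemRed S x y → ElemRed {r | r ∈ S ∧ rk r.1 < n} x y := by
    rintro x y hx ⟨r, hr, a, b, rfl, rfl⟩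
    have : rk r.1 ≤ rk (a ++ r.1 ++ b) := rk_infix ⟨a, b, rfl⟩
    exact ⟨r, ⟨hr, by omega⟩, a, b, rfl, rfl⟩
  refine Relation.ReflTransGen.mono ?_ _ _ h
  rintro x y ⟨h₁, h₂, h₃⟩
  exact ⟨h₁, h₂, h₃.imp (key _ _ h₁) (key _ _ h₂)⟩

/-- A conversion from `w` through words up to `w` leaves `w` for the last time by a reduction. -/
lemma Conv.last_departure {S : Set (Rule A)} (hS : Oriented S) {w v : Word A}
    (h : Conv S (rk w + 1) w v) (hv : w ≠ v) : ∃ b, ElemRed S w b ∧ Conv S (rk w) b v := by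
  have key : ∀ x, Conv S (rk w + 1) x v →
      (x ≠ w ∧ Conv S (rk w) x v) ∨ ∃ b, ElemRed S w b ∧ Conv S (rk w) b v := by
    intro x hx
    induction hx using Relation.ReflTransGen.head_induction_on with
    | refl => exact Or.inl ⟨hv.symm, Conv.refl _⟩
    | @head x y hs _ ih =>
      rcases ih with ⟨hy, ih⟩ | ih
      · obtain ⟨h₁, h₂, h₃⟩ := hs
        have hy' : rk y < rk w := by
          have : rk y ≠ rk w := fun e => hy (rk_inj.1 e)
          omega
        by_cases hx : x = w
        · subst hx
          rcases h₃ with h₃ | h₃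
          · exact Or.inr ⟨y, h₃, ih⟩
          · exact absurd (hS.rk_lt h₃) (by omega)
        · have hx' : rk x < rk w := by
            have : rk x ≠ rk w := fun e => hx (rk_inj.1 e)
            omega
          exact Or.inl ⟨hx, Relation.ReflTransGen.head ⟨hx', hy', h₃⟩ ih⟩
      · exact Or.inr ih
  rcases key w h with ⟨h', _⟩ | h'
  · exact absurd rfl h'
  · exact h'

lemma Conv.exists_of_thue {S : Set (Rule A)} {u v : Word A} (h : ThueEquiv S u v) :
    ∃ n, Conv S n u v := by
  induction h with
  | rel x y h =>
    exact ⟨rk x + rk y + 1, Conv.of_elemRed h (by omega) (by omega)⟩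
  | refl x => exact ⟨0, Conv.refl x⟩
  | symm x y _ ih => exact ih.imp fun n h => h.symm
  | trans x y z _ _ ih₁ ih₂ =>
    obtain ⟨n, h₁⟩ := ih₁
    obtain ⟨m, h₂⟩ := ih₂
    exact ⟨max n m, (h₁.mono subset_rfl (le_max_left _ _)).trans
      (h₂.mono subset_rfl (le_max_right _ _))⟩

lemma Conv.thue {S : Set (Rule A)} {n : ℕ} {u v : Word A} (h : Conv S n u v) :
    ThueEquiv S u v := by
  induction h with
  | refl => exact Relation.EqvGen.refl _
  | tail _ hs ih =>
    refine Relation.EqvGen.trans _ _ _ ih ?_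
    obtain ⟨_, _, h | h⟩ := hs
    · exact Relation.EqvGen.rel _ _ h
    · exact Relation.EqvGen.symm _ _ (Relation.EqvGen.rel _ _ h)

lemma Conv.of_reflTransGen {S : Set (Rule A)} (hS : Oriented S) {u v : Word A}
    (h : Relation.ReflTransGen (ElemRed S) u v) : rk v ≤ rk u ∧ Conv S (rk u + 1) u v := by
  induction h with
  | refl => exact ⟨le_rfl, Conv.refl _⟩
  | tail _ hs ih =>
    have := hS.rk_lt hs
    exact ⟨by omega, ih.2.trans (Conv.of_elemRed hs (by omega) (by omega))⟩

end Conversion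

/-! ### Words and the presented group -/

section Group

variable {inv : A → A} {R : Finset (Rule A)}

lemma value_nil : value inv R [] = 1 := by simp [value]

lemma value_append (u v : Word A) : value inv R (u ++ v) = value inv R u * value inv R v := by
  simp [value]

lemma value_cons (x : A) (u : Word A) :
    value inv R (x :: u) = value inv R [x] * value inv R u := value_append [x] u

lemma value_mul_inv (x : A) : value inv R [x] * value inv R [inv x] = 1 := by
  have h : FreeGroup.of x * FreeGroup.of (inv x) ∈ relators inv R := Or.inl ⟨x, rfl⟩
  have := PresentedGroup.one_of_mem h
  simpa [value, PresentedGroup.of] using this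

lemma value_inv (x : A) : value inv R [inv x] = (value inv R [x])⁻¹ :=
  (inv_eq_of_mul_eq_one_right (value_mul_inv x)).symm

lemma value_invWord (w : Word A) : value inv R (invWord inv w) = (value inv R w)⁻¹ := by
  induction w with
  | nil => simp [invWord, value]
  | cons x w ih =>
    have : invWord inv (x :: w) = invWord inv w ++ [inv x] := by simp [invWord]
    rw [this, value_append, ih, value_inv, value_cons x w, mul_inv_rev]

lemma value_of_mem {r : Rule A} (h : r ∈ R) : value inv R r.1 = value inv R r.2 := by
  have h : (r.1.map FreeGroup.of).prod * ((r.2.map FreeGroup.of).prod)⁻¹ ∈ relators inv R :=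
    Or.inr ⟨r, h, rfl⟩
  have h' := PresentedGroup.one_of_mem h
  have key : ∀ w : Word A,
      PresentedGroup.mk (relators inv R) ((w.map FreeGroup.of).prod) = value inv R w := by
    intro w
    simp only [value, map_list_prod, List.map_map]
    rfl
  rw [map_mul, map_inv, key, key] at h'
  exact mul_inv_eq_one.1 h'

variable (inv R) in
/-- The two sides of each rule of `S` represent the same element of the group. -/
def Valid (S : Set (Rule A)) : Prop := ∀ r ∈ S, value inv R r.1 = value inv R r.2

lemma Valid.elemRed {S : Set (Rule A)} (hS : Valid inv R S) {u v : Word A} (h : ElemRed S u v) :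
    value inv R u = value inv R v := by
  obtain ⟨r, hr, a, b, rfl, rfl⟩ := h
  simp only [value_append, hS r hr]

lemma Valid.reflTransGen {S : Set (Rule A)} (hS : Valid inv R S) {u v : Word A}
    (h : Relation.ReflTransGen (ElemRed S) u v) : value inv R u = value inv R v := by
  induction h with
  | refl => rfl
  | tail _ hs ih => rw [ih, hS.elemRed hs]

lemma Valid.thue {S : Set (Rule A)} (hS : Valid inv R S) {u v : Word A} (h : ThueEquiv S u v) :
    value inv R u = value inv R v := by
  induction h with
  | rel x y h => exact hS.elemRed h
  | refl x => rfl
  | symm x y _ ih => exact ih.symm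
  | trans x y z _ _ ih₁ ih₂ => exact ih₁.trans ih₂

lemma ThueEquiv.context {S : Set (Rule A)} {u v : Word A} (a b : Word A) (h : ThueEquiv S u v) :
    ThueEquiv S (a ++ u ++ b) (a ++ v ++ b) := by
  induction h with
  | rel x y h => exact Relation.EqvGen.rel _ _ (h.context a b)
  | refl x => exact Relation.EqvGen.refl _
  | symm x y _ ih => exact Relation.EqvGen.symm _ _ ih
  | trans x y z _ _ ih₁ ih₂ => exact Relation.EqvGen.trans _ _ _ ih₁ ih₂

/-- Thue equivalence as a congruence of the free monoid. -/
def thueCon (S : Set (Rule A)) : Con (FreeMonoid A) where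
  r u v := ThueEquiv S (FreeMonoid.toList u) (FreeMonoid.toList v)
  iseqv :=
    { refl := fun _ => Relation.EqvGen.refl _
      symm := fun h => Relation.EqvGen.symm _ _ h
      trans := fun h h' => Relation.EqvGen.trans _ _ _ h h' }
  mul' := by
    intro w x y z h h'
    simp only [FreeMonoid.toList_mul]
    refine Relation.EqvGen.trans _ (FreeMonoid.toList x ++ FreeMonoid.toList y) _ ?_ ?_
    · exact ThueEquiv.context [] (FreeMonoid.toList y) h
    · have := ThueEquiv.context (FreeMonoid.toList x) [] h'
      rwa [List.append_nil, List.append_nil] at this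

/-- If the rules `x · inv x = 1` and the rules of `R` are among the Thue relations, words with the
same value are Thue equivalent: the letters are invertible in the monoid of Thue classes, so the
presented group maps to its group of units. -/
lemma thue_of_value_eq (hinv : Function.Involutive inv) {S : Set (Rule A)}
    (hS : ∀ x, ([x, inv x], []) ∈ S) (hR : ∀ r ∈ R, r ∈ S) {u v : Word A}
    (h : value inv R u = value inv R v) : ThueEquiv S u v := by
  let q : Word A → (thueCon S).Quotient := fun w => ((FreeMonoid.ofList w : FreeMonoid A) : _)
  have q_eq : ∀ {w w'}, q w = q w' ↔ ThueEquiv S w w' := fun {w w'} => (thueCon S).eq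
  have q_mul : ∀ w w', q (w ++ w') = q w * q w' := fun w w' => rfl
  have q_rule : ∀ r ∈ S, q r.1 = q r.2 := fun r hr =>
    q_eq.2 (Relation.EqvGen.rel _ _ (ElemRed.of_mem hr))
  have q_one : ∀ x, q [x] * q [inv x] = 1 := fun x => by
    rw [← q_mul]
    exact q_rule _ (hS x)
  let f : A → (thueCon S).Quotientˣ := fun x =>
    ⟨q [x], q [inv x], q_one x, by have := q_one (inv x); rwa [hinv x] at this⟩
  have f_prod : ∀ w : Word A, ((w.map f).prod : (thueCon S).Quotient) = q w := by
    intro w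
    induction w with
    | nil => rfl
    | cons x w ih =>
      rw [List.map_cons, List.prod_cons, Units.val_mul, ih]
      rfl
  have hrel : ∀ r ∈ relators inv R, FreeGroup.lift f r = 1 := by
    rintro r (⟨x, rfl⟩ | ⟨r, hr, rfl⟩)
    · rw [map_mul, FreeGroup.lift_apply_of, FreeGroup.lift_apply_of]
      exact Units.ext (q_one x)
    · have key : ∀ w : Word A,
          FreeGroup.lift f ((w.map FreeGroup.of).prod) = (w.map f).prod := by
        intro w
        rw [map_list_prod, List.map_map]
        congr 2
      rw [map_mul, map_inv, key, key, mul_inv_eq_one]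
      exact Units.ext (by rw [f_prod, f_prod, q_rule r (hR r hr)])
  have f_value : ∀ w, PresentedGroup.toGroup hrel (value inv R w) = (w.map f).prod := by
    intro w
    rw [value, map_list_prod, List.map_map]
    congr 2
  rw [← q_eq, ← f_prod, ← f_prod, ← f_value, ← f_value, h]

end Group

/-! ### Paths in automata -/

section Paths

/-- There is a path labelled by the given word between two states, by arrows from a given set. -/
def HasPath (arr : Set (Arrow A)) : ℕ → List (Option A × Option A) → ℕ → Prop
  | s, [], t => s = t
  | s, x :: l, t => ∃ q, (s, x, q) ∈ arr ∧ HasPath arr q l t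

lemma HasPath.map {arr arr' : Set (Arrow A)} (f : ℕ → ℕ)
    (hf : ∀ a ∈ arr, (f a.1, a.2.1, f a.2.2) ∈ arr') {l : List (Option A × Option A)} :
    ∀ {s t : ℕ}, HasPath arr s l t → HasPath arr' (f s) l (f t) := by
  induction l with
  | nil => rintro s t rfl; rfl
  | cons x l ih =>
    rintro s t ⟨p, hp, h⟩
    exact ⟨f p, hf _ hp, ih h⟩

lemma mem_evalFrom_iff {arr : Finset (Arrow A)} {l : List (Option A × Option A)} :
    ∀ {S : Set ℕ} {t : ℕ}, t ∈ (toNFA arr).evalFrom S l ↔ ∃ s ∈ S, HasPath ↑arr s l t := by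
  induction l with
  | nil => intro S t; simp [HasPath]
  | cons x l ih =>
    intro S t
    rw [NFA.evalFrom_cons, ih]
    simp only [NFA.mem_stepSet, HasPath]
    constructor
    · rintro ⟨q, ⟨s, hs, hq⟩, h⟩
      exact ⟨s, hs, q, hq, h⟩
    · rintro ⟨s, hs, q, hq, h⟩
      exact ⟨q, ⟨s, hs, hq⟩, h⟩

lemma mem_accepts_iff {arr : Finset (Arrow A)} {l : List (Option A × Option A)} :
    l ∈ (toNFA arr).accepts ↔ HasPath ↑arr 0 l 0 := by
  rw [NFA.mem_accepts]
  constructor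
  · rintro ⟨t, ht, h⟩
    obtain ⟨s, hs, h⟩ := mem_evalFrom_iff.1 h
    have ht : t = 0 := ht
    have hs : s = 0 := hs
    rwa [hs, ht] at h
  · intro h
    exact ⟨0, rfl, mem_evalFrom_iff.2 ⟨0, rfl, h⟩⟩

lemma pad_cons_cons (x y : A) (u v : Word A) :
    pad (x :: u, y :: v) = (some x, some y) :: pad (u, v) := rfl

lemma pad_nil_cons (y : A) (v : Word A) : pad ([], y :: v) = (none, some y) :: pad ([], v) := by
  cases v <;> rfl

lemma pad_cons_nil (x : A) (u : Word A) : pad (x :: u, []) = (some x, none) :: pad (u, []) := by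
  cases u <;> rfl

lemma pad_nil_nil : pad (([], []) : Rule A) = [] := rfl

lemma length_pad (r : Rule A) : (pad r).length = max r.1.length r.2.length := by
  obtain ⟨u, v⟩ := r
  induction u generalizing v with
  | nil =>
    induction v with
    | nil => rfl
    | cons y v ih => rw [pad_nil_cons]; simp at ih ⊢; omega
  | cons x u ih =>
    cases v with
    | nil =>
      have := ih []
      rw [pad_cons_nil]; simp at this ⊢; omega
    | cons y v =>
      have := ih v
      rw [pad_cons_cons]; simp at this ⊢; omega

/-- A factorization of a padded word comes from factorizations of the two words. -/
lemma pad_eq_append {l l' : List (Option A × Option A)} :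
    ∀ {u v : Word A}, pad (u, v) = l ++ l' →
      l = pad (u.take l.length, v.take l.length) ∧
        l' = pad (u.drop l.length, v.drop l.length) := by
  induction l with
  | nil => intro u v h; simpa [pad_nil_nil] using h.symm
  | cons z l ih =>
    intro u v h
    cases u with
    | nil =>
      cases v with
      | nil => simp [pad_nil_nil] at h
      | cons y v =>
        rw [pad_nil_cons, List.cons_append, List.cons.injEq] at h
        obtain ⟨rfl, h⟩ := h
        have := ih h
        simp only [List.length_cons, List.take_nil, List.drop_nil, List.take_succ_cons,
          List.drop_succ_cons, pad_nil_cons] at this ⊢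
        exact ⟨by rw [← this.1], this.2⟩
    | cons x u =>
      cases v with
      | nil =>
        rw [pad_cons_nil, List.cons_append, List.cons.injEq] at h
        obtain ⟨rfl, h⟩ := h
        have := ih h
        simp only [List.length_cons, List.take_nil, List.drop_nil, List.take_succ_cons,
          List.drop_succ_cons, pad_cons_nil] at this ⊢
        exact ⟨by rw [← this.1], this.2⟩
      | cons y v =>
        rw [pad_cons_cons, List.cons_append, List.cons.injEq] at h
        obtain ⟨rfl, h⟩ := h
        have := ih h
        simp only [List.length_cons, List.take_succ_cons,
          List.drop_succ_cons, pad_cons_cons] at this ⊢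
        exact ⟨by rw [← this.1], this.2⟩

end Paths

/-! ### Validity of the words attached to states -/

section Labels

variable {inv : A → A} {R : Finset (Rule A)}

variable (inv R) in
/-- The group element of a padded letter; the padding symbol represents the identity. -/
def optValue (x : Option A) : PresentedGroup (relators inv R) := value inv R x.toList

variable (inv R) in
/-- The words attached to the states are compatible with the arrows: reading `(x, y)` from a state
labelled `g` leads to a state labelled `x⁻¹ g y` in the group. -/
def LabelsValid (W : WDiff A) : Prop :=
  value inv R (W.label 0) = 1 ∧ ∀ s x t, (s, x, t) ∈ W.arrows →
    optValue inv R x.1 * value inv R (W.label t) = value inv R (W.label s) * optValue inv R x.2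

lemma LabelsValid.hasPath {W : WDiff A} (hW : LabelsValid inv R W)
    {l : List (Option A × Option A)} : ∀ {s t : ℕ}, HasPath ↑W.arrows s l t →
      (l.map fun x => optValue inv R x.1).prod * value inv R (W.label t) =
        value inv R (W.label s) * (l.map fun x => optValue inv R x.2).prod := by
  induction l with
  | nil => rintro s t rfl; simp
  | cons x l ih =>
    rintro s t ⟨q, hq, h⟩
    have h₁ := hW.2 s x q hq
    simp only [List.map_cons, List.prod_cons]
    rw [mul_assoc, ih h, ← mul_assoc, h₁, mul_assoc]

lemma prod_pad (r : Rule A) :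
    ((pad r).map fun x => optValue inv R x.1).prod = value inv R r.1 ∧
      ((pad r).map fun x => optValue inv R x.2).prod = value inv R r.2 := by
  obtain ⟨u, v⟩ := r
  induction u generalizing v with
  | nil =>
    induction v with
    | nil => simp [pad_nil_nil, value_nil]
    | cons y v ih =>
      simp only [pad_nil_cons, List.map_cons, List.prod_cons, ih.1, ih.2]
      rw [value_cons y v]
      simp [optValue, value_nil]
  | cons x u ih =>
    cases v with
    | nil =>
      simp only [pad_cons_nil, List.map_cons, List.prod_cons, (ih []).1, (ih []).2]
      rw [value_cons x u]
      simp [optValue, value_nil]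
    | cons y v =>
      simp only [pad_cons_cons, List.map_cons, List.prod_cons, (ih v).1, (ih v).2]
      rw [value_cons x u, value_cons y v]
      simp [optValue]

lemma LabelsValid.valid [LinearOrder A] {W : WDiff A} (hW : LabelsValid inv R W) :
    Valid inv R (SetOfRules W.arrows) := by
  rintro r ⟨hr, -⟩
  have := hW.hasPath (mem_accepts_iff.1 hr)
  rwa [hW.1, mul_one, one_mul, (prod_pad r).1, (prod_pad r).2] at this

lemma SetOfRules.mono [LinearOrder A] {arr arr' : Finset (Arrow A)} (h : arr ⊆ arr') :
    SetOfRules arr ⊆ SetOfRules arr' := by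
  rintro r ⟨hr, hr'⟩
  refine ⟨mem_accepts_iff.2 ?_, hr'⟩
  exact HasPath.map (f := id) (fun a ha => h ha) (mem_accepts_iff.1 hr)

lemma source_mem_states {arr : Finset (Arrow A)} {s t : ℕ} {x : Option A × Option A}
    (h : (s, x, t) ∈ arr) : s ∈ states arr := by
  simp only [states, Finset.mem_insert, Finset.mem_union, Finset.mem_image]
  exact Or.inr (Or.inl ⟨_, h, rfl⟩)

lemma target_mem_states {arr : Finset (Arrow A)} {s t : ℕ} {x : Option A × Option A}
    (h : (s, x, t) ∈ arr) : t ∈ states arr := by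
  simp only [states, Finset.mem_insert, Finset.mem_union, Finset.mem_image]
  exact Or.inr (Or.inr ⟨_, h, rfl⟩)

lemma zero_mem_states (arr : Finset (Arrow A)) : 0 ∈ states arr := by simp [states]

lemma LabelsValid.relabels {S : Set (Rule A)} (hS : Valid inv R S) {W W' : WDiff A}
    (hW : LabelsValid inv R W) (h : Relabels S W W') : LabelsValid inv R W' := by
  have key : ∀ s ∈ states W.arrows, value inv R (W'.label s) = value inv R (W.label s) :=
    fun s hs => (hS.reflTransGen (h.2.2 s hs).1).symm
  refine ⟨(key 0 (zero_mem_states _)).trans hW.1, fun s x t ha => ?_⟩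
  rw [h.1] at ha
  rw [key s (source_mem_states ha), key t (target_mem_states ha)]
  exact hW.2 s x t ha

lemma LabelsValid.weldEq {W : WDiff A} (hW : LabelsValid inv R W) {seed : ℕ → ℕ → Prop}
    (hseed : ∀ s t, seed s t → value inv R (W.label s) = value inv R (W.label t)) {s t : ℕ}
    (h : WeldEq W.arrows seed s t) : value inv R (W.label s) = value inv R (W.label t) := by
  induction h with
  | seed h => exact hseed _ _ h
  | refl => rfl
  | symm _ ih => exact ih.symm
  | trans _ _ ih ih' => exact ih.trans ih'
  | fwd _ h₁ h₂ ih =>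
    have e₁ := hW.2 _ _ _ h₁
    have e₂ := hW.2 _ _ _ h₂
    rw [ih, ← e₂] at e₁
    exact mul_left_cancel e₁
  | bwd _ h₁ h₂ ih =>
    have e₁ := hW.2 _ _ _ h₁
    have e₂ := hW.2 _ _ _ h₂
    rw [ih, e₂] at e₁
    exact (mul_right_cancel e₁).symm
  | baseSource _ h₁ ih =>
    have e₁ := hW.2 _ _ _ h₁
    rw [ih, hW.1, one_mul] at e₁
    rw [ih, hW.1]
    exact (mul_eq_left.1 e₁).symm
  | baseTarget _ h₁ ih =>
    have e₁ := hW.2 _ _ _ h₁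
    rw [ih, hW.1, mul_one] at e₁
    rw [ih, hW.1]
    exact mul_eq_right.1 e₁.symm

lemma mem_mapArrows [DecidableEq A] {f : ℕ → ℕ} {arr : Finset (Arrow A)} {a : Arrow A} :
    a ∈ mapArrows f arr ↔ (∃ b ∈ arr, (f b.1, b.2.1, f b.2.2) = a) ∧
      ¬ (a.1 = 0 ∧ a.2.2 = 0 ∧ a.2.1.1 = a.2.1.2) := by
  simp [mapArrows]

lemma LabelsValid.welding [DecidableEq A] {W W' : WDiff A} (hW : LabelsValid inv R W)
    {seed : ℕ → ℕ → Prop}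
    (hseed : ∀ s t, seed s t → value inv R (W.label s) = value inv R (W.label t))
    (h : IsWelding W seed W') : LabelsValid inv R W' := by
  obtain ⟨f, -, hf, -, rfl⟩ := h
  refine ⟨hW.1, fun s x t ha => ?_⟩
  obtain ⟨⟨⟨s', x', t'⟩, hb, hb'⟩, -⟩ := mem_mapArrows.1 ha
  simp only [Prod.mk.injEq] at hb'
  obtain ⟨rfl, rfl, rfl⟩ := hb'
  change optValue inv R x'.1 * value inv R (W.label (f t')) =
    value inv R (W.label (f s')) * optValue inv R x'.2
  rw [← hW.weldEq hseed (hf s'), ← hW.weldEq hseed (hf t')]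
  exact hW.2 _ _ _ hb

lemma take_one_of_pad {u v : Word A} {z : Option A × Option A} {l : List (Option A × Option A)}
    (h : pad (u, v) = z :: l) : u.take 1 = z.1.toList ∧ v.take 1 = z.2.toList := by
  cases u with
  | nil =>
    cases v with
    | nil => simp [pad_nil_nil] at h
    | cons y v =>
      rw [pad_nil_cons, List.cons.injEq] at h
      simp [← h.1]
  | cons x u =>
    cases v with
    | nil =>
      rw [pad_cons_nil, List.cons.injEq] at h
      simp [← h.1]
    | cons y v =>
      rw [pad_cons_cons, List.cons.injEq] at h
      simp [← h.1]

lemma toList_pad_get (r : Rule A) (i : ℕ) (hi : i < (pad r).length) :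
    r.1.take (i + 1) = r.1.take i ++ ((pad r).get ⟨i, hi⟩).1.toList ∧
      r.2.take (i + 1) = r.2.take i ++ ((pad r).get ⟨i, hi⟩).2.toList := by
  have h := (pad_eq_append (u := r.1) (v := r.2) (List.take_append_drop i (pad r)).symm).2
  rw [List.length_take_of_le hi.le, List.drop_eq_getElem_cons hi] at h
  have h' := take_one_of_pad h.symm
  rw [List.take_add, List.take_add, h'.1, h'.2]
  exact ⟨rfl, rfl⟩

lemma LabelsValid.addPath [DecidableEq A] {W : WDiff A} (hW : LabelsValid inv R W) {r : Rule A}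
    (hr : value inv R r.1 = value inv R r.2) :
    LabelsValid inv R (KnuthBendix.addPath inv W r) := by
  set n := (pad r).length with hn
  set m := (states W.arrows).sup id with hm
  have le_m : ∀ s ∈ states W.arrows, s ≤ m := fun s hs => Finset.le_sup (f := id) hs
  have label_old : ∀ s, s ≤ m → (KnuthBendix.addPath inv W r).label s = W.label s := by
    intro s hs
    simp only [KnuthBendix.addPath, ← hm, ← hn]
    rw [if_neg (by omega)]
  have h0 : value inv R ((KnuthBendix.addPath inv W r).label 0) = 1 := by
    rw [label_old 0 (Nat.zero_le _)]
    exact hW.1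
  -- The position `i` of the path carries the group element of the two prefixes of length `i`; at
  -- the ends of the path this is the identity, since the rule is valid.
  have label_new : ∀ i ≤ n,
      value inv R ((KnuthBendix.addPath inv W r).label (if i = 0 ∨ i = n then 0 else m + i)) =
        (value inv R (r.1.take i))⁻¹ * value inv R (r.2.take i) := by
    intro i hi
    split_ifs with h
    · rw [h0]
      rcases h with rfl | rfl
      · simp [value_nil]
      · have hl := length_pad r
        rw [← hn] at hl
        rw [List.take_of_length_le (by omega), List.take_of_length_le (by omega), hr]
        simp
    · push Not at h
      have h' : m < m + i ∧ m + i < m + n := by omega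
      simp only [KnuthBendix.addPath, ← hm, ← hn]
      rw [if_pos h', Nat.add_sub_cancel_left, value_append, value_invWord]
  refine ⟨h0, fun s x t ha => ?_⟩
  simp only [KnuthBendix.addPath, Finset.mem_union, Finset.mem_image, Finset.mem_univ,
    true_and] at ha
  rcases ha with ha | ⟨i, hi⟩
  · rw [label_old s (le_m s (source_mem_states ha)), label_old t (le_m t (target_mem_states ha))]
    exact hW.2 s x t ha
  · simp only [Prod.mk.injEq, ← hm, ← hn] at hi
    obtain ⟨rfl, rfl, rfl⟩ := hi
    have hlt := i.2
    obtain ⟨e₁, e₂⟩ := toList_pad_get r i i.2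
    rw [label_new i (by omega), label_new (i + 1) (by omega), e₁, e₂, value_append, value_append]
    simp only [optValue]
    group

end Labels

/-! ### Rules accepted up to loops at the base state -/

section Threads

/-- The loops at the state `0` which welding omits. -/
def baseLoops (A : Type*) : Set (Arrow A) := {a | a.1 = 0 ∧ a.2.2 = 0 ∧ a.2.1.1 = a.2.1.2}

/-- The padded rule `r⁺` labels a path from `0` to `0`, provided that the loops labelled `(x, x)` at
the state `0` are put back. -/
def Threads (arr : Finset (Arrow A)) (r : Rule A) : Prop :=
  HasPath (↑arr ∪ baseLoops A) 0 (pad r) 0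

/-- No arrow labelled `(x, x)` leaves the state `0`. -/
def NoBaseLoop (arr : Finset (Arrow A)) : Prop := ∀ x t, (0, (x, x), t) ∉ arr

lemma Threads.map {arr arr' : Finset (Arrow A)} {r : Rule A} (f : ℕ → ℕ) (f0 : f 0 = 0)
    (hf : ∀ a ∈ arr, (f a.1, a.2.1, f a.2.2) ∈ (↑arr' ∪ baseLoops A : Set (Arrow A)))
    (h : Threads arr r) : Threads arr' r := by
  have := HasPath.map (arr' := ↑arr' ∪ baseLoops A) f ?_ h
  · rwa [f0] at this
  · rintro a (ha | ⟨h₁, h₂, h₃⟩)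
    · exact hf a ha
    · exact Or.inr ⟨by simp [h₁, f0], by simp [h₂, f0], h₃⟩

lemma Threads.mono {arr arr' : Finset (Arrow A)} (h : arr ⊆ arr') {r : Rule A}
    (hr : Threads arr r) : Threads arr' r :=
  hr.map id rfl fun _ ha => Or.inl (h ha)

section Welding

variable [DecidableEq A] {W W' : WDiff A} {seed : ℕ → ℕ → Prop}

lemma IsWelding.noBaseLoop (h : IsWelding W seed W') : NoBaseLoop W'.arrows := by
  obtain ⟨f, f0, hf, hf', rfl⟩ := h
  intro x t ha
  obtain ⟨⟨⟨s', x', t'⟩, hb, hb'⟩, hn⟩ := mem_mapArrows.1 ha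
  simp only [Prod.mk.injEq] at hb'
  obtain ⟨hs, rfl, rfl⟩ := hb'
  refine hn ⟨rfl, ?_, rfl⟩
  have h₁ : WeldEq W.arrows seed s' 0 := by
    have := hf s'
    rwa [hs] at this
  have h₂ := hf' _ _ (WeldEq.baseSource h₁ hb)
  exact h₂.symm.trans hs

lemma IsWelding.needed_subset (h : IsWelding W seed W') (hW : W.needed ⊆ W.arrows) :
    W'.needed ⊆ W'.arrows := by
  obtain ⟨f, -, -, -, rfl⟩ := h
  intro a ha
  obtain ⟨⟨b, hb, hb'⟩, hn⟩ := mem_mapArrows.1 ha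
  exact mem_mapArrows.2 ⟨⟨b, hW hb, hb'⟩, hn⟩

lemma IsWelding.threads (h : IsWelding W seed W') {r : Rule A} (hr : Threads W.needed r) :
    Threads W'.needed r := by
  obtain ⟨f, f0, -, -, rfl⟩ := h
  refine hr.map f f0 fun a ha => ?_
  by_cases hl : f a.1 = 0 ∧ f a.2.2 = 0 ∧ a.2.1.1 = a.2.1.2
  · exact Or.inr hl
  · exact Or.inl (mem_mapArrows.2 ⟨⟨a, ha, rfl⟩, hl⟩)

lemma addPath_needed_subset (inv : A → A) (r : Rule A) (hW : W.needed ⊆ W.arrows) :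
    (addPath inv W r).needed ⊆ (addPath inv W r).arrows :=
  Finset.union_subset_union hW subset_rfl

lemma subset_addPath_needed (inv : A → A) (r : Rule A) : W.needed ⊆ (addPath inv W r).needed :=
  Finset.subset_union_left

lemma threads_addPath (inv : A → A) (W : WDiff A) (r : Rule A) :
    Threads (addPath inv W r).needed r := by
  set n := (pad r).length with hn
  set m := (states W.arrows).sup id with hm
  have key : ∀ j ≤ n, HasPath (↑(addPath inv W r).needed ∪ baseLoops A)
      (if n - j = 0 ∨ n - j = n then 0 else m + (n - j)) ((pad r).drop (n - j)) 0 := by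
    intro j
    induction j with
    | zero =>
      intro _
      simp [hn, HasPath]
    | succ j ih =>
      intro hj
      have hlt : n - (j + 1) < (pad r).length := by omega
      have e : n - (j + 1) + 1 = n - j := by omega
      rw [List.drop_eq_getElem_cons hlt, e]
      refine ⟨_, Or.inl ?_, ih (by omega)⟩
      simp only [addPath, Finset.coe_union, Set.mem_union]
      refine Or.inr ?_
      simp only [Finset.coe_image, Set.mem_image, Finset.mem_coe, Finset.mem_univ, true_and]
      refine ⟨⟨n - (j + 1), hlt⟩, ?_⟩
      simp only [← hn, ← hm, e, List.get_eq_getElem]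
  have := key n le_rfl
  simpa [Threads] using this

end Welding

/-- A path which uses the virtual loops at `0` has a last one, or uses none. -/
lemma HasPath.last_loop {arr : Set (Arrow A)} {l : List (Option A × Option A)} :
    ∀ {s t : ℕ}, HasPath (arr ∪ baseLoops A) s l t → HasPath arr s l t ∨
      ∃ l₁ x l₂, l = l₁ ++ (x, x) :: l₂ ∧ HasPath arr 0 l₂ t := by
  induction l with
  | nil => intro s t h; exact Or.inl h
  | cons z l ih =>
    rintro s t ⟨q, hq, h⟩
    rcases ih h with h | ⟨l₁, x, l₂, rfl, h'⟩
    · rcases hq with hq | ⟨h₁, h₂, h₃⟩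
      · exact Or.inl ⟨q, hq, h⟩
      · obtain ⟨z₁, z₂⟩ := z
        simp only at h₁ h₂ h₃
        subst h₁ h₂ h₃
        exact Or.inr ⟨[], z₁, l, rfl, h⟩
    · exact Or.inr ⟨z :: l₁, x, l₂, rfl, h'⟩

/-- A path which uses the virtual loops at `0` has a first one, or uses none. -/
lemma HasPath.first_loop {arr : Set (Arrow A)} {l : List (Option A × Option A)} :
    ∀ {s t : ℕ}, HasPath (arr ∪ baseLoops A) s l t → HasPath arr s l t ∨
      ∃ l₁ x l₂, l = l₁ ++ (x, x) :: l₂ ∧ HasPath arr s l₁ 0 := by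
  induction l with
  | nil => intro s t h; exact Or.inl h
  | cons z l ih =>
    rintro s t ⟨q, hq, h⟩
    rcases hq with hq | ⟨h₁, h₂, h₃⟩
    · rcases ih h with h | ⟨l₁, x, l₂, rfl, h'⟩
      · exact Or.inl ⟨q, hq, h⟩
      · exact Or.inr ⟨z :: l₁, x, l₂, rfl, q, hq, h'⟩
    · obtain ⟨z₁, z₂⟩ := z
      simp only at h₁ h₂ h₃
      subst h₁ h₂ h₃
      exact Or.inr ⟨[], z₁, l, rfl, rfl⟩

/-- Welding may cut the path of a rule into pieces at `0`. One of the pieces is still a rule of the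
automaton: the last piece if the sides have different lengths, the first if they have the same
length. -/
lemma Threads.exists_rule [LinearOrder A] {arr : Finset (Arrow A)} (harr : NoBaseLoop arr)
    {r : Rule A} (h : Threads arr r) (hr : r ∈ SL2) : ∃ r' ∈ SetOfRules arr, r'.1 <:+: r.1 := by
  obtain ⟨u, v⟩ := r
  obtain ⟨hlt, hlen, hfirst⟩ := hr
  simp only at hlt hlen hfirst
  have hle : v.length ≤ u.length := by
    rcases slt_iff.1 hlt with h | h
    · exact h.le
    · exact h.1.le
  rcases hle.lt_or_eq with hne | heq
  · rcases HasPath.last_loop h with h | ⟨l₁, x, l₂, hl, h⟩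
    · exact ⟨(u, v), ⟨mem_accepts_iff.2 h, hlt, hlen, hfirst⟩, List.infix_rfl⟩
    · rw [List.append_cons] at hl
      have hpad := (pad_eq_append hl).2
      set k := (l₁ ++ [(x, x)]).length with hk
      have hk' : k ≤ max u.length v.length := by
        have := congrArg List.length hl
        rw [length_pad, List.length_append] at this
        simp only at this
        omega
      have hkv : k ≤ v.length := by
        -- the letter before the last piece is not padded, as its two components agree
        have h1 := (pad_eq_append (hl.trans (List.append_assoc _ _ _))).2
        have h2 := take_one_of_pad (h1.symm.trans (List.singleton_append))
        have hlen' := congrArg List.length (h2.1.trans h2.2.symm)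
        simp only [List.length_take, List.length_drop] at hlen'
        simp only [hk, List.length_append, List.length_singleton] at hk' ⊢
        omega
      refine ⟨(u.drop k, v.drop k), ⟨mem_accepts_iff.2 (hpad ▸ h), ?_, ?_, ?_⟩,
        (List.drop_suffix k u).isInfix⟩
      · refine slt_iff.2 (Or.inl ?_)
        simp only [List.length_drop]
        omega
      · simp only [List.length_drop]
        omega
      · rintro ⟨y, ⟨u', hu'⟩, ⟨v', hv'⟩⟩
        simp only at hu' hv'
        rw [← hu', ← hv'] at hpad
        subst hpad
        obtain ⟨q, hq, -⟩ := h
        exact harr _ _ hq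
  · rcases HasPath.first_loop h with h | ⟨l₁, x, l₂, hl, h⟩
    · exact ⟨(u, v), ⟨mem_accepts_iff.2 h, hlt, hlen, hfirst⟩, List.infix_rfl⟩
    · have hpad := (pad_eq_append hl).1
      refine ⟨(u.take l₁.length, v.take l₁.length), ⟨mem_accepts_iff.2 (hpad ▸ h), ?_, ?_, ?_⟩,
        (List.take_prefix _ u).isInfix⟩
      · have hlex : v < u := by
          rcases slt_iff.1 hlt with h | h
          · omega
          · exact h.2
        refine slt_iff.2 (Or.inr ⟨by simp [heq], ?_⟩)
        cases u with
        | nil => exact absurd hlex (List.not_lt_nil _)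
        | cons a u =>
          cases v with
          | nil => simp at heq
          | cons b v =>
            have hab : b ≠ a := by
              rintro rfl
              exact hfirst ⟨b, ⟨u, rfl⟩, ⟨v, rfl⟩⟩
            cases l₁ with
            | nil =>
              rw [pad_cons_cons, List.nil_append, List.cons.injEq, Prod.mk.injEq] at hl
              exact absurd (Option.some.inj (hl.1.2.trans hl.1.1.symm)) hab
            | cons z l₁ =>
              rw [List.cons_lt_cons_iff] at hlex
              simp only [List.length_cons, List.take_succ_cons]
              rw [List.cons_lt_cons_iff]
              rcases hlex with hlex | hlex
              · exact Or.inl hlex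
              · exact absurd hlex.1 hab
      · simp only [List.length_take]
        omega
      · rintro ⟨y, hu', hv'⟩
        exact hfirst ⟨y, hu'.trans (List.take_prefix _ u), hv'.trans (List.take_prefix _ v)⟩

end Threads

/-! ### The soundness of the automaton `WDiff` -/

section WDiffInvariant

variable {inv : A → A} {R : Finset (Rule A)}

variable (inv R) in
/-- The invariants of the automaton `WDiff`: the needed arrows are arrows, no loops labelled
`(x, x)` are kept at `0`, and the words attached to the states are correct in the group. -/
structure WDiffSound (W : WDiff A) : Prop where
  needed_subset : W.needed ⊆ W.arrows
  noBaseLoop : NoBaseLoop W.arrows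
  labelsValid : LabelsValid inv R W

lemma WDiffSound.relabels {S : Set (Rule A)} (hS : Valid inv R S) {W W' : WDiff A}
    (hW : WDiffSound inv R W) (h : Relabels S W W') : WDiffSound inv R W' :=
  ⟨by rw [h.1, h.2.1]; exact hW.1, by rw [h.1]; exact hW.2, hW.3.relabels hS h⟩

variable [LinearOrder A]

lemma WDiffSound.incorporates {rules : Finset (Arrow A)} (hS : Valid inv R (SetOfRules rules))
    {W W' : WDiff A} {r : Rule A} (hr : value inv R r.1 = value inv R r.2)
    (hW : WDiffSound inv R W) (h : Incorporates inv rules r W W') : WDiffSound inv R W' := by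
  obtain ⟨W₁, h₁, h₂⟩ := h
  refine WDiffSound.relabels hS ⟨?_, ?_, ?_⟩ h₂
  · exact h₁.needed_subset (addPath_needed_subset inv r hW.needed_subset)
  · exact h₁.noBaseLoop
  · exact (hW.labelsValid.addPath hr).welding (fun _ _ => False.elim) h₁

lemma Incorporates.threads {rules : Finset (Arrow A)} {W W' : WDiff A} {r r' : Rule A}
    (h : Incorporates inv rules r W W') (hr' : r' = r ∨ Threads W.needed r') :
    Threads W'.needed r' := by
  obtain ⟨W₁, h₁, h₂⟩ := h
  rw [h₂.2.1]
  refine h₁.threads ?_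
  rcases hr' with rfl | hr'
  · exact threads_addPath inv W _
  · exact hr'.mono (subset_addPath_needed inv r)

lemma WDiffSound.amalgamates {W W' : WDiff A} (hW : WDiffSound inv R W)
    (h : Amalgamates W W') : WDiffSound inv R W' := by
  obtain ⟨W₁, h₁, h₂⟩ := h
  have hW₁ := hW.relabels hW.labelsValid.valid h₁
  refine ⟨h₂.needed_subset hW₁.needed_subset, h₂.noBaseLoop, hW₁.labelsValid.welding ?_ h₂⟩
  rintro s t ⟨-, -, h⟩
  rw [h]

lemma Amalgamates.threads {W W' : WDiff A} (h : Amalgamates W W') {r : Rule A}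
    (hr : Threads W.needed r) : Threads W'.needed r := by
  obtain ⟨W₁, h₁, h₂⟩ := h
  rw [← h₁.2.1] at hr
  exact h₂.threads hr

end WDiffInvariant

/-! ### Invariants of the data -/

section DataInvariant

/-- The rules of `S` which are not only in `Delete`. -/
def Data.live (d : Data A) : Set (Rule A) := {r | r ∈ d.considered ∨ r ∈ d.now ∨ r ∈ d.new}

variable [LinearOrder A] [Fintype A]

/-- The set `S` of explicit rules, as a set. -/
abbrev Data.rulesOf (d : Data A) : Set (Rule A) := {r | r ∈ d.store}

lemma mem_store {d : Data A} {r : Rule A} : r ∈ d.store ↔ r ∈ d.live ∨ r ∈ d.delete := by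
  simp [Data.store, Data.live, or_assoc]

lemma live_subset_rulesOf (d : Data A) : d.live ⊆ d.rulesOf := fun _ h => mem_store.2 (Or.inl h)

variable (inv : A → A) (R : Finset (Rule A))

/-- The invariants of the data: the explicit rules are oriented, they and the rules of `Rules` hold in
the group, and the live rules alone yield all explicit rules `(l, r)` by conversions through words
up to `l`, as well as `x · inv x = 1` by conversions through words up to `x · inv x`. The latter is
what justifies moving a letter from one side of a rule to the other in the minimization routine. -/
structure DataSound (d : Data A) : Prop where
  oriented : Oriented d.rulesOf
  valid : Valid inv R d.rulesOf
  rules_valid : Valid inv R (SetOfRules d.rules)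
  wdiff : WDiffSound inv R d.wdiff
  store_conv : ∀ r ∈ d.store, Conv d.live (rk r.1 + 1) r.1 r.2
  inv_conv : ∀ x, Conv d.live (rk [x, inv x] + 1) [x, inv x] []

/-- `d'` arises from `d` by inserting into `New` rules with the property `Q`, none of which was an
explicit rule of `d`. -/
structure Extends (Q : Rule A → Prop) (d d' : Data A) : Prop where
  considered_eq : d'.considered = d.considered
  now_eq : d'.now = d.now
  delete_eq : d'.delete = d.delete
  rules_eq : d'.rules = d.rules
  wdiff_eq : d'.wdiff = d.wdiff
  new_subset : d.new ⊆ d'.new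
  mem_new : ∀ r ∈ d'.new, r ∈ d.new ∨ Q r ∧ r ∉ d.store

variable {inv R} {Q Q' : Rule A → Prop} {d d' d'' : Data A}

lemma Extends.refl (d : Data A) : Extends Q d d :=
  ⟨rfl, rfl, rfl, rfl, rfl, subset_rfl, fun _ h => Or.inl h⟩

lemma Extends.mono (hQ : ∀ r, Q r → Q' r) (h : Extends Q d d') : Extends Q' d d' :=
  ⟨h.1, h.2, h.3, h.4, h.5, h.6, fun r hr => (h.7 r hr).imp id fun h' => ⟨hQ r h'.1, h'.2⟩⟩

lemma Extends.live_subset (h : Extends Q d d') : d.live ⊆ d'.live := by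
  intro r hr
  simp only [Data.live, Set.mem_ofPred_eq, h.considered_eq, h.now_eq] at *
  exact hr.imp id (Or.imp id fun h' => h.new_subset h')

lemma Extends.store_subset (h : Extends Q d d') : d.store ⊆ d'.store := by
  intro r hr
  rw [mem_store] at *
  rw [h.delete_eq]
  exact hr.imp (fun h' => h.live_subset h') id

lemma Extends.trans (h : Extends Q d d') (h' : Extends Q d' d'') : Extends Q d d'' := by
  refine ⟨h'.1.trans h.1, h'.2.trans h.2, h'.3.trans h.3, h'.4.trans h.4, h'.5.trans h.5,
    h.6.trans h'.6, fun r hr => ?_⟩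
  rcases h'.mem_new r hr with hr | ⟨hr, hn⟩
  · exact h.mem_new r hr
  · exact Or.inr ⟨hr, fun hs => hn (h.store_subset hs)⟩

lemma Extends.mem_live (h : Extends Q d d') {r : Rule A} (hr : r ∈ d'.live) :
    r ∈ d.live ∨ Q r ∧ r ∈ d'.new ∧ r ∉ d.store := by
  simp only [Data.live, Set.mem_ofPred_eq, h.considered_eq, h.now_eq] at *
  rcases hr with hr | hr | hr
  · exact Or.inl (Or.inl hr)
  · exact Or.inl (Or.inr (Or.inl hr))
  · rcases h.mem_new r hr with h' | ⟨h', h''⟩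
    · exact Or.inl (Or.inr (Or.inr h'))
    · exact Or.inr ⟨h', hr, h''⟩

lemma Extends.mem_store (h : Extends Q d d') {r : Rule A} (hr : r ∈ d'.store) :
    r ∈ d.store ∨ Q r ∧ r ∈ d'.live := by
  rw [KnuthBendix.mem_store] at hr
  rcases hr with hr | hr
  · rcases h.mem_live hr with h' | ⟨h', -⟩
    · exact Or.inl (live_subset_rulesOf d h')
    · exact Or.inr ⟨h', hr⟩
  · rw [h.delete_eq] at hr
    exact Or.inl (KnuthBendix.mem_store.2 (Or.inr hr))

lemma Extends.addNew (d : Data A) {r : Rule A} (hr : Q r) : Extends Q d (d.addNew r) := by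
  unfold Data.addNew
  split_ifs with h
  · exact Extends.refl d
  · refine ⟨rfl, rfl, rfl, rfl, rfl, Finset.subset_insert _ _, fun r' hr' => ?_⟩
    rcases Finset.mem_insert.1 hr' with rfl | hr'
    · exact Or.inr ⟨hr, h⟩
    · exact Or.inl hr'

lemma mem_store_addNew (d : Data A) (r : Rule A) : r ∈ (d.addNew r).store := by
  unfold Data.addNew
  split_ifs with h
  · exact h
  · simp [Data.store]

lemma DataSound.extends (hd : DataSound inv R d) (h : Extends Q d d')
    (hQ : ∀ r, Q r → rk r.2 < rk r.1 ∧ value inv R r.1 = value inv R r.2) :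
    DataSound inv R d' := by
  refine ⟨fun r hr => ?_, fun r hr => ?_, ?_, ?_, fun r hr => ?_, fun x => ?_⟩
  · rcases h.mem_store hr with hr | hr
    · exact hd.oriented r hr
    · exact (hQ r hr.1).1
  · rcases h.mem_store hr with hr | hr
    · exact hd.valid r hr
    · exact (hQ r hr.1).2
  · rw [h.rules_eq]; exact hd.rules_valid
  · rw [h.wdiff_eq]; exact hd.wdiff
  · rcases h.mem_store hr with hr | hr
    · exact (hd.store_conv r hr).mono h.live_subset le_rfl
    · exact Conv.of_elemRed (ElemRed.of_mem hr.2) (by omega) (by have := (hQ r hr.1).1; omega)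
  · exact (hd.inv_conv x).mono h.live_subset le_rfl

/-! ### `Aut`-reduction -/

/-- The rules which `Aut`-reduction of a word of rank at most `n` may find. -/
def Found (rules : Finset (Arrow A)) (n : ℕ) (r : Rule A) : Prop :=
  r ∈ SetOfRules rules ∧ rk r.1 ≤ n

lemma rk_of_mem_SL2 {r : Rule A} (h : r ∈ SL2) : rk r.2 < rk r.1 := rk_lt.2 h.1

lemma DataSound.found (hd : DataSound inv R d) {n : ℕ} (h : Extends (Found d.rules n) d d') :
    DataSound inv R d' :=
  hd.extends h fun r hr => ⟨rk_of_mem_SL2 hr.1.2, hd.rules_valid r hr.1⟩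

lemma AutStep.spec {p q : Data A × Word A} (h : AutStep p q) (hp : DataSound inv R p.1) :
    Extends (Found p.1.rules (rk p.2)) p.1 q.1 ∧ ElemRed q.1.rulesOf p.2 q.2 := by
  cases h with
  | stored d a l b ρ h₁ h₂ h₃ => exact ⟨Extends.refl d, (l, ρ), h₃.1, a, b, rfl, rfl⟩
  | found d a l b ρ h₁ h₂ h₃ h₄ =>
    have hr : Found d.rules (rk (a ++ l ++ b)) (l, ρ) := ⟨h₄.1, rk_infix ⟨a, b, rfl⟩⟩
    exact ⟨Extends.addNew d hr, (l, ρ), mem_store_addNew d _, a, b, rfl, rfl⟩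

lemma AutStep.rk_lt {p q : Data A × Word A} (h : AutStep p q) (hp : DataSound inv R p.1) :
    rk q.2 < rk p.2 :=
  (hp.found (h.spec hp).1).oriented.rk_lt (h.spec hp).2

lemma autSteps_spec {p q : Data A × Word A} (h : Relation.ReflTransGen AutStep p q)
    (hp : DataSound inv R p.1) :
    Extends (Found p.1.rules (rk p.2)) p.1 q.1 ∧ rk q.2 ≤ rk p.2 ∧
      Conv q.1.live (rk p.2 + 1) p.2 q.2 ∧ value inv R p.2 = value inv R q.2 := by
  induction h with
  | refl => exact ⟨Extends.refl _, le_rfl, Conv.refl _, rfl⟩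
  | @tail q t _ hs ih =>
    obtain ⟨h₁, h₂, h₃, h₄⟩ := ih
    have hq := hp.found h₁
    obtain ⟨h₅, h₆⟩ := hs.spec hq
    have ht := hq.found h₅
    have hlt := hs.rk_lt hq
    refine ⟨h₁.trans (h₅.mono ?_), by omega, ?_, ?_⟩
    · rw [h₁.rules_eq]
      exact fun r hr => ⟨hr.1, hr.2.trans h₂⟩
    · refine (h₃.mono h₅.live_subset le_rfl).trans ?_
      refine Conv.subst (S := t.1.rulesOf) (fun r hr _ => ht.store_conv r hr) ?_
      exact Conv.of_elemRed h₆ (by omega) (by omega)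
    · rw [h₄, ht.valid.elemRed h₆]

lemma AutReduces.spec {w w' : Word A} (h : AutReduces d w d' w') (hd : DataSound inv R d) :
    Extends (Found d.rules (rk w)) d d' ∧ rk w' ≤ rk w ∧ Conv d'.live (rk w + 1) w w' ∧
      value inv R w = value inv R w' ∧ ¬ AutReducible d.rules w' := by
  obtain ⟨h₁, h₂⟩ := h
  obtain ⟨h₃, h₄, h₅, h₆⟩ := autSteps_spec h₁ hd
  refine ⟨h₃, h₄, h₅, h₆, ?_⟩
  rw [← h₃.rules_eq]
  exact h₂

lemma AutReduces.rk_lt {w w' : Word A} (h : AutReduces d w d' w') (hd : DataSound inv R d)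
    (hw : w' ≠ w) : rk w' < rk w :=
  lt_of_le_of_ne (h.spec hd).2.1 fun e => hw (rk_inj.1 e)

end DataInvariant

/-! ### The minimization routine -/

section Minimization

variable [LinearOrder A] [Fintype A]

/-- The maximal rank of the two words of a pair. -/
noncomputable def top (r : Rule A) : ℕ := max (rk r.1) (rk r.2)

lemma rk_fst_le_top (r : Rule A) : rk r.1 ≤ top r := le_max_left _ _

lemma rk_snd_le_top (r : Rule A) : rk r.2 ≤ top r := le_max_right _ _

/-- The two words of the pair `r` are connected by the rules of `S`, through words not above the
larger of the two. -/
def Joined (S : Set (Rule A)) (r : Rule A) : Prop := Conv S (top r + 1) r.1 r.2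

lemma Joined.reduce {S : Set (Rule A)} {r r' : Rule A} (h : Joined S r') (ht : top r' ≤ top r)
    (h₁ : Conv S (top r + 1) r.1 r'.1) (h₂ : Conv S (top r + 1) r.2 r'.2) : Joined S r :=
  (h₁.trans (h.mono subset_rfl (by omega))).trans h₂.symm

lemma top_swap (u v : Word A) : top (v, u) = top (u, v) := max_comm _ _

lemma Joined.swap {S : Set (Rule A)} {u v : Word A} (h : Joined S (v, u)) : Joined S (u, v) := by
  have := Conv.symm h
  rwa [top_swap] at this

lemma top_context (a b u v : Word A) {x : Word A} (hx : rk x < top (u, v) + 1) :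
    rk (a ++ x ++ b) < top (a ++ u ++ b, a ++ v ++ b) + 1 := by
  have h₁ := rk_context_le (u := x) (v := u) a b
  have h₂ := rk_context_le (u := x) (v := v) a b
  simp only [top] at *
  omega

lemma Joined.context {S : Set (Rule A)} {u v : Word A} (a b : Word A) (h : Joined S (u, v)) :
    Joined S (a ++ u ++ b, a ++ v ++ b) :=
  Conv.context a b h fun _ hx => top_context a b u v hx

variable {inv : A → A}

lemma ShortenCond.rk_lt {u v : Word A} {x : A} (h : ShortenCond inv (u ++ [x], v)) :
    rk (v ++ [inv x]) < rk u := by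
  rcases h with h | ⟨h, a, u', b, v', he, hlt⟩ | ⟨a, b, he, hlt⟩
  · refine rk_lt_of_length ?_
    simp only [List.length_append, List.length_singleton] at h ⊢
    omega
  · simp only [Prod.mk.injEq] at he
    obtain ⟨he, rfl⟩ := he
    cases u with
    | nil => simp at h
    | cons c u =>
      rw [List.cons_append, List.cons.injEq] at he
      obtain ⟨rfl, -⟩ := he
      refine rk_lt_of_head ?_ hlt
      simp at h ⊢
      omega
  · simp only [Prod.mk.injEq] at he
    obtain ⟨he, rfl⟩ := he
    have : u = [a] ∧ x = b := by
      cases u with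
      | nil => simp at he
      | cons c u =>
        simp only [List.cons_append, List.cons.injEq] at he
        obtain ⟨rfl, he⟩ := he
        cases u with
        | nil => simpa using he
        | cons c u => simp at he
    obtain ⟨rfl, rfl⟩ := this
    exact rk_lt_of_head rfl hlt

lemma Joined.shorten {S : Set (Rule A)} {u v : Word A} {x : A}
    (hlt : rk (v ++ [inv x]) < rk u)
    (hS : rk [inv x, x] < top (u ++ [x], v) → Conv S (rk [inv x, x] + 1) [inv x, x] [])
    (h : Joined S (u, v ++ [inv x])) : Joined S (u ++ [x], v) := by
  have h₁ : rk (v ++ [inv x, x]) < rk (u ++ [x]) := by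
    have := (rk_snoc_lt x).2 hlt
    simpa using this
  have h₂ : rk [inv x, x] ≤ rk (v ++ [inv x, x]) := rk_infix ⟨v, [], by simp⟩
  have h₃ := rk_fst_le_top (u ++ [x], v)
  simp only at h₃
  have c₁ : Conv S (top (u ++ [x], v) + 1) (u ++ [x]) (v ++ [inv x, x]) := by
    have := h.context [] [x]
    simp only [List.nil_append, List.append_assoc, List.cons_append] at this
    refine Conv.mono subset_rfl ?_ this
    simp only [top] at *
    omega
  have c₂ : Conv S (top (u ++ [x], v) + 1) (v ++ [inv x, x]) v := by
    have := (hS (by omega)).context_le (n := top (u ++ [x], v) + 1) v [] (by simp; omega)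
    simpa using this
  exact c₁.trans c₂

lemma Joined.rotate {S : Set (Rule A)} {u v : Word A} {x : A}
    (hlt : rk (inv x :: v) < rk u)
    (hS : rk [x, inv x] < top (x :: u, v) → Conv S (rk [x, inv x] + 1) [x, inv x] [])
    (h : Joined S (u, inv x :: v)) : Joined S (x :: u, v) := by
  have h₁ : rk (x :: inv x :: v) < rk (x :: u) := (rk_cons_lt x).2 hlt
  have h₂ : rk [x, inv x] ≤ rk (x :: inv x :: v) := rk_infix ⟨[], v, by simp⟩
  have h₃ := rk_fst_le_top (x :: u, v)
  simp only at h₃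
  have c₁ : Conv S (top (x :: u, v) + 1) (x :: u) (x :: inv x :: v) := by
    have := h.context [x] []
    simp only [List.append_nil, List.cons_append, List.nil_append] at this
    refine Conv.mono subset_rfl ?_ this
    simp only [top] at *
    omega
  have c₂ : Conv S (top (x :: u, v) + 1) (x :: inv x :: v) v := by
    have := (hS (by omega)).context_le (n := top (x :: u, v) + 1) [] v (by simp; omega)
    simpa using this
  exact c₁.trans c₂

variable (inv) (R : Finset (Rule A))

/-- How the current pair of the minimization routine is related to the rule `input`: either it is
below the left-hand side of `input`, or that left-hand side is still present. It holds in the group,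
and `input` follows from it by the live rules with smaller left-hand side. -/
structure PairInv (d : Data A) (input cur : Rule A) : Prop where
  order : top cur < rk input.1 ∨ cur.1 = input.1 ∧ rk cur.2 ≤ rk input.2
  joined : ∀ S, {r | r ∈ d.live ∧ rk r.1 < rk input.1} ⊆ S → Joined S cur →
    Conv S (rk input.1 + 1) input.1 input.2
  value_eq : value inv R cur.1 = value inv R cur.2

variable {inv R} {d d' : Data A} {input cur : Rule A}

lemma PairInv.top_le (h : PairInv inv R d input cur) (hin : rk input.2 < rk input.1) :
    top cur ≤ rk input.1 := by
  rcases h.order with h' | ⟨h', h''⟩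
  · exact h'.le
  · rw [top, h']
    omega

lemma PairInv.start (h : value inv R input.1 = value inv R input.2)
    (hin : rk input.2 < rk input.1) : PairInv inv R d input input := by
  refine ⟨Or.inr ⟨rfl, le_rfl⟩, fun S _ hS => ?_, h⟩
  have : top input = rk input.1 := max_eq_left hin.le
  rwa [Joined, this] at hS

lemma PairInv.mono {Q : Rule A → Prop} (hd : Extends Q d d') (h : PairInv inv R d input cur) :
    PairInv inv R d' input cur :=
  ⟨h.order, fun S hS => h.joined S fun _ hr => hS ⟨hd.live_subset hr.1, hr.2⟩, h.value_eq⟩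

/-- A change of the pair to words which are strictly smaller than the larger one before. -/
lemma PairInv.step_lt {cur' : Rule A} (h : PairInv inv R d input cur)
    (hin : rk input.2 < rk input.1) (ht : top cur' < top cur)
    (hj : ∀ S, {r | r ∈ d.live ∧ rk r.1 < rk input.1} ⊆ S → Joined S cur' → Joined S cur)
    (hv : value inv R cur'.1 = value inv R cur'.2) : PairInv inv R d input cur' :=
  ⟨Or.inl (ht.trans_le (h.top_le hin)), fun S hS hc => h.joined S hS (hj S hS hc), hv⟩

/-- Reduction inside the left-hand side. -/
lemma PairInv.reduce_left {a b u u' v : Word A} (hd : DataSound inv R d)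
    (hin : rk input.2 < rk input.1) (h : PairInv inv R d input (a ++ u ++ b, v))
    (hu : rk u < rk input.1) (hr : AutReduces d u d' u') :
    PairInv inv R d' input (a ++ u' ++ b, v) := by
  obtain ⟨h₁, h₂, h₃, h₄, -⟩ := hr.spec hd
  have h' := h.mono h₁
  have hle := (rk_context_le (u := u') (v := u) a b).2 h₂
  have ht : top (a ++ u' ++ b, v) ≤ top (a ++ u ++ b, v) := by
    simp only [top]
    omega
  refine ⟨?_, fun S hS hc => h'.joined S hS (hc.reduce ht ?_ (Conv.refl _)), ?_⟩
  · rcases h.order with ho | ⟨ho, ho'⟩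
    · exact Or.inl (ht.trans_lt ho)
    · simp only at ho ho'
      by_cases hu' : u' = u
      · subst hu'
        exact Or.inr ⟨ho, ho'⟩
      · left
        have := (rk_context_lt (u := u') (v := u) a b).2 (hr.rk_lt hd hu')
        rw [ho] at this
        simp only [top]
        omega
  · refine Conv.context_le (w := u) a b ?_ (Nat.lt_succ_of_le (rk_fst_le_top (_, _)))
    exact h₃.restrict.mono (fun r hr => hS ⟨hr.1, by have := hr.2; omega⟩) le_rfl
  · have := h.value_eq
    simp only [value_append] at this ⊢
    rw [← h₄, this]

/-- Reduction of the right-hand side. -/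
lemma PairInv.reduce_right {u v v' : Word A} (hd : DataSound inv R d)
    (hin : rk input.2 < rk input.1) (h : PairInv inv R d input (u, v))
    (hr : AutReduces d v d' v') : PairInv inv R d' input (u, v') := by
  obtain ⟨h₁, h₂, h₃, h₄, -⟩ := hr.spec hd
  have h' := h.mono h₁
  have ht : top (u, v') ≤ top (u, v) := by
    simp only [top]
    omega
  have hv : rk v < rk input.1 := by
    rcases h.order with ho | ⟨-, ho'⟩
    · exact (rk_snd_le_top (u, v)).trans_lt ho
    · simp only at ho'
      omega
  refine ⟨?_, fun S hS hc => h'.joined S hS (hc.reduce ht (Conv.refl _) ?_), ?_⟩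
  · rcases h.order with ho | ⟨ho, ho'⟩
    · exact Or.inl (ht.trans_lt ho)
    · exact Or.inr ⟨ho, h₂.trans ho'⟩
  · have := rk_snd_le_top (u, v)
    simp only at this
    refine (h₃.restrict.mono (T := S) ?_ (by omega))
    exact fun r hr => hS ⟨hr.1, by have := hr.2; omega⟩
  · exact h.value_eq.trans h₄

lemma DataSound.conv_inv (hd : DataSound inv R d) {n : ℕ} {x : A} (hx : rk [x, inv x] < n)
    {S : Set (Rule A)} (hS : {r | r ∈ d.live ∧ rk r.1 < n} ⊆ S) :
    Conv S (rk [x, inv x] + 1) [x, inv x] [] :=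
  (hd.inv_conv x).restrict.mono (fun r hr => hS ⟨hr.1, by have := hr.2; omega⟩) le_rfl

lemma PairInv.swap {u v : Word A} (h : PairInv inv R d input (u, v))
    (hin : rk input.2 < rk input.1) (huv : rk u < rk v) : PairInv inv R d input (v, u) := by
  refine ⟨?_, fun S hS hc => h.joined S hS hc.swap, h.value_eq.symm⟩
  rcases h.order with ho | ⟨ho, ho'⟩
  · rw [top_swap]
    exact Or.inl ho
  · simp only at ho ho'
    rw [← ho] at hin
    omega

lemma top_of_le {u v : Word A} (h : rk v ≤ rk u) : top (u, v) = rk u := max_eq_left h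

lemma PairInv.shorten (hinv : Function.Involutive inv) {u v : Word A} {x : A}
    (hd : DataSound inv R d) (hin : rk input.2 < rk input.1)
    (h : PairInv inv R d input (u ++ [x], v)) (hlt : rk (v ++ [inv x]) < rk u) :
    PairInv inv R d input (u, v ++ [inv x]) := by
  have hux : rk u < rk (u ++ [x]) := rk_lt_of_length (by simp)
  have ht := rk_fst_le_top (u ++ [x], v)
  have ht' := h.top_le hin
  simp only at ht
  refine h.step_lt hin ?_ (fun S hS hc => hc.shorten hlt fun hx => ?_) ?_
  · rw [top_of_le hlt.le]
    omega
  · have := hd.conv_inv (x := inv x) (n := rk input.1) (by rw [hinv x]; omega) hS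
    rwa [hinv x] at this
  · have := h.value_eq
    simp only [value_append, value_inv] at this ⊢
    rw [← this, mul_inv_cancel_right]

lemma PairInv.rotate {u v : Word A} {x : A}
    (hd : DataSound inv R d) (hin : rk input.2 < rk input.1)
    (h : PairInv inv R d input (x :: u, v)) (hlt : rk (inv x :: v) < rk u) :
    PairInv inv R d input (u, inv x :: v) := by
  have hux : rk u < rk (x :: u) := rk_lt_of_length (by simp)
  have ht := rk_fst_le_top (x :: u, v)
  have ht' := h.top_le hin
  simp only at ht
  refine h.step_lt hin ?_ (fun S hS hc => hc.rotate hlt fun hx => ?_) ?_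
  · rw [top_of_le hlt.le]
    omega
  · exact hd.conv_inv (by omega) hS
  · have := h.value_eq
    simp only [value_cons x u] at this
    simp only [value_cons (inv x) v, value_inv]
    rw [← this, inv_mul_cancel_left]

lemma top_cons_lt (x : A) (u v : Word A) : top (u, v) < top (x :: u, x :: v) := by
  have h₁ : rk u < rk (x :: u) := rk_lt_of_length (by simp)
  have h₂ : rk v < rk (x :: v) := rk_lt_of_length (by simp)
  simp only [top]
  omega

lemma top_snoc_lt (x : A) (u v : Word A) : top (u, v) < top (u ++ [x], v ++ [x]) := by
  have h₁ : rk u < rk (u ++ [x]) := rk_lt_of_length (by simp)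
  have h₂ : rk v < rk (v ++ [x]) := rk_lt_of_length (by simp)
  simp only [top]
  omega

lemma PairInv.cancel_first {u v : Word A} {x : A} (hin : rk input.2 < rk input.1)
    (h : PairInv inv R d input (x :: u, x :: v)) : PairInv inv R d input (u, v) := by
  refine h.step_lt hin (top_cons_lt x u v) (fun S hS hc => ?_) ?_
  · simpa using hc.context [x] []
  · have := h.value_eq
    simp only [value_cons x u, value_cons x v] at this
    exact mul_left_cancel this

lemma PairInv.cancel_last {u v : Word A} {x : A} (hin : rk input.2 < rk input.1)
    (h : PairInv inv R d input (u ++ [x], v ++ [x])) : PairInv inv R d input (u, v) := by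
  refine h.step_lt hin (top_snoc_lt x u v) (fun S hS hc => ?_) ?_
  · simpa using hc.context [] [x]
  · have := h.value_eq
    simp only [value_append] at this
    exact mul_right_cancel this

end Minimization

/-! ### The steps of the minimization routine -/

section Frames

/-- The position of a line in the minimization routine. -/
def MinLine.index : MinLine → ℕ
  | reducePrefix => 0
  | reduceSuffix => 1
  | reduceLeft => 2
  | reduceRight => 3
  | orient => 4
  | shorten => 5
  | rotate => 6
  | cancelFirst => 7
  | cancelLast => 8
  | loop => 9
  | output => 10

variable [LinearOrder A] [Fintype A]

/-- A number which decreases whenever the minimization routine changes the current pair: lowering the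
larger word outweighs any growth of the smaller one, and an interchange puts the larger word on the
left. -/
noncomputable def weight (r : Rule A) : ℕ :=
  2 * (2 ^ rk r.1 + 2 ^ rk r.2) + if rk r.1 < rk r.2 then 1 else 0

lemma weight_lt_of_top {r r' : Rule A} (h : top r' < top r) : weight r' < weight r := by
  have key : ∀ n, n < top r → 2 * 2 ^ n ≤ 2 ^ top r := fun n hn => by
    rw [← pow_succ']
    exact Nat.pow_le_pow_right (by norm_num) hn
  have h₁ := key _ ((rk_fst_le_top r').trans_lt h)
  have h₂ := key _ ((rk_snd_le_top r').trans_lt h)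
  have h₃ : 2 ^ top r + 1 ≤ 2 ^ rk r.1 + 2 ^ rk r.2 := by
    have p₁ : 1 ≤ 2 ^ rk r.1 := Nat.one_le_two_pow
    have p₂ : 1 ≤ 2 ^ rk r.2 := Nat.one_le_two_pow
    rcases max_choice (rk r.1) (rk r.2) with e | e <;> rw [top, e] <;> omega
  unfold weight
  split_ifs <;> omega

lemma weight_lt_of_le {r r' : Rule A} (h₁ : rk r'.1 ≤ rk r.1) (h₂ : rk r'.2 ≤ rk r.2)
    (h : r' ≠ r) : weight r' < weight r := by
  have p₁ : 2 ^ rk r'.1 ≤ 2 ^ rk r.1 := Nat.pow_le_pow_right (by norm_num) h₁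
  have p₂ : 2 ^ rk r'.2 ≤ 2 ^ rk r.2 := Nat.pow_le_pow_right (by norm_num) h₂
  have : 2 ^ rk r'.1 + 2 ^ rk r'.2 < 2 ^ rk r.1 + 2 ^ rk r.2 := by
    rcases h₁.lt_or_eq with h₁ | h₁
    · have : 2 ^ rk r'.1 < 2 ^ rk r.1 := Nat.pow_lt_pow_right (by norm_num) h₁
      omega
    · rcases h₂.lt_or_eq with h₂ | h₂
      · have : 2 ^ rk r'.2 < 2 ^ rk r.2 := Nat.pow_lt_pow_right (by norm_num) h₂
        omega
      · exact absurd (Prod.ext (rk_inj.1 h₁) (rk_inj.1 h₂)) h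
  unfold weight
  split_ifs <;> omega

lemma weight_swap_lt {u v : Word A} (h : rk u < rk v) : weight (v, u) < weight (u, v) := by
  simp only [weight]
  rw [if_pos h, if_neg (by omega)]
  omega

variable (inv : A → A) (R : Finset (Rule A))

/-- The invariants inside the minimization routine; most of them hold from a certain line on. By
`proper`, the left-hand side of `input` is lost if it has an `Aut`-reducible proper subword; by
`saved`, the pair gets smaller in each round of the loop; the last three fields make the output a
rule in the language of `SL2` unless it is trivial. -/
structure FrameInv (d : Data A) (input : Rule A) (f : Frame A) : Prop where
  pair : PairInv inv R d input f.cur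
  start : f.line.index ≤ 1 → f.cur = input
  prefix_irr : f.line.index = 1 → ∀ u x, input.1 = u ++ [x] → ¬ AutReducible d.rules u
  proper : 2 ≤ f.line.index → ProperSubwordReducible d.rules input.1 → top f.cur < rk input.1
  rhs_irr : 4 ≤ f.line.index → ¬ AutReducible d.rules f.saved.2
  saved : 4 ≤ f.line.index → f.cur = f.saved ∨ weight f.cur < weight f.saved
  done : f.line.index = 10 → f.cur = f.saved
  le : 5 ≤ f.line.index → rk f.cur.2 ≤ rk f.cur.1
  length_le : 6 ≤ f.line.index → f.cur.1.length ≤ f.cur.2.length + 2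
  first : 8 ≤ f.line.index → ¬ ∃ x u v, f.cur = (x :: u, x :: v)

variable {inv R} {d d' : Data A} {input : Rule A} {f f' : Frame A}

lemma AutReducible.of_infix {rules : Finset (Arrow A)} {u w : Word A} (h : AutReducible rules u)
    (hu : u <:+: w) : AutReducible rules w := fun hw => h (hw.infix hu)

lemma infix_of_ne {s w : Word A} (h : s <:+: w) (hne : s ≠ w) :
    (∃ u x, w = u ++ [x] ∧ s <:+: u) ∨ ∃ x u, w = x :: u ∧ s <:+: u := by
  obtain ⟨a, b, rfl⟩ := h
  cases a with
  | cons x a => exact Or.inr ⟨x, a ++ s ++ b, by simp, a, b, rfl⟩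
  | nil =>
    rcases List.eq_nil_or_concat b with rfl | ⟨b', x, rfl⟩
    · simp at hne
    · refine Or.inl ⟨s ++ b', x, by simp, [], b', by simp⟩

lemma FrameInv.begin (h : value inv R input.1 = value inv R input.2)
    (hin : rk input.2 < rk input.1) : FrameInv inv R d input ⟨.reducePrefix, input, input⟩ where
  pair := PairInv.start h hin
  start _ := rfl
  prefix_irr h := by simp [MinLine.index] at h
  proper h := by simp [MinLine.index] at h
  rhs_irr h := by simp [MinLine.index] at h
  saved h := by simp [MinLine.index] at h
  done h := by simp [MinLine.index] at h
  le h := by simp [MinLine.index] at h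
  length_le h := by simp [MinLine.index] at h
  first h := by simp [MinLine.index] at h

/-- The rules which may be found while `input` is being minimized. -/
def FoundBelow (rules : Finset (Arrow A)) (n : ℕ) (r : Rule A) : Prop :=
  r ∈ SetOfRules rules ∧ rk r.1 < n

lemma AutReduces.extends_below {w w' : Word A} (h : AutReduces d w d' w')
    (hd : DataSound inv R d) {n : ℕ} (hw : rk w < n) : Extends (FoundBelow d.rules n) d d' :=
  (h.spec hd).1.mono fun _ hr => ⟨hr.1, hr.2.trans_lt hw⟩

lemma MinStep.extends (hd : DataSound inv R d) (hin : rk input.2 < rk input.1)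
    (hf : FrameInv inv R d input f) (h : MinStep inv input (d, f) (d', f')) :
    Extends (FoundBelow d.rules (rk input.1)) d d' := by
  cases h with
  | prefixSame _ _ s u v x h =>
    have := hf.start (by simp [MinLine.index])
    refine h.extends_below hd (rk_lt_of_length ?_)
    simp [← this]
  | prefixChanged _ _ s u u' v x h h' =>
    have := hf.start (by simp [MinLine.index])
    refine h.extends_below hd (rk_lt_of_length ?_)
    simp [← this]
  | suffix _ _ s u u' v x h =>
    have := hf.start (by simp [MinLine.index])
    refine h.extends_below hd (rk_lt_of_length ?_)
    simp [← this]
  | leftChanged _ _ s u u' v h h' =>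
    refine h'.extends_below hd ?_
    rcases hf.pair.order with ho | ⟨ho, -⟩
    · exact (rk_fst_le_top _).trans_lt ho
    · exact absurd ho h
  | right _ _ s u v v' h =>
    refine h.extends_below hd ?_
    rcases hf.pair.order with ho | ⟨-, ho⟩
    · exact (rk_snd_le_top _).trans_lt ho
    · exact ho.trans_lt hin
  | _ => exact Extends.refl _

lemma MinStep.top_le (hd : DataSound inv R d)
    (h : MinStep inv input (d, f) (d', f')) : top f'.cur ≤ top f.cur := by
  cases h with
  | prefixSame _ _ s u v x h => exact le_rfl
  | prefixChanged _ _ s u u' v x h h' =>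
    have := (rk_snoc_le x).2 (h.spec hd).2.1
    simp only [top]
    omega
  | suffix _ _ s u u' v x h =>
    have := (rk_cons_le x).2 (h.spec hd).2.1
    simp only [top]
    omega
  | leftChanged _ _ s u u' v h h' =>
    have := (h'.spec hd).2.1
    simp only [top]
    omega
  | right _ _ s u v v' h =>
    have := (h.spec hd).2.1
    simp only [top]
    omega
  | orientSwap _ s u v h => exact (top_swap _ _).le
  | shortenAgain _ s u v x h =>
    have h₁ := h.rk_lt
    have h₂ : rk u < rk (u ++ [x]) := rk_lt_of_length (by simp)
    simp only [top]
    omega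
  | rotateOnce _ s u v x y h h' =>
    have h₁ : rk (inv x :: v) < rk (y :: u) := rk_lt_of_head (by simp at h; omega) h'
    have h₂ : rk (y :: u) < rk (x :: y :: u) := rk_lt_of_length (by simp)
    simp only [top]
    omega
  | cancelFirstAgain _ s u v x => exact (top_cons_lt x u v).le
  | cancelLastAgain _ s u v x => exact (top_snoc_lt x u v).le
  | _ => exact le_rfl

lemma MinStep.pair (hinv : Function.Involutive inv) (hd : DataSound inv R d)
    (hin : rk input.2 < rk input.1) (hf : FrameInv inv R d input f)
    (h : MinStep inv input (d, f) (d', f')) : PairInv inv R d' input f'.cur := by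
  have hp := hf.pair
  cases h with
  | prefixSame _ _ s u v x h => exact hp.mono (h.spec hd).1
  | prefixChanged _ _ s u u' v x h h' =>
    have hs := hf.start (by simp [MinLine.index])
    refine PairInv.reduce_left (a := []) (b := [x]) hd hin hp ?_ h
    exact rk_lt_of_length (by simp [← hs])
  | suffix _ _ s u u' v x h =>
    have hs := hf.start (by simp [MinLine.index])
    have := PairInv.reduce_left (a := [x]) (b := []) hd hin (by simpa using hp) ?_ h
    · simpa using this
    · exact rk_lt_of_length (by simp [← hs])
  | leftChanged _ _ s u u' v h h' =>
    have := PairInv.reduce_left (a := []) (b := []) hd hin (by simpa using hp) ?_ h'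
    · simpa using this
    · rcases hp.order with ho | ⟨ho, -⟩
      · exact (rk_fst_le_top _).trans_lt ho
      · exact absurd ho h
  | right _ _ s u v v' h => exact PairInv.reduce_right hd hin hp h
  | orientSwap _ s u v h => exact hp.swap hin (rk_lt.2 h)
  | shortenAgain _ s u v x h => exact hp.shorten hinv hd hin h.rk_lt
  | rotateOnce _ s u v x y h h' =>
    exact hp.rotate hd hin (rk_lt_of_head (by simp at h; omega) h')
  | cancelFirstAgain _ s u v x => exact hp.cancel_first hin
  | cancelLastAgain _ s u v x => exact hp.cancel_last hin
  | _ => exact hp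

/-- After both the longest proper prefix and the longest proper suffix of the left-hand side have
been `Aut`-reduced, the left-hand side has changed if it had a reducible proper subword. -/
lemma MinStep.proper (hinv : Function.Involutive inv) (hd : DataSound inv R d)
    (hin : rk input.2 < rk input.1) (hf : FrameInv inv R d input f)
    (h : MinStep inv input (d, f) (d', f')) (hi : 2 ≤ f'.line.index)
    (hr : ProperSubwordReducible d.rules input.1) : top f'.cur < rk input.1 := by
  by_cases hi' : 2 ≤ f.line.index
  · exact (h.top_le hd).trans_lt (hf.proper hi' hr)
  · have hs := hf.start (by omega)
    have ho := (h.pair hinv hd hin hf).order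
    refine ho.resolve_right ?_
    rintro ⟨ho, -⟩
    cases h with
    | prefixChanged _ _ s u u' v x h h' =>
      simp only at hs
      rw [← hs] at ho
      simp only [List.append_cancel_right_eq] at ho
      exact h' ho
    | suffix _ _ s u u' v x h =>
      simp only at hs
      subst hs
      simp only [List.cons.injEq, true_and] at ho
      subst ho
      obtain ⟨t, ht, hne, hred⟩ := hr
      rcases infix_of_ne ht hne with ⟨w, y, hw, htw⟩ | ⟨y, w, hw, htw⟩
      · exact hf.prefix_irr rfl w y hw (hred.of_infix htw)
      · simp only [List.cons.injEq] at hw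
        obtain ⟨rfl, rfl⟩ := hw
        exact (h.spec hd).2.2.2.2 (hred.of_infix htw)
    | _ => simp [MinLine.index] at hi hi'

lemma MinStep.saved (hf : FrameInv inv R d input f)
    (h : MinStep inv input (d, f) (d', f')) (hi : 4 ≤ f'.line.index) :
    f'.cur = f'.saved ∨ weight f'.cur < weight f'.saved := by
  have key : ∀ {r r' s : Rule A}, (r = s ∨ weight r < weight s) → weight r' < weight r →
      r' = s ∨ weight r' < weight s := by
    rintro r r' s (rfl | h₁) h₂
    · exact Or.inr h₂
    · exact Or.inr (h₂.trans h₁)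
  cases h with
  | right _ _ s u v v' h => exact Or.inl rfl
  | orientSwap _ s u v h =>
    exact key (hf.saved (by simp [MinLine.index])) (weight_swap_lt (rk_lt.2 h))
  | shortenAgain _ s u v x h =>
    refine key (hf.saved (by simp [MinLine.index])) (weight_lt_of_top ?_)
    have h₁ := h.rk_lt
    have h₂ : rk u < rk (u ++ [x]) := rk_lt_of_length (by simp)
    simp only [top]
    omega
  | rotateOnce _ s u v x y h h' =>
    refine key (hf.saved (by simp [MinLine.index])) (weight_lt_of_top ?_)
    have h₁ : rk (inv x :: v) < rk (y :: u) := rk_lt_of_head (by simp at h; omega) h'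
    have h₂ : rk (y :: u) < rk (x :: y :: u) := rk_lt_of_length (by simp)
    simp only [top]
    omega
  | cancelFirstAgain _ s u v x =>
    exact key (hf.saved (by simp [MinLine.index])) (weight_lt_of_top (top_cons_lt x u v))
  | cancelLastAgain _ s u v x =>
    exact key (hf.saved (by simp [MinLine.index])) (weight_lt_of_top (top_snoc_lt x u v))
  | orientKeep => exact hf.saved (by simp [MinLine.index])
  | shortenDone => exact hf.saved (by simp [MinLine.index])
  | rotateDone => exact hf.saved (by simp [MinLine.index])
  | cancelFirstDone => exact hf.saved (by simp [MinLine.index])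
  | cancelLastDone => exact hf.saved (by simp [MinLine.index])
  | loopDone => exact hf.saved (by simp [MinLine.index])
  | _ => simp [MinLine.index] at hi

lemma MinStep.le (hf : FrameInv inv R d input f)
    (h : MinStep inv input (d, f) (d', f')) (hi : 5 ≤ f'.line.index) :
    rk f'.cur.2 ≤ rk f'.cur.1 := by
  cases h with
  | orientKeep _ s u v h => rw [← rk_lt] at h; exact not_lt.1 h
  | orientSwap _ s u v h => exact (rk_lt.2 h).le
  | shortenAgain _ s u v x h => exact h.rk_lt.le
  | rotateOnce _ s u v x y h h' => exact (rk_lt_of_head (by simp at h; omega) h').le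
  | cancelFirstAgain _ s u v x => exact (rk_cons_le x).1 (hf.le (by simp [MinLine.index]))
  | cancelLastAgain _ s u v x => exact (rk_snoc_le x).1 (hf.le (by simp [MinLine.index]))
  | shortenDone => exact hf.le (by simp [MinLine.index])
  | rotateDone => exact hf.le (by simp [MinLine.index])
  | cancelFirstDone => exact hf.le (by simp [MinLine.index])
  | cancelLastDone => exact hf.le (by simp [MinLine.index])
  | loopDone => exact hf.le (by simp [MinLine.index])
  | _ => simp [MinLine.index] at hi

lemma MinStep.length_le (hf : FrameInv inv R d input f)
    (h : MinStep inv input (d, f) (d', f')) (hi : 6 ≤ f'.line.index) :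
    f'.cur.1.length ≤ f'.cur.2.length + 2 := by
  cases h with
  | shortenDone _ s r h =>
    by_contra h'
    exact h (Or.inl (not_le.1 h'))
  | rotateOnce _ s u v x y h h' => simp at h ⊢; omega
  | cancelFirstAgain _ s u v x =>
    have := hf.length_le (by simp [MinLine.index])
    simp at this ⊢
    omega
  | cancelLastAgain _ s u v x =>
    have := hf.length_le (by simp [MinLine.index])
    simp at this ⊢
    omega
  | rotateDone => exact hf.length_le (by simp [MinLine.index])
  | cancelFirstDone => exact hf.length_le (by simp [MinLine.index])
  | cancelLastDone => exact hf.length_le (by simp [MinLine.index])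
  | loopDone => exact hf.length_le (by simp [MinLine.index])
  | _ => simp [MinLine.index] at hi

lemma MinStep.first (hf : FrameInv inv R d input f)
    (h : MinStep inv input (d, f) (d', f')) (hi : 8 ≤ f'.line.index) :
    ¬ ∃ x u v, f'.cur = (x :: u, x :: v) := by
  cases h with
  | cancelFirstDone _ s r h => exact h
  | cancelLastAgain _ s u v x =>
    rintro ⟨y, u', v', he⟩
    simp only [Prod.mk.injEq] at he
    obtain ⟨rfl, rfl⟩ := he
    exact hf.first (by simp [MinLine.index]) ⟨y, u' ++ [x], v' ++ [x], rfl⟩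
  | cancelLastDone => exact hf.first (by simp [MinLine.index])
  | loopDone => exact hf.first (by simp [MinLine.index])
  | _ => simp [MinLine.index] at hi

lemma MinStep.frameInv (hinv : Function.Involutive inv) (hd : DataSound inv R d)
    (hin : rk input.2 < rk input.1) (hf : FrameInv inv R d input f)
    (h : MinStep inv input (d, f) (d', f')) : FrameInv inv R d' input f' := by
  have hrules := (h.extends hd hin hf).rules_eq
  refine ⟨h.pair hinv hd hin hf, fun hi => ?_, fun hi u x hu => ?_, fun hi hr => ?_, fun hi => ?_,
    h.saved hf, fun hi => ?_, h.le hf, h.length_le hf, h.first hf⟩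
  · cases h with
    | prefixSame _ _ s u v x h => exact hf.start (by simp [MinLine.index])
    | _ => simp [MinLine.index] at hi
  · rw [hrules]
    cases h with
    | prefixSame _ _ s u' v x' h =>
      have hs := hf.start (by simp [MinLine.index])
      simp only at hs
      rw [← hs] at hu
      have := List.append_inj_left' hu rfl
      rw [← this]
      exact (h.spec hd).2.2.2.2
    | _ => simp [MinLine.index] at hi
  · rw [hrules] at hr
    exact h.proper hinv hd hin hf hi hr
  · rw [hrules]
    cases h with
    | right _ _ s u v v' h => exact (h.spec hd).2.2.2.2
    | orientKeep => exact hf.rhs_irr (by simp [MinLine.index])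
    | orientSwap => exact hf.rhs_irr (by simp [MinLine.index])
    | shortenAgain => exact hf.rhs_irr (by simp [MinLine.index])
    | shortenDone => exact hf.rhs_irr (by simp [MinLine.index])
    | rotateOnce => exact hf.rhs_irr (by simp [MinLine.index])
    | rotateDone => exact hf.rhs_irr (by simp [MinLine.index])
    | cancelFirstAgain => exact hf.rhs_irr (by simp [MinLine.index])
    | cancelFirstDone => exact hf.rhs_irr (by simp [MinLine.index])
    | cancelLastAgain => exact hf.rhs_irr (by simp [MinLine.index])
    | cancelLastDone => exact hf.rhs_irr (by simp [MinLine.index])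
    | loopDone => exact hf.rhs_irr (by simp [MinLine.index])
    | _ => simp [MinLine.index] at hi
  · cases h with
    | loopDone _ s r h => exact h
    | _ => simp [MinLine.index] at hi

/-- The output of minimization is the trivial pair or a rule in the language of `SL2`. -/
lemma FrameInv.output_mem {out s : Rule A} (hf : FrameInv inv R d input ⟨.output, out, s⟩) :
    out = ([], []) ∨ out ∈ SL2 := by
  have h₁ : rk out.2 ≤ rk out.1 := hf.le (by simp [MinLine.index])
  have h₂ : out.1.length ≤ out.2.length + 2 := hf.length_le (by simp [MinLine.index])
  have h₃ : ¬ ∃ x u v, out = (x :: u, x :: v) := hf.first (by simp [MinLine.index])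
  obtain ⟨u, v⟩ := out
  simp only at h₁ h₂ h₃
  rcases h₁.lt_or_eq with h₁ | h₁
  · refine Or.inr ⟨rk_lt.1 h₁, h₂, ?_⟩
    rintro ⟨x, ⟨u', hu'⟩, ⟨v', hv'⟩⟩
    exact h₃ ⟨x, u', v', Prod.ext hu'.symm hv'.symm⟩
  · rw [rk_inj] at h₁
    subst h₁
    cases v with
    | nil => exact Or.inl rfl
    | cons x v => exact absurd ⟨x, v, v, rfl⟩ h₃

lemma FrameInv.rhs_irreducible {out s : Rule A}
    (hf : FrameInv inv R d input ⟨.output, out, s⟩) : ¬ AutReducible d.rules out.2 := by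
  have h₁ : out = s := hf.done rfl
  rw [h₁]
  exact hf.rhs_irr (by simp [MinLine.index])

/-! ### Termination of the minimization routine -/

/-- The weight of the pair at the beginning of the current round of the minimization loop. -/
noncomputable def Frame.outer (f : Frame A) : ℕ :=
  if f.line.index ≤ 3 then weight f.cur else weight f.saved

/-- A frame comes before another one if its round, its line, or its pair within a line, is more
advanced. -/
def Frame.Before (f' f : Frame A) : Prop :=
  f'.outer < f.outer ∨ f'.outer = f.outer ∧ (f.line.index < f'.line.index ∨
    f.line.index = f'.line.index ∧ weight f'.cur < weight f.cur)

lemma MinLine.index_le (l : MinLine) : l.index ≤ 10 := by cases l <;> simp [MinLine.index]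

lemma Frame.before_wf : WellFounded (Frame.Before (A := A)) := by
  refine Subrelation.wf (r := InvImage (Prod.Lex (· < ·) (Prod.Lex (· < ·) (· < ·)))
    fun f : Frame A => (f.outer, 10 - f.line.index, weight f.cur)) ?_
    (InvImage.wf _ (WellFounded.prod_lex wellFounded_lt
      (WellFounded.prod_lex wellFounded_lt wellFounded_lt)))
  intro f' f h
  simp only [InvImage, Prod.lex_def]
  have h₁ := f.line.index_le
  have h₂ := f'.line.index_le
  rcases h with h | ⟨h, h' | ⟨h', h''⟩⟩
  · exact Or.inl h
  · exact Or.inr ⟨h, Or.inl (by omega)⟩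
  · exact Or.inr ⟨h, Or.inr ⟨by omega, h''⟩⟩

lemma MinStep.before (hd : DataSound inv R d) (hf : FrameInv inv R d input f)
    (h : MinStep inv input (d, f) (d', f')) : f'.Before f := by
  have adv : ∀ {f' f : Frame A}, f'.outer ≤ f.outer → f.line.index < f'.line.index →
      f'.Before f := fun h h' => h.lt_or_eq.imp id fun h => ⟨h, Or.inl h'⟩
  have le : ∀ {r r' : Rule A}, rk r'.1 ≤ rk r.1 → rk r'.2 ≤ rk r.2 → weight r' ≤ weight r := by
    intro r r' h₁ h₂
    by_cases h : r' = r
    · rw [h]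
    · exact (weight_lt_of_le h₁ h₂ h).le
  cases h with
  | prefixSame _ _ s u v x h => exact adv le_rfl (by simp [MinLine.index])
  | prefixChanged _ _ s u u' v x h h' =>
    refine adv ?_ (by simp [MinLine.index])
    exact le ((rk_snoc_le x).2 (h.spec hd).2.1) le_rfl
  | suffix _ _ s u u' v x h =>
    refine adv ?_ (by simp [MinLine.index])
    exact le ((rk_cons_le x).2 (h.spec hd).2.1) le_rfl
  | leftSame => exact adv le_rfl (by simp [MinLine.index])
  | leftChanged _ _ s u u' v h h' =>
    refine adv ?_ (by simp [MinLine.index])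
    exact le (h'.spec hd).2.1 le_rfl
  | right _ _ s u v v' h =>
    refine adv ?_ (by simp [MinLine.index])
    exact le le_rfl (h.spec hd).2.1
  | shortenAgain _ s u v x h =>
    refine Or.inr ⟨rfl, Or.inr ⟨rfl, weight_lt_of_top ?_⟩⟩
    have h₁ := h.rk_lt
    have h₂ : rk u < rk (u ++ [x]) := rk_lt_of_length (by simp)
    simp only [top]
    omega
  | cancelFirstAgain _ s u v x =>
    exact Or.inr ⟨rfl, Or.inr ⟨rfl, weight_lt_of_top (top_cons_lt x u v)⟩⟩
  | cancelLastAgain _ s u v x =>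
    exact Or.inr ⟨rfl, Or.inr ⟨rfl, weight_lt_of_top (top_snoc_lt x u v)⟩⟩
  | loopAgain _ s r h =>
    rcases hf.saved (by simp [MinLine.index]) with h' | h'
    · exact absurd h' h
    · exact Or.inl h'
  | _ => exact adv le_rfl (by simp [MinLine.index])

end Frames

/-! ### Handling the output of minimization -/

section Handling

variable [LinearOrder A] [Fintype A] {inv : A → A} {R : Finset (Rule A)}

/-- The effect of handling the output `out` of the minimization of `input`. -/
structure Handled (input out : Rule A) (d d' : Data A) : Prop where
  rules_eq : d'.rules = d.rules
  live_of_ne : ∀ r ∈ d.live, r ≠ input → r ∈ d'.live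
  out_mem : out ≠ ([], []) → out ∈ d'.considered ∪ d'.now
  of_mem_live : ∀ r ∈ d'.live, r ∈ d.live ∨ r = out ∧ out ≠ ([], [])
  of_mem_delete : ∀ r ∈ d'.delete, r ∈ d.delete ∨ r = input
  considered_subset : d'.considered ⊆ d.considered
  considered_of_ne : ∀ r ∈ d.considered, r ≠ input → r ∈ d'.considered
  of_mem_recorded : ∀ r ∈ d'.considered ∪ d'.now,
    r ∈ d.considered ∪ d.now ∧ r ≠ input ∨ r = out ∧ out ≠ ([], [])
  recorded_of_ne : ∀ r ∈ d.considered ∪ d.now, r ≠ input → r ∈ d'.considered ∪ d'.now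
  input_mem : input ∈ d'.live → input ∈ d'.considered ∪ d'.now
  new_subset : d'.new ⊆ d.new
  input_not_mem : input ∉ d'.new

variable {d d₁ d₂ : Data A} {input out : Rule A}

lemma mem_live_iff {d : Data A} {r : Rule A} :
    r ∈ d.live ↔ r ∈ d.considered ∨ r ∈ d.now ∨ r ∈ d.new := Iff.rfl

/-- The state of the lists after the output has been recorded. -/
lemma RecordsOutput.lists (h : RecordsOutput inv out d d₁) :
    d₁.rules = d.rules ∧ d₁.considered = d.considered ∧ d₁.delete = d.delete ∧
      (∀ r, r ∈ d₁.considered ∪ d₁.now ↔ r ∈ d.considered ∪ d.now ∨ r = out ∧ out ≠ ([], [])) ∧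
      (∀ r, r ∈ d₁.new ↔ r ∈ d.new ∧ ¬ (r = out ∧ out ≠ ([], []))) := by
  cases h with
  | trivial h =>
    subst h
    simp
  | weld W h h' =>
    refine ⟨rfl, rfl, rfl, fun r => ?_, fun r => ?_⟩
    · simp only [Data.record]
      split_ifs with hc
      · rw [Finset.mem_union, or_comm] at hc
        refine ⟨Or.inl, ?_⟩
        rintro (h | ⟨rfl, -⟩)
        · exact h
        · exact Finset.mem_union.2 hc
      · simp only [Finset.mem_union, Finset.mem_insert]
        tauto
    · simp only [Data.record, Finset.mem_erase]
      tauto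

lemma handled (h₁ : RecordsOutput inv out d d₁) (h₂ : DisposesInput input out d₁ d₂)
    (hin : input ≠ ([], [])) (hp : ProperSubwordReducible d.rules input.1 → out ≠ input) :
    Handled input out d d₂ := by
  obtain ⟨e₁, e₂, e₃, e₄, e₅⟩ := h₁.lists
  simp only [Finset.mem_union] at e₄
  have e₆ : ∀ r, r ∈ d₁.live ↔ r ∈ d.live ∨ r = out ∧ out ≠ ([], []) := by
    intro r
    rw [mem_live_iff, mem_live_iff, ← or_assoc, e₄ r, e₅ r]
    grind
  cases h₂ with
  | discard h =>
    rw [e₁] at h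
    have hne := hp h
    clear h h₁ hp
    refine ⟨e₁, ?_, ?_, ?_, ?_, ?_, ?_, ?_, ?_, ?_, ?_, ?_⟩ <;>
      simp only [mem_live_iff, Data.discard, Finset.mem_union, Finset.mem_erase,
        Finset.subset_iff] at e₆ ⊢ <;> grind
  | postpone h hne =>
    clear h h₁ hp
    refine ⟨e₁, ?_, ?_, ?_, ?_, ?_, ?_, ?_, ?_, ?_, ?_, ?_⟩ <;>
      simp only [mem_live_iff, Data.postpone, Data.discard, Finset.mem_union, Finset.mem_erase,
        Finset.mem_insert, Finset.subset_iff] at e₆ ⊢ <;> grind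
  | keep h heq =>
    subst heq
    clear h h₁ hp
    refine ⟨e₁, ?_, ?_, ?_, ?_, ?_, ?_, ?_, ?_, ?_, ?_, ?_⟩ <;>
      simp only [mem_live_iff, Finset.mem_union, Finset.subset_iff] at e₆ ⊢ <;> grind

lemma DisposesInput.wdiff_eq (h₂ : DisposesInput input out d₁ d₂) : d₂.wdiff = d₁.wdiff := by
  cases h₂ <;> rfl

lemma handled_wdiff (hd : DataSound inv R d) (hv : value inv R out.1 = value inv R out.2)
    (h₁ : RecordsOutput inv out d d₁) (h₂ : DisposesInput input out d₁ d₂) :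
    WDiffSound inv R d₂.wdiff ∧
      ∀ r, Threads d.wdiff.needed r ∨ r = out ∧ out ≠ ([], []) → Threads d₂.wdiff.needed r := by
  rw [h₂.wdiff_eq]
  cases h₁ with
  | trivial h =>
    refine ⟨hd.wdiff, ?_⟩
    rintro r (hr | ⟨-, hr⟩)
    · exact hr
    · exact absurd h hr
  | weld W h h' =>
    refine ⟨hd.wdiff.incorporates hd.rules_valid hv h', ?_⟩
    rintro r (hr | ⟨hr, -⟩)
    · exact h'.threads (Or.inr hr)
    · exact h'.threads (Or.inl hr)

/-- The input rule is a consequence of what remains. -/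
lemma Handled.conv (hd : DataSound inv R d) {s : Rule A}
    (hf : FrameInv inv R d input ⟨.output, out, s⟩) (h : Handled input out d d₂) :
    ∀ r ∈ d.live, Conv d₂.live (rk r.1 + 1) r.1 r.2 := by
  intro r hr
  have hlt := hd.oriented r (live_subset_rulesOf d hr)
  by_cases hne : r = input
  · subst hne
    refine hf.pair.joined d₂.live ?_ ?_
    · rintro r' ⟨hr', hlt'⟩
      refine h.live_of_ne r' hr' ?_
      rintro rfl
      exact lt_irrefl _ hlt'
    · by_cases ht : out = ([], [])
      · subst ht
        exact Conv.refl _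
      · have := h.out_mem ht
        rw [Finset.mem_union] at this
        have hout : out ∈ d₂.live := this.imp id Or.inl
        exact Conv.of_elemRed (ElemRed.of_mem hout) (Nat.lt_succ_of_le (rk_fst_le_top _))
          (Nat.lt_succ_of_le (rk_snd_le_top _))
  · exact Conv.of_elemRed (ElemRed.of_mem (h.live_of_ne r hr hne)) (by omega) (by omega)

/-- If the live rules of `d` remain consequences of those of `d'`, the explicit rules of which are
live rules or come from `d`, the invariants concerning conversions persist. -/
lemma DataSound.of_conv {d d' : Data A} (hd : DataSound inv R d)
    (hc : ∀ r ∈ d.live, Conv d'.live (rk r.1 + 1) r.1 r.2)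
    (hs : ∀ r ∈ d'.store, r ∈ d.store ∨
      rk r.2 < rk r.1 ∧ value inv R r.1 = value inv R r.2 ∧ r ∈ d'.live)
    (hr : Valid inv R (SetOfRules d'.rules)) (hw : WDiffSound inv R d'.wdiff) :
    DataSound inv R d' := by
  refine ⟨fun r h => ?_, fun r h => ?_, hr, hw, fun r h => ?_, fun x => ?_⟩
  · rcases hs r h with h | h
    · exact hd.oriented r h
    · exact h.1
  · rcases hs r h with h | h
    · exact hd.valid r h
    · exact h.2.1
  · rcases hs r h with h | h
    · exact Conv.subst (fun r hr _ => hc r hr) (hd.store_conv r h)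
    · exact Conv.of_elemRed (ElemRed.of_mem h.2.2) (by omega) (by omega)
  · exact Conv.subst (fun r hr _ => hc r hr) (hd.inv_conv x)

end Handling

/-! ### Critical pairs -/

section CriticalPairs

variable [DecidableEq A]

lemma mem_critPairs {r r' : Rule A} {p : Word A × Word A} :
    p ∈ critPairs r r' ↔ ∃ s₁ z s₂, z ≠ [] ∧ r.1 = s₁ ++ z ∧ r'.1 = z ++ s₂ ∧
      p = (r.2 ++ s₂, s₁ ++ r'.2) := by
  simp only [critPairs, Finset.mem_image, Finset.mem_filter, Finset.mem_Icc]
  constructor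
  · rintro ⟨k, ⟨⟨h₁, h₂⟩, h₃⟩, rfl⟩
    refine ⟨r.1.take (r.1.length - k), r'.1.take k, r'.1.drop k, ?_, ?_, ?_, rfl⟩
    · intro h
      have := congrArg List.length h
      simp only [List.length_take, List.length_nil] at this
      omega
    · rw [← h₃, List.take_append_drop]
    · rw [List.take_append_drop]
  · rintro ⟨s₁, z, s₂, hz, h₁, h₂, rfl⟩
    have hpos := List.length_pos_iff.2 hz
    refine ⟨z.length, ⟨⟨hpos, ?_⟩, ?_⟩, ?_⟩ <;> simp [h₁, h₂]

variable {inv : A → A} {R : Finset (Rule A)}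

lemma value_critPairs {r r' : Rule A} (h : value inv R r.1 = value inv R r.2)
    (h' : value inv R r'.1 = value inv R r'.2) {p : Word A × Word A} (hp : p ∈ critPairs r r') :
    value inv R p.1 = value inv R p.2 := by
  obtain ⟨s₁, z, s₂, -, h₁, h₂, rfl⟩ := mem_critPairs.1 hp
  simp only [value_append]
  rw [← h, ← h', h₁, h₂, value_append, value_append, mul_assoc]

end CriticalPairs

/-! ### Invariants of a run -/

section Invariant

variable [LinearOrder A] [Fintype A] (inv : A → A) (R : Finset (Rule A))

/-- The rules whose minimization in the current pass may still be outstanding although they are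
already in `Considered`; between the formation of `Rules` and the next pass these are all rules, as
no arrow is marked as needed then. -/
def Control.pending : Control A → Set (Rule A)
  | .considered todo => {r | r ∈ todo}
  | .minimize ret input _ => {r | r ∈ ret.pending ∨ r = input}
  | .delete => Set.univ
  | _ => ∅

/-- The invariants of a run of the procedure. The two which carry the argument are `crit`, that the
critical pairs between rules in `Considered` are resolved or about to be treated, and `threads`, that
the rules minimized in the current pass are accepted by the needed part of `WDiff`, up to loops at
the base state. -/
structure ConfigInv (c : Config A) : Prop where
  data : DataSound inv R c.1
  frame : ∀ ret input f, c.2 = .minimize ret input f →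
    FrameInv inv R c.1 input f ∧ input ∈ c.1.live ∧
      (ret = .new ∨ ∃ todo, ret = .considered todo ∧ todo ⊆ c.1.considered ∧ input ∉ todo)
  todo_subset : ∀ todo, c.2 = .considered todo → todo ⊆ c.1.considered
  todo_valid : ∀ todo, c.2 = .overlaps todo → ∀ p ∈ todo, value inv R p.1 = value inv R p.2
  crit : ∀ r₁ ∈ c.1.considered, ∀ r₂ ∈ c.1.considered, ∀ p ∈ critPairs r₁ r₂,
    (∃ todo, c.2 = .overlaps todo ∧ p ∈ todo) ∨ Joined c.1.live p
  threads : ∀ r ∈ c.1.considered ∪ c.1.now,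
    r ∈ c.2.pending ∨ r ∈ SL2 ∧ Threads c.1.wdiff.needed r
  now_empty : c.2 = .wdiff ∨ c.2 = .delete → c.1.now = ∅

variable {inv R} {c c' : Config A}

lemma ConfigInv.handled {d d₁ d₂ : Data A} {ret : Control A} {input out s : Rule A}
    (hc : ConfigInv inv R (d, .minimize ret input ⟨.output, out, s⟩))
    (h₁ : RecordsOutput inv out d d₁) (h₂ : DisposesInput input out d₁ d₂) :
    Handled input out d d₂ := by
  obtain ⟨hf, hin, -⟩ := hc.frame _ _ _ rfl
  have hlt := hc.data.oriented _ (live_subset_rulesOf _ hin)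
  refine KnuthBendix.handled h₁ h₂ ?_ ?_
  · rintro rfl
    exact lt_irrefl _ hlt
  · rintro hp rfl
    exact absurd (hf.proper (by simp [MinLine.index]) hp) (not_lt.2 (rk_fst_le_top _))

/-- A step changes rules only to consequences: the live rules before it are consequences of those
after it, by conversions bounded by their left-hand sides. -/
lemma Step.conv (hc : ConfigInv inv R c) (h : Step inv c c') :
    ∀ r ∈ c.1.live, Conv c'.1.live (rk r.1 + 1) r.1 r.2 := by
  have key : ∀ {S : Set (Rule A)}, c.1.live ⊆ S →
      ∀ r ∈ c.1.live, Conv S (rk r.1 + 1) r.1 r.2 := by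
    intro S hS r hr
    have hlt := hc.data.oriented r (live_subset_rulesOf _ hr)
    exact Conv.of_elemRed (ElemRed.of_mem (hS hr)) (by omega) (by omega)
  have hd := hc.data
  cases h with
  | pickConsidered d todo r h => exact key subset_rfl
  | endConsidered d => exact key subset_rfl
  | pickNew d r h => exact key subset_rfl
  | endNew d h => exact key subset_rfl
  | minimize d d' ret input f f' h =>
    obtain ⟨hf, hin, -⟩ := hc.frame _ _ _ rfl
    exact key (h.extends hd (hd.oriented _ (live_subset_rulesOf _ hin)) hf).live_subset
  | handle d d₁ d₂ ret input out s h₁ h₂ =>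
    obtain ⟨hf, hin, -⟩ := hc.frame _ _ _ rfl
    exact Handled.conv hd hf (hc.handled h₁ h₂)
  | pickNow d r h =>
    refine key fun r' hr' => ?_
    simp only [mem_live_iff, Finset.mem_insert, Finset.mem_erase] at hr' ⊢
    tauto
  | overlap d d₁ d₂ d₃ todo p w₁ w₂ hp h₁ h₂ h₃ =>
    have e₁ := (h₁.spec hd).1
    have hd₁ := hd.found e₁
    have e₂ := (h₂.spec hd₁).1
    refine key ((e₁.live_subset.trans e₂.live_subset).trans ?_)
    cases h₃ with
    | eq h => exact subset_rfl
    | gt h => exact (Extends.addNew (Q := fun _ => True) _ trivial).live_subset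
    | lt h => exact (Extends.addNew (Q := fun _ => True) _ trivial).live_subset
  | endOverlaps d => exact key subset_rfl
  | endNow d h => exact key subset_rfl
  | amalgamate d W h h' => exact key subset_rfl
  | copy d h => exact key subset_rfl
  | endPass d => exact key subset_rfl

/-- The rules which the treatment of a critical pair inserts into `New` are sound. -/
lemma AddsCritical.spec {w₁ w₂ : Word A} {d d' : Data A} (h : AddsCritical w₁ w₂ d d')
    (hv : value inv R w₁ = value inv R w₂) :
    Extends (fun r => rk r.2 < rk r.1 ∧ value inv R r.1 = value inv R r.2) d d' ∧
      (w₁ = w₂ ∨ (w₁, w₂) ∈ d'.store ∨ (w₂, w₁) ∈ d'.store) := by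
  cases h with
  | eq h => exact ⟨Extends.refl _, Or.inl h⟩
  | gt h =>
    exact ⟨Extends.addNew _ ⟨rk_lt.2 h, hv⟩, Or.inr (Or.inl (mem_store_addNew _ _))⟩
  | lt h =>
    exact ⟨Extends.addNew _ ⟨rk_lt.2 h, hv.symm⟩, Or.inr (Or.inr (mem_store_addNew _ _))⟩

lemma overlap_spec {d d₁ d₂ d₃ : Data A} {p : Word A × Word A} {w₁ w₂ : Word A}
    (hd : DataSound inv R d) (hp : value inv R p.1 = value inv R p.2)
    (h₁ : AutReduces d p.1 d₁ w₁) (h₂ : AutReduces d₁ p.2 d₂ w₂)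
    (h₃ : AddsCritical w₁ w₂ d₂ d₃) :
    Extends (fun r => rk r.2 < rk r.1 ∧ value inv R r.1 = value inv R r.2) d d₃ ∧
      Joined d₃.live p := by
  obtain ⟨e₁, l₁, c₁, v₁, -⟩ := h₁.spec hd
  have hd₁ := hd.found e₁
  obtain ⟨e₂, l₂, c₂, v₂, -⟩ := h₂.spec hd₁
  have hd₂ := hd₁.found e₂
  obtain ⟨e₃, h⟩ := h₃.spec (inv := inv) (R := R) (by rw [← v₁, ← v₂, hp])
  have hd₃ := hd₂.extends e₃ fun _ h => h
  refine ⟨((e₁.mono fun r hr => ?_).trans (e₂.mono fun r hr => ?_)).trans e₃, ?_⟩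
  · exact ⟨rk_of_mem_SL2 hr.1.2, hd.rules_valid r hr.1⟩
  · exact ⟨rk_of_mem_SL2 hr.1.2, hd₁.rules_valid r hr.1⟩
  · have t₁ := rk_fst_le_top p
    have t₂ := rk_snd_le_top p
    have k₁ : Conv d₃.live (top p + 1) p.1 w₁ :=
      c₁.mono (e₂.live_subset.trans e₃.live_subset) (by omega)
    have k₂ : Conv d₃.live (top p + 1) p.2 w₂ := c₂.mono e₃.live_subset (by omega)
    refine (k₁.trans ?_).trans k₂.symm
    rcases h with rfl | h | h
    · exact Conv.refl _
    · exact (hd₃.store_conv _ h).mono subset_rfl (by simp only; omega)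
    · exact ((hd₃.store_conv _ h).mono subset_rfl (by simp only; omega)).symm

lemma Step.data (hc : ConfigInv inv R c) (h : Step inv c c') :
    DataSound inv R c'.1 := by
  have hconv := h.conv hc
  have hd := hc.data
  cases h with
  | pickConsidered d todo r h => exact hd
  | endConsidered d => exact hd
  | pickNew d r h => exact hd
  | endNew d h => exact hd
  | minimize d d' ret input f f' h =>
    obtain ⟨hf, hin, -⟩ := hc.frame _ _ _ rfl
    exact hd.extends (h.extends hd (hd.oriented _ (live_subset_rulesOf _ hin)) hf)
      fun r hr => ⟨rk_of_mem_SL2 hr.1.2, hd.rules_valid r hr.1⟩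
  | handle d d₁ d₂ ret input out s h₁ h₂ =>
    obtain ⟨hf, hin, -⟩ := hc.frame _ _ _ rfl
    have hh := hc.handled h₁ h₂
    refine hd.of_conv hconv (fun r hr => ?_) ?_ (handled_wdiff hd hf.pair.value_eq h₁ h₂).1
    · rcases mem_store.1 hr with hr | hr
      · rcases hh.of_mem_live r hr with h | ⟨rfl, h⟩
        · exact Or.inl (live_subset_rulesOf _ h)
        · exact Or.inr ⟨rk_of_mem_SL2 (hf.output_mem.resolve_left h), hf.pair.value_eq, hr⟩
      · rcases hh.of_mem_delete r hr with h | rfl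
        · exact Or.inl (mem_store.2 (Or.inr h))
        · exact Or.inl (live_subset_rulesOf _ hin)
    · change Valid inv R (SetOfRules d₂.rules)
      rw [hh.rules_eq]
      exact hd.rules_valid
  | pickNow d r h =>
    refine hd.of_conv hconv (fun r' hr' => Or.inl ?_) hd.rules_valid hd.wdiff
    simp only [mem_store, mem_live_iff, Finset.mem_insert, Finset.mem_erase] at hr' ⊢
    rcases hr' with ((rfl | h') | h' | h') | h' <;> tauto
  | overlap d d₁ d₂ d₃ todo p w₁ w₂ hp h₁ h₂ h₃ =>
    have := overlap_spec hd (hc.todo_valid _ rfl p hp) h₁ h₂ h₃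
    exact hd.extends this.1 fun _ h => h
  | endOverlaps d => exact hd
  | endNow d h => exact hd
  | amalgamate d W h h' =>
    exact hd.of_conv hconv (fun r hr => Or.inl hr) hd.rules_valid (hd.wdiff.amalgamates h')
  | copy d h =>
    refine hd.of_conv hconv (fun r hr => Or.inl hr) ?_ ?_
    · exact fun r hr => hd.wdiff.labelsValid.valid r (SetOfRules.mono hd.wdiff.needed_subset hr)
    · have hs := hd.wdiff.needed_subset
      exact ⟨Finset.empty_subset _, fun x t ht => hd.wdiff.noBaseLoop x t (hs ht),
        hd.wdiff.labelsValid.1, fun s x t ht => hd.wdiff.labelsValid.2 s x t (hs ht)⟩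
  | endPass d =>
    refine hd.of_conv hconv (fun r hr => Or.inl ?_) hd.rules_valid hd.wdiff
    simp only [mem_store, mem_live_iff, Finset.notMem_empty, or_false] at hr ⊢
    exact Or.inl hr

end Invariant

section InvariantPreserved

variable [LinearOrder A] [Fintype A] {inv : A → A} {R : Finset (Rule A)} {c c' : Config A}

lemma Joined.of_conv {S T : Set (Rule A)} (h : ∀ r ∈ S, Conv T (rk r.1 + 1) r.1 r.2)
    {p : Word A × Word A} (hp : Joined S p) : Joined T p :=
  Conv.subst (fun r hr _ => h r hr) hp

/-- Critical pairs once resolved remain resolved. -/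
lemma Step.joined (hc : ConfigInv inv R c) (h : Step inv c c') {p : Word A × Word A}
    (hp : Joined c.1.live p) : Joined c'.1.live p :=
  hp.of_conv (h.conv hc)

lemma Step.frame (hinv : Function.Involutive inv) (hc : ConfigInv inv R c) (h : Step inv c c') :
    ∀ ret input f, c'.2 = .minimize ret input f →
      FrameInv inv R c'.1 input f ∧ input ∈ c'.1.live ∧
        (ret = .new ∨ ∃ todo, ret = .considered todo ∧ todo ⊆ c'.1.considered ∧ input ∉ todo) := by
  have hd := hc.data
  intro ret' input' g he
  cases h with
  | pickConsidered d todo r h =>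
    simp only [Control.minimize.injEq] at he
    obtain ⟨rfl, rfl, rfl⟩ := he
    have hsub := hc.todo_subset todo rfl
    have hr : r ∈ d.live := Or.inl (hsub h)
    have hr' := live_subset_rulesOf _ hr
    exact ⟨FrameInv.begin (hd.valid r hr') (hd.oriented r hr'), hr,
      Or.inr ⟨_, rfl, (Finset.erase_subset _ _).trans hsub, Finset.notMem_erase _ _⟩⟩
  | pickNew d r h =>
    simp only [Control.minimize.injEq] at he
    obtain ⟨rfl, rfl, rfl⟩ := he
    have hr : r ∈ d.live := Or.inr (Or.inr h)
    have hr' := live_subset_rulesOf _ hr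
    exact ⟨FrameInv.begin (hd.valid r hr') (hd.oriented r hr'), hr, Or.inl rfl⟩
  | minimize d d' ret input f f' h =>
    simp only [Control.minimize.injEq] at he
    obtain ⟨rfl, rfl, rfl⟩ := he
    obtain ⟨hf, hin, hret⟩ := hc.frame _ _ _ rfl
    have hlt := hd.oriented _ (live_subset_rulesOf _ hin)
    have hext := h.extends hd hlt hf
    refine ⟨h.frameInv hinv hd hlt hf, hext.live_subset hin, ?_⟩
    rw [show (d', Control.minimize ret input f').1.considered = d.considered from
      hext.considered_eq]
    exact hret
  | handle d d₁ d₂ ret input out s h₁ h₂ =>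
    obtain ⟨-, -, hret⟩ := hc.frame _ _ _ rfl
    simp only at he
    rcases hret with h | ⟨todo, h, -⟩ <;> rw [he] at h <;> exact absurd h (by simp)
  | _ => exact absurd he (by simp)

lemma Step.todo_subset (hc : ConfigInv inv R c) (h : Step inv c c') :
    ∀ todo, c'.2 = .considered todo → todo ⊆ c'.1.considered := by
  intro todo' he
  cases h with
  | handle d d₁ d₂ ret input out s h₁ h₂ =>
    obtain ⟨-, -, hret⟩ := hc.frame _ _ _ rfl
    have hh := hc.handled h₁ h₂
    simp only at he
    rcases hret with h | ⟨todo, h, h', h''⟩ <;> rw [he] at h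
    · exact absurd h (by simp)
    · simp only [Control.considered.injEq] at h
      subst h
      intro r hr
      refine hh.considered_of_ne r (h' hr) ?_
      rintro rfl
      exact h'' hr
  | endPass d =>
    simp only [Control.considered.injEq] at he
    subst he
    exact subset_rfl
  | _ => exact absurd he (by simp)

lemma mem_allCritPairs {r : Rule A} {C : Finset (Rule A)} {p : Word A × Word A} :
    p ∈ allCritPairs r C ↔ ∃ r' ∈ C, p ∈ critPairs r r' ∨ p ∈ critPairs r' r := by
  simp [allCritPairs]

lemma Step.todo_valid (hc : ConfigInv inv R c) (h : Step inv c c') :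
    ∀ todo, c'.2 = .overlaps todo → ∀ p ∈ todo, value inv R p.1 = value inv R p.2 := by
  have hd := hc.data
  intro todo' he
  cases h with
  | handle d d₁ d₂ ret input out s h₁ h₂ =>
    obtain ⟨-, -, hret⟩ := hc.frame _ _ _ rfl
    simp only at he
    rcases hret with h | ⟨todo, h, -⟩ <;> rw [he] at h <;> exact absurd h (by simp)
  | pickNow d r h =>
    simp only [Control.overlaps.injEq] at he
    subst he
    intro p hp
    obtain ⟨r', hr', hp⟩ := mem_allCritPairs.1 hp
    have hr : r ∈ d.live := Or.inr (Or.inl h)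
    have hr' : r' ∈ d.live := by
      rcases Finset.mem_insert.1 hr' with rfl | hr'
      · exact hr
      · exact Or.inl hr'
    have v := hd.valid r (live_subset_rulesOf _ hr)
    have v' := hd.valid r' (live_subset_rulesOf _ hr')
    rcases hp with hp | hp
    · exact value_critPairs v v' hp
    · exact value_critPairs v' v hp
  | overlap d d₁ d₂ d₃ todo p w₁ w₂ hp h₁ h₂ h₃ =>
    simp only [Control.overlaps.injEq] at he
    subst he
    exact fun p' hp' => hc.todo_valid _ rfl p' (Finset.mem_of_mem_erase hp')
  | _ => exact absurd he (by simp)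

lemma Step.crit (hc : ConfigInv inv R c) (h : Step inv c c') :
    ∀ r₁ ∈ c'.1.considered, ∀ r₂ ∈ c'.1.considered, ∀ p ∈ critPairs r₁ r₂,
      (∃ todo, c'.2 = .overlaps todo ∧ p ∈ todo) ∨ Joined c'.1.live p := by
  -- outside the treatment of overlaps, a step which only shrinks `Considered` is harmless
  have key : (∀ todo, c.2 = .overlaps todo → todo = ∅) → c'.1.considered ⊆ c.1.considered →
      ∀ r₁ ∈ c'.1.considered, ∀ r₂ ∈ c'.1.considered, ∀ p ∈ critPairs r₁ r₂,
      (∃ todo, c'.2 = .overlaps todo ∧ p ∈ todo) ∨ Joined c'.1.live p := by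
    intro h₁ h₂ r₁ hr₁ r₂ hr₂ p hp
    rcases hc.crit r₁ (h₂ hr₁) r₂ (h₂ hr₂) p hp with ⟨todo, ht, hp'⟩ | hj
    · rw [h₁ todo ht] at hp'
      exact absurd hp' (Finset.notMem_empty _)
    · exact Or.inr (h.joined hc hj)
  have hstep := h
  have hd := hc.data
  cases h with
  | minimize d d' ret input f f' h =>
    obtain ⟨hf, hin, -⟩ := hc.frame _ _ _ rfl
    refine key (by simp) ?_
    exact (h.extends hd (hd.oriented _ (live_subset_rulesOf _ hin)) hf).considered_eq.subset
  | handle d d₁ d₂ ret input out s h₁ h₂ =>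
    exact key (by simp) (hc.handled h₁ h₂).considered_subset
  | pickNow d r h =>
    intro r₁ hr₁ r₂ hr₂ p hp
    rcases Finset.mem_insert.1 hr₁ with rfl | hr₁'
    · exact Or.inl ⟨_, rfl, mem_allCritPairs.2 ⟨r₂, hr₂, Or.inl hp⟩⟩
    · rcases Finset.mem_insert.1 hr₂ with rfl | hr₂'
      · exact Or.inl ⟨_, rfl, mem_allCritPairs.2 ⟨r₁, hr₁, Or.inr hp⟩⟩
      · rcases hc.crit r₁ hr₁' r₂ hr₂' p hp with ⟨todo, ht, -⟩ | hj
        · exact absurd ht (by simp)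
        · exact Or.inr (hstep.joined hc hj)
  | overlap d d₁ d₂ d₃ todo q w₁ w₂ hq h₁ h₂ h₃ =>
    have hs := overlap_spec hd (hc.todo_valid _ rfl q hq) h₁ h₂ h₃
    intro r₁ hr₁ r₂ hr₂ p hp
    simp only [hs.1.considered_eq] at hr₁ hr₂
    rcases hc.crit r₁ hr₁ r₂ hr₂ p hp with ⟨todo', ht, hp'⟩ | hj
    · simp only [Control.overlaps.injEq] at ht
      subst ht
      by_cases hpq : p = q
      · subst hpq
        exact Or.inr hs.2
      · exact Or.inl ⟨_, rfl, Finset.mem_erase.2 ⟨hpq, hp'⟩⟩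
    · exact Or.inr (hstep.joined hc hj)
  | endOverlaps d => exact key (by simp) subset_rfl
  | _ => exact key (by simp) subset_rfl

lemma Step.threads (hc : ConfigInv inv R c) (h : Step inv c c') :
    ∀ r ∈ c'.1.considered ∪ c'.1.now,
      r ∈ c'.2.pending ∨ r ∈ SL2 ∧ Threads c'.1.wdiff.needed r := by
  have hd := hc.data
  cases h with
  | pickConsidered d todo r h =>
    intro r' hr'
    rcases hc.threads r' hr' with h' | h'
    · refine Or.inl ?_
      have h' : r' ∈ todo := h'
      by_cases he : r' = r
      · exact Or.inr he
      · exact Or.inl (Finset.mem_erase.2 ⟨he, h'⟩)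
    · exact Or.inr h'
  | endConsidered d =>
    intro r' hr'
    exact Or.inr ((hc.threads r' hr').resolve_left (Finset.notMem_empty r'))
  | pickNew d r h =>
    intro r' hr'
    exact Or.inr ((hc.threads r' hr').resolve_left id)
  | endNew d h => exact hc.threads
  | minimize d d' ret input f f' h =>
    obtain ⟨hf, hin, -⟩ := hc.frame _ _ _ rfl
    have hext := h.extends hd (hd.oriented _ (live_subset_rulesOf _ hin)) hf
    intro r' hr'
    simp only [hext.considered_eq, hext.now_eq, hext.wdiff_eq] at hr' ⊢
    exact hc.threads r' hr'
  | handle d d₁ d₂ ret input out s h₁ h₂ =>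
    obtain ⟨hf, -, -⟩ := hc.frame _ _ _ rfl
    have hh := hc.handled h₁ h₂
    have hw := (handled_wdiff hd hf.pair.value_eq h₁ h₂).2
    intro r' hr'
    rcases hh.of_mem_recorded r' hr' with ⟨h, hne⟩ | h
    · rcases hc.threads r' h with (h' | h') | h'
      · exact Or.inl h'
      · exact absurd h' hne
      · exact Or.inr ⟨h'.1, hw r' (Or.inl h'.2)⟩
    · refine Or.inr ⟨?_, hw r' (Or.inr h)⟩
      rw [h.1]
      exact hf.output_mem.resolve_left h.2
  | pickNow d r h =>
    intro r' hr'
    refine hc.threads r' ?_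
    simp only [Finset.mem_union, Finset.mem_insert, Finset.mem_erase] at hr' ⊢
    rcases hr' with (rfl | h') | h'
    · exact Or.inr h
    · exact Or.inl h'
    · exact Or.inr h'.2
  | overlap d d₁ d₂ d₃ todo p w₁ w₂ hp h₁ h₂ h₃ =>
    have hext := (overlap_spec hd (hc.todo_valid _ rfl p hp) h₁ h₂ h₃).1
    intro r' hr'
    simp only [hext.considered_eq, hext.now_eq, hext.wdiff_eq] at hr' ⊢
    exact hc.threads r' hr'
  | endOverlaps d => exact hc.threads
  | endNow d h => exact hc.threads
  | amalgamate d W h h' =>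
    intro r' hr'
    rcases hc.threads r' hr' with h | h
    · exact Or.inl h
    · exact Or.inr ⟨h.1, h'.threads h.2⟩
  | copy d h => exact fun r' _ => Or.inl (Set.mem_univ r')
  | endPass d =>
    intro r' hr'
    have hn : d.now = ∅ := hc.now_empty (Or.inr rfl)
    simp only [hn, Finset.union_empty] at hr'
    exact Or.inl hr'

lemma Step.now_empty (hc : ConfigInv inv R c) (h : Step inv c c') :
    c'.2 = .wdiff ∨ c'.2 = .delete → c'.1.now = ∅ := by
  intro he
  cases h with
  | handle d d₁ d₂ ret input out s h₁ h₂ =>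
    obtain ⟨-, -, hret⟩ := hc.frame _ _ _ rfl
    simp only at he
    rcases hret with h | ⟨todo, h, -⟩ <;> rw [h] at he <;> simp at he
  | endNow d h => exact h
  | amalgamate d W h h' => exact hc.now_empty (Or.inl rfl)
  | copy d h => exact hc.now_empty (Or.inl rfl)
  | _ => simp at he

lemma Step.configInv (hinv : Function.Involutive inv) (hc : ConfigInv inv R c)
    (h : Step inv c c') : ConfigInv inv R c' :=
  ⟨h.data hc, h.frame hinv hc, h.todo_subset hc, h.todo_valid hc, h.crit hc, h.threads hc,
    h.now_empty hc⟩

/-- When `Rules` is formed from `WDiff`, the left-hand side of each rule in `Considered` becomes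
`Aut`-reducible. -/
lemma ConfigInv.autReducible_needed {d : Data A} (hc : ConfigInv inv R (d, .wdiff)) {r : Rule A}
    (hr : r ∈ d.considered ∪ d.now) : AutReducible d.wdiff.needed r.1 := by
  obtain ⟨h₁, h₂⟩ := (hc.threads r hr).resolve_left id
  have hn : NoBaseLoop d.wdiff.needed := fun x t ht =>
    hc.data.wdiff.noBaseLoop x t (hc.data.wdiff.needed_subset ht)
  obtain ⟨r', hr', hi⟩ := h₂.exists_rule hn h₁
  exact fun h => h r' hr' hi

lemma labelsValid_foldl {l : List (Rule A)} :
    ∀ {W : WDiff A}, LabelsValid inv R W → W.needed ⊆ W.arrows →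
      (∀ r ∈ l, value inv R r.1 = value inv R r.2) →
      LabelsValid inv R (l.foldl (addPath inv) W) ∧
        (l.foldl (addPath inv) W).needed ⊆ (l.foldl (addPath inv) W).arrows := by
  induction l with
  | nil => exact fun h h' _ => ⟨h, h'⟩
  | cons r l ih =>
    intro W h h' hl
    rw [List.forall_mem_cons] at hl
    exact ih (h.addPath hl.1) (addPath_needed_subset inv r h') hl.2

lemma mem_initialRules {r : Rule A} :
    r ∈ initialRules inv R ↔ r ∈ R ∨ ∃ x, ([x, inv x], []) = r := by
  simp [initialRules]

lemma valid_initialRules {r : Rule A} (hr : r ∈ initialRules inv R) :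
    value inv R r.1 = value inv R r.2 := by
  rcases mem_initialRules.1 hr with hr | ⟨x, rfl⟩
  · exact value_of_mem hr
  · change value inv R [x, inv x] = value inv R []
    rw [value_cons, value_mul_inv, value_nil]

lemma IsInitial.store_eq (h : IsInitial inv R c) : c.1.store = initialRules inv R := by
  obtain ⟨l, W₁, W, -, -, -, rfl⟩ := h
  simp [Data.store]

lemma IsInitial.configInv (hR : ∀ r ∈ R, r ∈ SL2) (h : IsInitial inv R c) :
    ConfigInv inv R c := by
  have hs := h.store_eq
  obtain ⟨l, W₁, W, hl, h₁, h₂, rfl⟩ := h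
  have hlv : ∀ r ∈ l, value inv R r.1 = value inv R r.2 := fun r hr =>
    valid_initialRules (hl ▸ List.mem_toFinset.2 hr)
  have h0 : LabelsValid inv R (⟨∅, ∅, fun _ => []⟩ : WDiff A) :=
    ⟨value_nil, fun s x t h => absurd h (Finset.notMem_empty _)⟩
  obtain ⟨f₁, f₂⟩ := labelsValid_foldl h0 subset_rfl hlv
  have hW₁ : WDiffSound inv R W₁ :=
    ⟨h₁.needed_subset f₂, h₁.noBaseLoop, f₁.welding (fun _ _ => False.elim) h₁⟩
  have hW := hW₁.relabels hW₁.labelsValid.valid h₂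
  have hor : ∀ r ∈ initialRules inv R, rk r.2 < rk r.1 := by
    intro r hr
    rcases mem_initialRules.1 hr with hr | ⟨x, rfl⟩
    · exact rk_of_mem_SL2 (hR r hr)
    · exact rk_lt_of_length (by simp)
  have hlive : ∀ r ∈ initialRules inv R,
      r ∈ Data.live ⟨∅, ∅, initialRules inv R, ∅, W.arrows, W⟩ := fun r hr => Or.inr (Or.inr hr)
  have hconv : ∀ r ∈ initialRules inv R,
      Conv (Data.live ⟨∅, ∅, initialRules inv R, ∅, W.arrows, W⟩) (rk r.1 + 1) r.1 r.2 := by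
    intro r hr
    have := hor r hr
    exact Conv.of_elemRed (ElemRed.of_mem (hlive r hr)) (by omega) (by omega)
  simp only at hs
  refine ⟨⟨?_, ?_, hW.labelsValid.valid, hW, ?_, ?_⟩, ?_, ?_, ?_, ?_, ?_, ?_⟩
  · intro r hr
    simp only [Data.rulesOf, hs, Set.mem_ofPred_eq] at hr
    exact hor r hr
  · intro r hr
    simp only [Data.rulesOf, hs, Set.mem_ofPred_eq] at hr
    exact valid_initialRules hr
  · intro r hr
    simp only [hs] at hr
    exact hconv r hr
  · exact fun x => hconv _ (mem_initialRules.2 (Or.inr ⟨x, rfl⟩))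
  · simp
  · simp
  · simp
  · simp
  · simp
  · simp

lemma IsRun.configInv (hinv : Function.Involutive inv) (hR : ∀ r ∈ R, r ∈ SL2)
    {c : ℕ → Config A} (hc : IsRun inv R c) (t : ℕ) : ConfigInv inv R (c t) := by
  induction t with
  | zero => exact hc.1.configInv hR
  | succ t ih => exact (hc.2 t).configInv hinv ih

end InvariantPreserved

/-! ### Termination of the amalgamation of states -/

section Liveness

lemma WeldEq.mem_states {arr : Finset (Arrow A)} {seed : ℕ → ℕ → Prop}
    (hseed : ∀ s t, seed s t → s ∈ states arr ∧ t ∈ states arr) {s t : ℕ}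
    (h : WeldEq arr seed s t) : s = t ∨ s ∈ states arr ∧ t ∈ states arr := by
  induction h with
  | seed h => exact Or.inr (hseed _ _ h)
  | refl s => exact Or.inl rfl
  | symm _ ih => exact ih.imp Eq.symm And.symm
  | trans _ _ ih₁ ih₂ =>
    rcases ih₁ with rfl | ih₁
    · exact ih₂
    · rcases ih₂ with rfl | ih₂
      · exact Or.inr ih₁
      · exact Or.inr ⟨ih₁.1, ih₂.2⟩
  | fwd _ h₁ h₂ _ => exact Or.inr ⟨target_mem_states h₁, target_mem_states h₂⟩
  | bwd _ h₁ h₂ _ => exact Or.inr ⟨source_mem_states h₁, source_mem_states h₂⟩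
  | baseSource _ h _ => exact Or.inr ⟨source_mem_states h, target_mem_states h⟩
  | baseTarget _ h _ => exact Or.inr ⟨source_mem_states h, target_mem_states h⟩

lemma states_mapArrows_subset [DecidableEq A] {f : ℕ → ℕ} (f0 : f 0 = 0)
    (arr : Finset (Arrow A)) : states (mapArrows f arr) ⊆ (states arr).image f := by
  intro s hs
  simp only [states, Finset.mem_insert, Finset.mem_union, Finset.mem_image] at hs
  rcases hs with rfl | ⟨a, ha, rfl⟩ | ⟨a, ha, rfl⟩
  · exact Finset.mem_image.2 ⟨0, zero_mem_states _, f0⟩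
  · obtain ⟨⟨⟨s', x', t'⟩, hb, rfl⟩, -⟩ := mem_mapArrows.1 ha
    exact Finset.mem_image.2 ⟨s', source_mem_states hb, rfl⟩
  · obtain ⟨⟨⟨s', x', t'⟩, hb, rfl⟩, -⟩ := mem_mapArrows.1 ha
    exact Finset.mem_image.2 ⟨t', target_mem_states hb, rfl⟩

variable [LinearOrder A] [Fintype A]

/-- The sum of the ranks of the words attached to the states. -/
noncomputable def WDiff.labelSum (W : WDiff A) : ℕ := ∑ s ∈ states W.arrows, rk (W.label s)

/-- One round of amalgamation identifies states or makes a label smaller. -/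
lemma Amalgamates.decreases {W W' : WDiff A} (h : Amalgamates W W') (hW : ¬ Settled W) :
    (states W'.arrows).card < (states W.arrows).card ∨
      (states W'.arrows).card = (states W.arrows).card ∧ W'.labelSum < W.labelSum := by
  obtain ⟨W₁, ⟨ha, -, hl⟩, f, f0, hf, hf', rfl⟩ := h
  rw [ha] at hf hf'
  have hor : Oriented (SetOfRules W.arrows) := fun r hr => rk_of_mem_SL2 hr.2
  have hle : ∀ s ∈ states W.arrows, rk (W₁.label s) ≤ rk (W.label s) := fun s hs =>
    (Conv.of_reflTransGen hor (hl s hs).1).1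
  have hsub : states (mapArrows f W₁.arrows) ⊆ (states W.arrows).image f :=
    ha ▸ states_mapArrows_subset f0 W₁.arrows
  have c₁ := Finset.card_le_card hsub
  have c₂ := Finset.card_image_le (s := states W.arrows) (f := f)
  rcases (c₁.trans c₂).lt_or_eq with h | h
  · exact Or.inl h
  refine Or.inr ⟨h, ?_⟩
  have hinj : Set.InjOn f (states W.arrows) := Finset.card_image_iff.1 (by omega)
  have hfix : ∀ s ∈ states W.arrows, f s = s := by
    intro s hs
    have hfs : f s ∈ states W.arrows := by
      rcases (hf s).mem_states (by rintro s t ⟨h₁, h₂, -⟩; exact ⟨h₁, h₂⟩) with e | ⟨-, e⟩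
      · rwa [← e]
      · exact e
    exact hinj hfs hs (hf' _ _ (hf s)).symm
  have himg : (states W.arrows).image f = states W.arrows := by
    refine (Finset.image_congr fun s hs => hfix s hs).trans Finset.image_id
  have hst : states (mapArrows f W₁.arrows) = states W.arrows := by
    rw [himg] at hsub
    exact Finset.eq_of_subset_of_card_le hsub h.ge
  simp only [WDiff.labelSum, hst]
  refine Finset.sum_lt_sum hle ?_
  by_contra hno
  push Not at hno
  have heq : ∀ s ∈ states W.arrows, W₁.label s = W.label s := fun s hs =>
    rk_inj.1 (le_antisymm (hle s hs) (hno s hs))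
  refine hW ⟨fun s hs t ht hst => ?_, fun s hs => ?_⟩
  · have := hf' s t (WeldEq.seed ⟨hs, ht, by rw [heq s hs, heq t ht, hst]⟩)
    rwa [hfix s hs, hfix t ht] at this
  · have := (hl s hs).2
    rwa [heq s hs] at this

/-! ### Every pass ends -/

variable (inv : A → A) (R : Finset (Rule A))

/-- An infinite run in which the invariants hold at all times. -/
structure SoundRun (c : ℕ → Config A) : Prop where
  inv_at : ∀ t, ConfigInv inv R (c t)
  step_at : ∀ t, Step inv (c t) (c (t + 1))

variable {inv R} {c : ℕ → Config A}

/-- The possible steps inside the minimization routine. -/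
lemma Step.of_minimize {c c' : Config A} (h : Step inv c c') {ret : Control A} {input : Rule A}
    {f : Frame A} (hc : c.2 = .minimize ret input f) :
    (∃ f', c'.2 = .minimize ret input f' ∧ MinStep inv input (c.1, f) (c'.1, f')) ∨
      ∃ out s d₁, f = ⟨.output, out, s⟩ ∧ RecordsOutput inv out c.1 d₁ ∧
        DisposesInput input out d₁ c'.1 ∧ c'.2 = ret := by
  cases h with
  | minimize d d' ret' input' f₁ f' h =>
    simp only [Control.minimize.injEq] at hc
    obtain ⟨rfl, rfl, rfl⟩ := hc
    exact Or.inl ⟨f', rfl, h⟩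
  | handle d d₁ d₂ ret' input' out s h₁ h₂ =>
    simp only [Control.minimize.injEq] at hc
    obtain ⟨rfl, rfl, rfl⟩ := hc
    exact Or.inr ⟨out, s, d₁, rfl, h₁, h₂, rfl⟩
  | _ => exact absurd hc (by simp)

/-- Minimization reaches its output. -/
lemma SoundRun.exists_output (hc : SoundRun inv R c) {ret : Control A} {input : Rule A} :
    ∀ {f : Frame A} {t : ℕ}, (c t).2 = .minimize ret input f →
      ∃ t' ≥ t, ∃ out s, (c t').2 = .minimize ret input ⟨.output, out, s⟩ ∧
        Extends (FoundBelow (c t).1.rules (rk input.1)) (c t).1 (c t').1 := by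
  intro f
  induction f using (Frame.before_wf (A := A)).induction with
  | _ f ih =>
    intro t ht
    rcases (hc.step_at t).of_minimize ht with ⟨f', hf', hm⟩ | ⟨out, s, d₁, rfl, -⟩
    · have hi := hc.inv_at t
      obtain ⟨hf, hin, -⟩ := hi.frame _ _ _ ht
      have hlt := hi.data.oriented _ (live_subset_rulesOf _ hin)
      have hext := hm.extends hi.data hlt hf
      obtain ⟨t', ht', out, s, hout, hext'⟩ := ih f' (hm.before hi.data hf) hf'
      refine ⟨t', by omega, out, s, hout, ?_⟩
      rw [hext.rules_eq] at hext'
      exact hext.trans hext'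
    · exact ⟨t, le_rfl, out, s, ht, Extends.refl _⟩

/-- Minimization returns; in the meantime, `New` has lost the input and received only rules with
smaller left-hand sides. -/
lemma SoundRun.exists_return (hc : SoundRun inv R c) {ret : Control A} {input : Rule A}
    {f : Frame A} {t : ℕ} (ht : (c t).2 = .minimize ret input f) :
    ∃ t' ≥ t, (c t').2 = ret ∧ input ∉ (c t').1.new ∧
      ∀ r ∈ (c t').1.new, r ∈ (c t).1.new ∨ rk r.1 < rk input.1 := by
  obtain ⟨t', ht', out, s, hout, hext⟩ := hc.exists_output ht
  rcases (hc.step_at t').of_minimize hout with ⟨f', -, hm⟩ | ⟨out', s', d₁, he, h₁, h₂, hret⟩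
  · cases hm
  · simp only [Frame.mk.injEq, true_and] at he
    obtain ⟨rfl, rfl⟩ := he
    have hi := hc.inv_at t'
    have e : c t' = ((c t').1, .minimize ret input ⟨.output, out, s⟩) := Prod.ext rfl hout
    rw [e] at hi
    have hh := hi.handled h₁ h₂
    refine ⟨t' + 1, by omega, hret, hh.input_not_mem, fun r hr => ?_⟩
    exact (hext.mem_new r (hh.new_subset hr)).imp id fun h => h.1.2

lemma SoundRun.exists_new_of_considered (hc : SoundRun inv R c) :
    ∀ {n : ℕ} {t : ℕ} {todo : Finset (Rule A)}, todo.card = n → (c t).2 = .considered todo →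
      ∃ t' ≥ t, (c t').2 = .new := by
  intro n
  induction n with
  | zero =>
    intro t todo hn ht
    have hs := hc.step_at t
    rw [Finset.card_eq_zero] at hn
    subst hn
    generalize c t = a at *
    generalize hb : c (t + 1) = b at *
    cases hs with
    | pickConsidered d todo r h =>
      simp only [Control.considered.injEq] at ht
      subst ht
      exact absurd h (Finset.notMem_empty _)
    | endConsidered d => exact ⟨t + 1, by omega, by rw [hb]⟩
    | _ => exact absurd ht (by simp)
  | succ n ih =>
    intro t todo hn ht
    have hs := hc.step_at t
    generalize c t = a at *
    generalize hb : c (t + 1) = b at *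
    cases hs with
    | pickConsidered d todo' r h =>
      simp only [Control.considered.injEq] at ht
      subst ht
      obtain ⟨t', ht', hr, -⟩ := hc.exists_return (t := t + 1) (by rw [hb])
      obtain ⟨t'', ht'', h'⟩ := ih (by rw [Finset.card_erase_of_mem h]; omega) hr
      exact ⟨t'', by omega, h'⟩
    | endConsidered d => exact ⟨t + 1, by omega, by rw [hb]⟩
    | _ => exact absurd ht (by simp)

/-- The ranks of the left-hand sides of a set of rules, as a multiset: the Dershowitz–Manna order on
these multisets measures the progress in emptying `New`. -/
noncomputable def newRanks (s : Finset (Rule A)) : Multiset ℕ := s.val.map fun r => rk r.1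

lemma newRanks_lt {s s' : Finset (Rule A)} {r : Rule A} (hr : r ∈ s) (hr' : r ∉ s')
    (h : ∀ r' ∈ s', r' ∈ s ∨ rk r'.1 < rk r.1) :
    (newRanks s').IsDershowitzMannaLT (newRanks s) := by
  have key : ∀ a b : Finset (Rule A), newRanks a = newRanks (a ∩ b) + newRanks (a \ b) := by
    intro a b
    have hd : Disjoint (a ∩ b) (a \ b) := (Finset.disjoint_sdiff_inter a b).symm
    have : a = (a ∩ b).disjUnion (a \ b) hd := by
      rw [Finset.disjUnion_eq_union, Finset.union_comm, Finset.sdiff_union_inter]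
    conv_lhs => rw [this]
    simp [newRanks, Finset.disjUnion]
  refine ⟨newRanks (s' ∩ s), newRanks (s' \ s), newRanks (s \ s'), ?_, key _ _, ?_, ?_⟩
  · intro he
    have : rk r.1 ∈ newRanks (s \ s') :=
      Multiset.mem_map.2 ⟨r, Finset.mem_sdiff.2 ⟨hr, hr'⟩, rfl⟩
    rw [he] at this
    exact Multiset.notMem_zero _ this
  · rw [Finset.inter_comm]
    exact key _ _
  · intro y hy
    obtain ⟨q, hq, rfl⟩ := Multiset.mem_map.1 hy
    obtain ⟨hq, hq'⟩ := Finset.mem_sdiff.1 hq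
    refine ⟨rk r.1, ?_, (h q hq).resolve_left hq'⟩
    exact Multiset.mem_map.2 ⟨r, Finset.mem_sdiff.2 ⟨hr, hr'⟩, rfl⟩

/-- `New` is emptied: each minimized rule is replaced by finitely many rules with smaller left-hand
sides. -/
lemma SoundRun.exists_now_of_new (hc : SoundRun inv R c) :
    ∀ {M : Multiset ℕ} {t : ℕ}, newRanks (c t).1.new = M → (c t).2 = .new →
      ∃ t' ≥ t, (c t').2 = .now ∧ (c t').1.new = ∅ := by
  intro M
  induction M using
    (Multiset.wellFounded_isDershowitzMannaLT (α := ℕ)).induction with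
  | _ M ih =>
    intro t hM ht
    have hs := hc.step_at t
    have hret := fun input f => hc.exists_return (t := t + 1) (ret := .new) (input := input) (f := f)
    generalize c t = a at *
    generalize hb : c (t + 1) = b at *
    cases hs with
    | pickNew d r h =>
      obtain ⟨t', ht', h₁, h₂, h₃⟩ := hret _ _ rfl
      obtain ⟨t'', ht'', h'⟩ := ih _ (hM ▸ newRanks_lt h h₂ h₃) rfl h₁
      exact ⟨t'', by omega, h'⟩
    | endNew d h => exact ⟨t + 1, by omega, by rw [hb], by rw [hb]; exact h⟩
    | _ => exact absurd ht (by simp)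

lemma SoundRun.exists_now_of_overlaps (hc : SoundRun inv R c) :
    ∀ {n : ℕ} {t : ℕ} {todo : Finset (Word A × Word A)}, todo.card = n →
      (c t).2 = .overlaps todo → ∃ t' ≥ t, (c t').2 = .now ∧ (c t').1.now = (c t).1.now := by
  intro n
  induction n with
  | zero =>
    intro t todo hn ht
    have hs := hc.step_at t
    rw [Finset.card_eq_zero] at hn
    subst hn
    generalize c t = a at *
    generalize hb : c (t + 1) = b at *
    cases hs with
    | overlap d d₁ d₂ d₃ todo p w₁ w₂ hp h₁ h₂ h₃ =>
      simp only [Control.overlaps.injEq] at ht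
      subst ht
      exact absurd hp (Finset.notMem_empty _)
    | endOverlaps d => exact ⟨t + 1, by omega, by rw [hb], by rw [hb]⟩
    | _ => exact absurd ht (by simp)
  | succ n ih =>
    intro t todo hn ht
    have hs := hc.step_at t
    have hi := hc.inv_at t
    have ih' := fun todo => ih (t := t + 1) (todo := todo)
    generalize c t = a at *
    generalize hb : c (t + 1) = b at *
    cases hs with
    | overlap d d₁ d₂ d₃ todo' p w₁ w₂ hp h₁ h₂ h₃ =>
      simp only [Control.overlaps.injEq] at ht
      subst ht
      have hext := (overlap_spec hi.data (hi.todo_valid _ rfl p hp) h₁ h₂ h₃).1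
      obtain ⟨t', ht', h, h'⟩ := ih' _ (by rw [Finset.card_erase_of_mem hp]; omega) rfl
      exact ⟨t', by omega, h, h'.trans hext.now_eq⟩
    | endOverlaps d => exact ⟨t + 1, by omega, by rw [hb], by rw [hb]⟩
    | _ => exact absurd ht (by simp)

lemma SoundRun.exists_wdiff_of_now (hc : SoundRun inv R c) :
    ∀ {n : ℕ} {t : ℕ}, (c t).1.now.card = n → (c t).2 = .now → ∃ t' ≥ t, (c t').2 = .wdiff := by
  intro n
  induction n using Nat.strong_induction_on with
  | _ n ih =>
    intro t hn ht
    have hs := hc.step_at t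
    have hov := fun n todo => hc.exists_now_of_overlaps (t := t + 1) (n := n) (todo := todo)
    generalize c t = a at *
    generalize hb : c (t + 1) = b at *
    cases hs with
    | pickNow d r h =>
      obtain ⟨t', ht', h₁, h₂⟩ := hov _ _ rfl rfl
      have hlt : (c t').1.now.card < n := by
        rw [h₂, ← hn]
        exact Finset.card_erase_lt_of_mem h
      obtain ⟨t'', ht'', h'⟩ := ih _ hlt rfl h₁
      exact ⟨t'', by omega, h'⟩
    | endNow d h => exact ⟨t + 1, by omega, by rw [hb]⟩
    | _ => exact absurd ht (by simp)

lemma SoundRun.exists_delete_of_wdiff (hc : SoundRun inv R c) :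
    ∀ {p : ℕ × ℕ} {t : ℕ}, ((states (c t).1.wdiff.arrows).card, (c t).1.wdiff.labelSum) = p →
      (c t).2 = .wdiff → ∃ t' ≥ t, (c t').2 = .delete := by
  intro p
  induction p using
    (WellFounded.prod_lex (wellFounded_lt (α := ℕ)) (wellFounded_lt (α := ℕ))).induction with
  | _ p ih =>
    intro t hp ht
    have hs := hc.step_at t
    have ih' := fun q hq => ih q hq (t := t + 1)
    generalize c t = a at *
    generalize hb : c (t + 1) = b at *
    cases hs with
    | amalgamate d W h h' =>
      obtain ⟨t', ht', h''⟩ := ih' _ (by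
        rw [← hp, Prod.lex_def]
        exact h'.decreases h) rfl rfl
      exact ⟨t', by omega, h''⟩
    | copy d h => exact ⟨t + 1, by omega, by rw [hb]⟩
    | _ => exact absurd ht (by simp)

lemma SoundRun.exists_considered_of_delete (hc : SoundRun inv R c) {t : ℕ}
    (ht : (c t).2 = .delete) : (c (t + 1)).2 = .considered (c t).1.considered ∧
      (c (t + 1)).1.considered = (c t).1.considered := by
  have hs := hc.step_at t
  generalize c t = a at *
  generalize hb : c (t + 1) = b at *
  cases hs with
  | endPass d => exact ⟨rfl, rfl⟩
  | _ => exact absurd ht (by simp)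

lemma SoundRun.exists_delete_of_new (hc : SoundRun inv R c) {t : ℕ} (ht : (c t).2 = .new) :
    ∃ t' ≥ t, (c t').2 = .delete := by
  obtain ⟨t₁, h₁, h₁', -⟩ := hc.exists_now_of_new rfl ht
  obtain ⟨t₂, h₂, h₂'⟩ := hc.exists_wdiff_of_now rfl h₁'
  obtain ⟨t₃, h₃, h₃'⟩ := hc.exists_delete_of_wdiff rfl h₂'
  exact ⟨t₃, by omega, h₃'⟩

/-- The end of a pass is reached again and again. -/
lemma SoundRun.exists_delete (hc : SoundRun inv R c) (t : ℕ) : ∃ t' ≥ t, (c t').2 = .delete := by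
  have hcons : ∀ {t todo}, (c t).2 = .considered todo → ∃ t' ≥ t, (c t').2 = .delete := by
    intro t todo ht
    obtain ⟨t₁, h₁, h₁'⟩ := hc.exists_new_of_considered rfl ht
    obtain ⟨t₂, h₂, h₂'⟩ := hc.exists_delete_of_new h₁'
    exact ⟨t₂, by omega, h₂'⟩
  have hnow : ∀ {t}, (c t).2 = .now → ∃ t' ≥ t, (c t').2 = .delete := by
    intro t ht
    obtain ⟨t₂, h₂, h₂'⟩ := hc.exists_wdiff_of_now rfl ht
    obtain ⟨t₃, h₃, h₃'⟩ := hc.exists_delete_of_wdiff rfl h₂'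
    exact ⟨t₃, by omega, h₃'⟩
  rcases h : (c t).2 with todo | _ | ⟨ret, input, f⟩ | _ | todo | _ | _
  · exact hcons h
  · exact hc.exists_delete_of_new h
  · obtain ⟨t₁, h₁, h₁', -⟩ := hc.exists_return h
    rcases ((hc.inv_at t).frame _ _ _ h).2.2 with rfl | ⟨todo, rfl, -⟩
    · obtain ⟨t₂, h₂, h₂'⟩ := hc.exists_delete_of_new h₁'
      exact ⟨t₂, by omega, h₂'⟩
    · obtain ⟨t₂, h₂, h₂'⟩ := hcons h₁'
      exact ⟨t₂, by omega, h₂'⟩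
  · exact hnow h
  · obtain ⟨t₁, h₁, h₁', -⟩ := hc.exists_now_of_overlaps rfl h
    obtain ⟨t₂, h₂, h₂'⟩ := hnow h₁'
    exact ⟨t₂, by omega, h₂'⟩
  · exact hc.exists_delete_of_wdiff rfl h
  · exact ⟨t, le_rfl, h⟩

/-- `New` is empty again and again, when the treatment of `Now` begins. -/
lemma SoundRun.exists_now (hc : SoundRun inv R c) (t : ℕ) :
    ∃ t' ≥ t, (c t').2 = .now ∧ (c t').1.new = ∅ := by
  obtain ⟨t₁, h₁, h₁'⟩ := hc.exists_delete t
  obtain ⟨t₂, h₂, h₂'⟩ :=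
    hc.exists_new_of_considered rfl (hc.exists_considered_of_delete h₁').1
  obtain ⟨t₃, h₃, h₃'⟩ := hc.exists_now_of_new rfl h₂'
  exact ⟨t₃, by omega, h₃'⟩

end Liveness

section Persistence

variable [LinearOrder A] [Fintype A] {inv : A → A} {R : Finset (Rule A)} {c : ℕ → Config A}

/-! ### Reducibility and convertibility persist -/

lemma SoundRun.conv_mono (hc : SoundRun inv R c) {t t' : ℕ} (h : t ≤ t') {n : ℕ} {u v : Word A}
    (huv : Conv (c t).1.live n u v) : Conv (c t').1.live n u v := by
  induction t', h using Nat.le_induction with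
  | base => exact huv
  | succ t' _ ih => exact Conv.subst (fun r hr _ => (hc.step_at t').conv (hc.inv_at t') r hr) ih

lemma SoundRun.live_oriented (hc : SoundRun inv R c) (t : ℕ) : Oriented (c t).1.live :=
  fun r hr => (hc.inv_at t).data.oriented r (live_subset_rulesOf _ hr)

/-- A conversion from `r.1` to `r.2` through words up to `r.1` has to begin with a reduction of
`r.1`; so `r.1` remains reducible if `r` remains a consequence in this sense. -/
lemma reducible_of_conv {S T : Set (Rule A)} (hS : Oriented S) (hT : Oriented T)
    (h : ∀ r ∈ S, Conv T (rk r.1 + 1) r.1 r.2) {w : Word A} (hw : ¬ Irreducible S w) :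
    ¬ Irreducible T w := by
  unfold Irreducible at hw
  push Not at hw
  obtain ⟨r, hr, hrw⟩ := hw
  have hne : r.1 ≠ r.2 := fun e => by
    have := hS r hr
    rw [e] at this
    exact lt_irrefl _ this
  obtain ⟨b, hb, -⟩ := (h r hr).last_departure hT hne
  exact fun hi => not_irreducible_iff.2 ⟨b, hb⟩ (hi.infix hrw)

lemma SoundRun.reducible_mono (hc : SoundRun inv R c) {t t' : ℕ} (h : t ≤ t') {w : Word A}
    (hw : ¬ Irreducible (c t).1.live w) : ¬ Irreducible (c t').1.live w := by
  induction t', h using Nat.le_induction with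
  | base => exact hw
  | succ t' _ ih =>
    exact reducible_of_conv (hc.live_oriented _) (hc.live_oriented _)
      ((hc.step_at t').conv (hc.inv_at t')) ih

lemma SoundRun.live_reducible (hc : SoundRun inv R c) {t : ℕ} {w : Word A}
    (hw : ¬ Irreducible (c t).1.rulesOf w) : ¬ Irreducible (c t).1.live w :=
  reducible_of_conv (hc.inv_at t).data.oriented (hc.live_oriented t)
    (fun r hr => (hc.inv_at t).data.store_conv r hr) hw

/-- The rules of a program state which are in `Considered` or `Now`. -/
def Data.recorded (d : Data A) : Set (Rule A) := {r | r ∈ d.considered ∪ d.now}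

/-- Between the emptying of `New` and the formation of `Rules`, the word `w` is reducible by
the rules in `Considered` and `Now`. -/
def RecordedReducible (w : Word A) (c : Config A) : Prop :=
  c.2 = .now ∨ (∃ todo, c.2 = .overlaps todo) ∨ c.2 = .wdiff → ¬ Irreducible c.1.recorded w

lemma not_irreducible_mono {S T : Set (Rule A)} (h : S ⊆ T) {w : Word A}
    (hw : ¬ Irreducible S w) : ¬ Irreducible T w := fun hi => hw fun r hr => hi r (h hr)

lemma Step.recordedReducible {c c' : Config A} (hc : ConfigInv inv R c) (h : Step inv c c')
    {w : Word A} (hw : ¬ Irreducible c.1.live w) (hr : RecordedReducible w c) :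
    RecordedReducible w c' := by
  intro he
  cases h with
  | handle d d₁ d₂ ret input out s h₁ h₂ =>
    obtain ⟨-, -, hret⟩ := hc.frame _ _ _ rfl
    simp only at he
    rcases hret with h | ⟨todo, h, -⟩ <;> rw [h] at he <;> simp at he
  | endNew d h =>
    refine not_irreducible_mono (fun r hr => ?_) hw
    simp only [mem_live_iff, h, Finset.notMem_empty, or_false] at hr
    exact Finset.mem_union.2 hr
  | pickNow d r h =>
    refine not_irreducible_mono (fun r' hr' => ?_) (hr (Or.inl rfl))
    simp only [Data.recorded, Set.mem_ofPred_eq, Finset.mem_union, Finset.mem_insert,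
      Finset.mem_erase] at hr' ⊢
    tauto
  | overlap d d₁ d₂ d₃ todo p w₁ w₂ hp h₁ h₂ h₃ =>
    have hext := (overlap_spec hc.data (hc.todo_valid _ rfl p hp) h₁ h₂ h₃).1
    refine not_irreducible_mono (fun r' hr' => ?_) (hr (Or.inr (Or.inl ⟨_, rfl⟩)))
    simp only [Data.recorded, Set.mem_ofPred_eq, hext.considered_eq, hext.now_eq] at hr' ⊢
    exact hr'
  | endOverlaps d => exact hr (Or.inr (Or.inl ⟨_, rfl⟩))
  | endNow d h => exact hr (Or.inl rfl)
  | amalgamate d W h h' => exact hr (Or.inr (Or.inr rfl))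
  | _ => simp at he

/-- `Rules` changes only when it is formed from `WDiff`. -/
lemma Step.rules_eq {c c' : Config A} (hc : ConfigInv inv R c) (h : Step inv c c') :
    c'.2 ≠ .delete ∧ c'.1.rules = c.1.rules ∨ c.2 = .wdiff ∧ c'.1.rules = c.1.wdiff.needed := by
  have hd := hc.data
  cases h with
  | minimize d d' ret input f f' h =>
    obtain ⟨hf, hin, -⟩ := hc.frame _ _ _ rfl
    refine Or.inl ⟨by simp, ?_⟩
    exact (h.extends hd (hd.oriented _ (live_subset_rulesOf _ hin)) hf).rules_eq
  | handle d d₁ d₂ ret input out s h₁ h₂ =>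
    obtain ⟨-, -, hret⟩ := hc.frame _ _ _ rfl
    refine Or.inl ⟨?_, (hc.handled h₁ h₂).rules_eq⟩
    rcases hret with rfl | ⟨todo, rfl, -⟩ <;> simp
  | overlap d d₁ d₂ d₃ todo p w₁ w₂ hp h₁ h₂ h₃ =>
    refine Or.inl ⟨by simp, ?_⟩
    exact (overlap_spec hd (hc.todo_valid _ rfl p hp) h₁ h₂ h₃).1.rules_eq
  | copy d h => exact Or.inr ⟨rfl, rfl⟩
  | _ => exact Or.inl ⟨by simp, rfl⟩

lemma ConfigInv.autReducible_of_recorded {c : Config A} (hc : ConfigInv inv R c)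
    (h : c.2 = .wdiff) {w : Word A} (hw : RecordedReducible w c) :
    AutReducible c.1.wdiff.needed w := by
  have hw := hw (Or.inr (Or.inr h))
  unfold Irreducible at hw
  push Not at hw
  obtain ⟨r, hr, hrw⟩ := hw
  rw [show c = (c.1, .wdiff) from Prod.ext rfl h] at hc
  exact (hc.autReducible_needed hr).of_infix hrw

/-- A word which is reducible by the explicit rules at some time is `Aut`-reducible at all times from
some time on. -/
lemma SoundRun.eventually_autReducible (hc : SoundRun inv R c) {t : ℕ} {w : Word A}
    (hw : ¬ Irreducible (c t).1.rulesOf w) :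
    ∃ T, ∀ t' ≥ T, AutReducible (c t').1.rules w := by
  have hlive := hc.live_reducible hw
  obtain ⟨t₁, h₁, hnow, hnew⟩ := hc.exists_now t
  have hrec : ∀ t' ≥ t₁, RecordedReducible w (c t') := by
    intro t' ht'
    induction t', ht' using Nat.le_induction with
    | base =>
      intro _
      refine not_irreducible_mono (fun r hr => ?_) (hc.reducible_mono h₁ hlive)
      simp only [mem_live_iff, hnew, Finset.notMem_empty, or_false] at hr
      exact Finset.mem_union.2 hr
    | succ t' ht' ih =>
      exact (hc.step_at t').recordedReducible (hc.inv_at t')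
        (hc.reducible_mono (h₁.trans ht') hlive) ih
  obtain ⟨t₂, h₂, hdel⟩ := hc.exists_delete (t₁ + 1)
  obtain ⟨k, rfl⟩ : ∃ k, t₂ = k + 1 := ⟨t₂ - 1, by omega⟩
  refine ⟨k + 1, fun t' ht' => ?_⟩
  induction t', ht' using Nat.le_induction with
  | base =>
    rcases (hc.step_at k).rules_eq (hc.inv_at k) with ⟨h, -⟩ | ⟨h, h'⟩
    · exact absurd hdel h
    · rw [h']
      exact (hc.inv_at k).autReducible_of_recorded h (hrec k (by omega))
  | succ t' ht' ih =>
    rcases (hc.step_at t').rules_eq (hc.inv_at t') with ⟨-, h⟩ | ⟨h, h'⟩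
    · rw [h]
      exact ih
    · rw [h']
      exact (hc.inv_at t').autReducible_of_recorded h (hrec t' (by omega))

/-! ### Stable rules -/

/-- A live rule remains live except when it is the input of a minimization with another output. -/
lemma Step.mem_live {c c' : Config A} (hc : ConfigInv inv R c) (h : Step inv c c') {r : Rule A}
    (hr : r ∈ c.1.live)
    (hout : ∀ ret out s, c.2 = .minimize ret r ⟨.output, out, s⟩ → out = r) : r ∈ c'.1.live := by
  have hd := hc.data
  cases h with
  | minimize d d' ret input f f' h =>
    obtain ⟨hf, hin, -⟩ := hc.frame _ _ _ rfl
    exact (h.extends hd (hd.oriented _ (live_subset_rulesOf _ hin)) hf).live_subset hr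
  | handle d d₁ d₂ ret input out s h₁ h₂ =>
    have hh := hc.handled h₁ h₂
    by_cases he : r = input
    · subst he
      have := hout _ _ _ rfl
      subst this
      have hne : out ≠ ([], []) := by
        rintro rfl
        exact lt_irrefl _ (hd.oriented _ (live_subset_rulesOf _ hr))
      have := hh.out_mem hne
      rw [Finset.mem_union] at this
      exact this.imp id Or.inl
    · exact hh.live_of_ne r hr he
  | pickNow d r' h =>
    simp only [mem_live_iff, Finset.mem_insert, Finset.mem_erase] at hr ⊢
    tauto
  | overlap d d₁ d₂ d₃ todo p w₁ w₂ hp h₁ h₂ h₃ =>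
    exact (overlap_spec hd (hc.todo_valid _ rfl p hp) h₁ h₂ h₃).1.live_subset hr
  | _ => exact hr

/-- A rule in `Considered` or `Now` leaves these sets only by ceasing to be live. -/
lemma Step.mem_recorded {c c' : Config A} (hc : ConfigInv inv R c) (h : Step inv c c')
    {r : Rule A} (hr : r ∈ c.1.considered ∪ c.1.now) (hr' : r ∈ c'.1.live) :
    r ∈ c'.1.considered ∪ c'.1.now := by
  have hd := hc.data
  cases h with
  | minimize d d' ret input f f' h =>
    obtain ⟨hf, hin, -⟩ := hc.frame _ _ _ rfl
    have hext := h.extends hd (hd.oriented _ (live_subset_rulesOf _ hin)) hf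
    simp only [hext.considered_eq, hext.now_eq] at hr ⊢
    exact hr
  | handle d d₁ d₂ ret input out s h₁ h₂ =>
    have hh := hc.handled h₁ h₂
    by_cases he : r = input
    · subst he
      exact hh.input_mem hr'
    · exact hh.recorded_of_ne r hr he
  | pickNow d r' h =>
    simp only [Finset.mem_union, Finset.mem_insert, Finset.mem_erase] at hr ⊢
    tauto
  | overlap d d₁ d₂ d₃ todo p w₁ w₂ hp h₁ h₂ h₃ =>
    have hext := (overlap_spec hd (hc.todo_valid _ rfl p hp) h₁ h₂ h₃).1
    simp only [hext.considered_eq, hext.now_eq] at hr ⊢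
    exact hr
  | _ => exact hr

/-- A rule which is live from some time on is in `Considered` at the end of each late pass. -/
lemma SoundRun.eventually_considered (hc : SoundRun inv R c) {r : Rule A} {T : ℕ}
    (hr : ∀ t ≥ T, r ∈ (c t).1.live) :
    ∃ T', ∀ t ≥ T', (c t).2 = .delete → r ∈ (c t).1.considered := by
  obtain ⟨t₁, h₁, -, hnew⟩ := hc.exists_now T
  refine ⟨t₁, fun t ht hdel => ?_⟩
  have : r ∈ (c t).1.considered ∪ (c t).1.now := by
    clear hdel
    induction t, ht using Nat.le_induction with
    | base =>
      have := hr t₁ h₁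
      simp only [mem_live_iff, hnew, Finset.notMem_empty, or_false] at this
      exact Finset.mem_union.2 this
    | succ t ht ih => exact (hc.step_at t).mem_recorded (hc.inv_at t) ih (hr _ (by omega))
  rwa [(hc.inv_at t).now_empty (Or.inr hdel), Finset.union_empty] at this

/-- A rule which still has to be minimized in the current pass is minimized. -/
lemma SoundRun.exists_output_of_mem (hc : SoundRun inv R c) {r : Rule A} :
    ∀ {n : ℕ} {t : ℕ} {todo : Finset (Rule A)}, todo.card = n → (c t).2 = .considered todo →
      r ∈ todo → ∃ t' ≥ t, ∃ ret out s, (c t').2 = .minimize ret r ⟨.output, out, s⟩ := by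
  intro n
  induction n with
  | zero =>
    intro t todo hn _ hr
    rw [Finset.card_eq_zero] at hn
    subst hn
    exact absurd hr (Finset.notMem_empty _)
  | succ n ih =>
    intro t todo hn ht hr
    have hs := hc.step_at t
    generalize c t = a at *
    generalize hb : c (t + 1) = b at *
    cases hs with
    | pickConsidered d todo' r' h =>
      simp only [Control.considered.injEq] at ht
      subst ht
      have hb' : (c (t + 1)).2 = .minimize (.considered (todo'.erase r')) r'
        ⟨.reducePrefix, r', r'⟩ := by rw [hb]
      by_cases he : r = r'
      · subst he
        obtain ⟨t', ht', out, s, h', -⟩ := hc.exists_output hb'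
        exact ⟨t', by omega, _, out, s, h'⟩
      · obtain ⟨t', ht', h', -⟩ := hc.exists_return hb'
        obtain ⟨t'', ht'', h''⟩ := ih (by rw [Finset.card_erase_of_mem h]; omega) h'
          (Finset.mem_erase.2 ⟨he, hr⟩)
        exact ⟨t'', by omega, h''⟩
    | endConsidered d =>
      simp only [Control.considered.injEq] at ht
      subst ht
      exact absurd hr (Finset.notMem_empty _)
    | _ => exact absurd ht (by simp)

/-- A rule which is live from some time on is minimized again and again. -/
lemma SoundRun.exists_late_output (hc : SoundRun inv R c) {r : Rule A} {T : ℕ}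
    (hr : ∀ t ≥ T, r ∈ (c t).1.live) (T' : ℕ) :
    ∃ t ≥ T', ∃ ret out s, (c t).2 = .minimize ret r ⟨.output, out, s⟩ := by
  obtain ⟨T₁, h₁⟩ := hc.eventually_considered hr
  obtain ⟨t, ht, hdel⟩ := hc.exists_delete (max T₁ T')
  have := hc.exists_considered_of_delete hdel
  obtain ⟨t', ht', h⟩ := hc.exists_output_of_mem rfl this.1
    (h₁ t ((le_max_left _ _).trans ht) hdel)
  exact ⟨t', by omega, h⟩

variable (c) in
/-- The permanent rules which are live from some time on. -/
def stableRules : Set (Rule A) := {r | Permanent c r ∧ ∃ T, ∀ t ≥ T, r ∈ (c t).1.live}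

variable (c) in
/-- Convertibility, at some time, by live rules through words of rank less than `n`. -/
def ConvBelow (n : ℕ) (u v : Word A) : Prop := ∃ t, Conv (c t).1.live n u v

lemma SoundRun.convBelow_trans (hc : SoundRun inv R c) {n : ℕ} {u v w : Word A}
    (h : ConvBelow c n u v) (h' : ConvBelow c n v w) : ConvBelow c n u w := by
  obtain ⟨t, h⟩ := h
  obtain ⟨t', h'⟩ := h'
  exact ⟨max t t', (hc.conv_mono (le_max_left _ _) h).trans (hc.conv_mono (le_max_right _ _) h')⟩

lemma ConvBelow.symm {n : ℕ} {u v : Word A} (h : ConvBelow c n u v) : ConvBelow c n v u := by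
  obtain ⟨t, h⟩ := h
  exact ⟨t, h.symm⟩

/-- If minimization never changes the rule `r` from some time on, then `r` is stable. -/
lemma SoundRun.stable_of_output (hc : SoundRun inv R c) {r : Rule A} {T : ℕ}
    (hr : r ∈ (c T).1.live)
    (hout : ∀ t ≥ T, ∀ ret out s, (c t).2 = .minimize ret r ⟨.output, out, s⟩ → out = r) :
    r ∈ stableRules c := by
  have hlive : ∀ t ≥ T, r ∈ (c t).1.live := by
    intro t ht
    induction t, ht using Nat.le_induction with
    | base => exact hr
    | succ t ht ih => exact (hc.step_at t).mem_live (hc.inv_at t) ih (hout t ht)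
  have key : ∀ w, ¬ PermanentlyIrreducible c w →
      ∃ t ret s, (c t).2 = .minimize ret r ⟨.output, r, s⟩ ∧ AutReducible (c t).1.rules w := by
    intro w hw
    unfold PermanentlyIrreducible at hw
    push Not at hw
    obtain ⟨T₁, hw⟩ := hw
    obtain ⟨T₂, hT₂⟩ := hc.eventually_autReducible (hw T₁ le_rfl)
    obtain ⟨t, ht, ret, out, s, ho⟩ := hc.exists_late_output hlive (max T T₂)
    have := hout t ((le_max_left _ _).trans ht) _ _ _ ho
    subst this
    exact ⟨t, ret, s, ho, hT₂ t ((le_max_right _ _).trans ht)⟩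
  refine ⟨⟨?_, fun w hw hne => ?_⟩, T, hlive⟩
  · by_contra h
    obtain ⟨t, ret, s, ho, hred⟩ := key _ h
    exact ((hc.inv_at t).frame _ _ _ ho).1.rhs_irreducible hred
  · by_contra h
    obtain ⟨t, ret, s, ho, hred⟩ := key _ h
    have := ((hc.inv_at t).frame _ _ _ ho).1.proper (by simp [MinLine.index]) ⟨w, hw, hne, hred⟩
    exact absurd this (not_lt.2 (rk_fst_le_top r))

/-- Each live rule `(l, ρ)` is superseded by a stable reduction: some stable rule reduces `l` to a word
which is convertible to `ρ` through words below `l`. Either minimization leaves the rule unchanged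
forever, and it is stable itself, or the output of a minimization expresses it by smaller rules. -/
lemma SoundRun.exists_stable (hc : SoundRun inv R c) (r : Rule A) :
    ∀ T, r ∈ (c T).1.live → ∃ b, ElemRed (stableRules c) r.1 b ∧ ConvBelow c (rk r.1) r.2 b := by
  induction r using (InvImage.wf (fun r : Rule A => (rk r.1, rk r.2))
    (WellFounded.prod_lex (wellFounded_lt (α := ℕ)) (wellFounded_lt (α := ℕ)))).induction with
  | _ r ih =>
    intro T hT
    by_cases hex : ∀ t ≥ T, ∀ ret out s, (c t).2 = .minimize ret r ⟨.output, out, s⟩ → out = r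
    · exact ⟨r.2, ElemRed.of_mem (hc.stable_of_output hT hex), 0, Conv.refl _⟩
    · push Not at hex
      obtain ⟨t, ht, ret, out, s, ho, hne⟩ := hex
      have hi := hc.inv_at t
      obtain ⟨hf, hin, -⟩ := hi.frame _ _ _ ho
      have hlt := hc.live_oriented t r hin
      have hout : out ≠ ([], []) → out ∈ (c (t + 1)).1.live := by
        intro hne'
        rcases (hc.step_at t).of_minimize ho with ⟨f', -, hm⟩ | ⟨out', s', d₁, he, h₁, h₂, -⟩
        · cases hm
        · simp only [Frame.mk.injEq, true_and] at he
          obtain ⟨rfl, rfl⟩ := he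
          have e : c t = ((c t).1, .minimize ret r ⟨.output, out, s⟩) := Prod.ext rfl ho
          rw [e] at hi
          have := (hi.handled h₁ h₂).out_mem hne'
          rw [Finset.mem_union] at this
          exact this.imp id Or.inl
      -- The input follows from the output and from the live rules with smaller left-hand side.
      set S : Set (Rule A) := {r' | r' ∈ (c t).1.live ∧ rk r'.1 < rk r.1} ∪
        {r' | r' = out ∧ out ≠ ([], [])} with hS
      have hSor : Oriented S := by
        rintro r' (h | ⟨rfl, h⟩)
        · exact hc.live_oriented t r' h.1
        · exact rk_of_mem_SL2 (hf.output_mem.resolve_left h)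
      have hconv : Conv S (rk r.1 + 1) r.1 r.2 := by
        refine hf.pair.joined S Set.subset_union_left ?_
        by_cases htriv : out = ([], [])
        · simp only [htriv]
          exact Conv.refl _
        · exact Conv.of_elemRed (ElemRed.of_mem (Or.inr ⟨rfl, htriv⟩))
            (Nat.lt_succ_of_le (rk_fst_le_top out)) (Nat.lt_succ_of_le (rk_snd_le_top out))
      have hSconv : ∀ r' ∈ S, Conv (c (t + 1)).1.live (rk r'.1 + 1) r'.1 r'.2 := by
        intro r' hr'
        have hlt' := hSor r' hr'
        rcases hr' with h | ⟨rfl, h⟩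
        · exact (hc.step_at t).conv hi r' h.1
        · exact Conv.of_elemRed (ElemRed.of_mem (hout h)) (by omega) (by omega)
      -- Such a conversion reduces `r.1` by some `r'`, which is smaller than `r`.
      obtain ⟨b, ⟨r', hr', x, y, hx, rfl⟩, hb⟩ := hconv.last_departure hSor
        (fun e => by rw [e] at hlt; exact lt_irrefl _ hlt)
      have hsmall : rk r'.1 < rk r.1 ∨ rk r'.1 = rk r.1 ∧ rk r'.2 < rk r.2 := by
        rcases hr' with h | ⟨rfl, -⟩
        · exact Or.inl h.2
        · rcases hf.pair.order with h | ⟨h, h'⟩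
          · exact Or.inl ((rk_fst_le_top r').trans_lt h)
          · simp only at h h'
            refine Or.inr ⟨by rw [h], lt_of_le_of_ne h' fun e => hne ?_⟩
            exact Prod.ext h (rk_inj.1 e)
      obtain ⟨T', hT'⟩ : ∃ T', r' ∈ (c T').1.live := by
        rcases hr' with h | ⟨rfl, h⟩
        · exact ⟨t, h.1⟩
        · exact ⟨t + 1, hout h⟩
      obtain ⟨b', hb', t', hconv'⟩ := ih r' (Prod.lex_def.2 hsmall) T' hT'
      refine ⟨x ++ b' ++ y, ?_, ?_⟩
      · rw [hx]
        exact hb'.context x y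
      · refine hc.convBelow_trans (v := x ++ r'.2 ++ y) ?_ ⟨t', ?_⟩
        · exact ⟨t + 1, (Conv.subst (fun r hr _ => hSconv r hr) hb).symm⟩
        · rw [hx]
          exact hconv'.context_lt x y

end Persistence

section Confluence

variable [LinearOrder A] [Fintype A] {inv : A → A} {R : Finset (Rule A)} {c : ℕ → Config A}

/-! ### Confluence of the stable rules -/

lemma SoundRun.stable_oriented (hc : SoundRun inv R c) : Oriented (stableRules c) := by
  rintro r ⟨-, T, hT⟩
  exact hc.live_oriented T r (hT T le_rfl)

lemma ConvBelow.context {w u v : Word A} (a b : Word A) (h : ConvBelow c (rk w) u v) :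
    ConvBelow c (rk (a ++ w ++ b)) (a ++ u ++ b) (a ++ v ++ b) :=
  h.imp fun _ h => h.context_lt a b

/-- In a late pass both rules are in `Considered`, so that their critical pairs have been treated. -/
lemma SoundRun.critPair_joined (hc : SoundRun inv R c) {r₁ r₂ : Rule A} (h₁ : r₁ ∈ stableRules c)
    (h₂ : r₂ ∈ stableRules c) {p : Word A × Word A} (hp : p ∈ critPairs r₁ r₂) :
    ∃ t, Joined (c t).1.live p := by
  obtain ⟨-, T₁, h₁⟩ := h₁
  obtain ⟨-, T₂, h₂⟩ := h₂
  obtain ⟨T₁', h₁⟩ := hc.eventually_considered h₁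
  obtain ⟨T₂', h₂⟩ := hc.eventually_considered h₂
  obtain ⟨t, ht, hdel⟩ := hc.exists_delete (max T₁' T₂')
  have := (hc.inv_at t).crit r₁ (h₁ t ((le_max_left _ _).trans ht) hdel) r₂
    (h₂ t ((le_max_right _ _).trans ht) hdel) p hp
  rcases this with ⟨todo, h, -⟩ | h
  · rw [hdel] at h
    cases h
  · exact ⟨t, h⟩

lemma SoundRun.convBelow_of_overlap (hc : SoundRun inv R c) {r₁ r₂ : Rule A}
    (h₁ : r₁ ∈ stableRules c) (h₂ : r₂ ∈ stableRules c) {s₁ z s₂ : Word A} (hz : z ≠ [])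
    (e₁ : r₁.1 = s₁ ++ z) (e₂ : r₂.1 = z ++ s₂) :
    ConvBelow c (rk (s₁ ++ z ++ s₂)) (r₁.2 ++ s₂) (s₁ ++ r₂.2) := by
  obtain ⟨t, ht⟩ := hc.critPair_joined h₁ h₂ (mem_critPairs.2 ⟨s₁, z, s₂, hz, e₁, e₂, rfl⟩)
  refine ⟨t, Conv.mono subset_rfl ?_ ht⟩
  have k₁ := (rk_context_lt [] s₂).2 (hc.stable_oriented r₁ h₁)
  have k₂ := (rk_context_lt s₁ []).2 (hc.stable_oriented r₂ h₂)
  simp only [List.nil_append, List.append_nil, e₁, e₂] at k₁ k₂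
  rw [← List.append_assoc] at k₂
  exact Nat.succ_le_of_lt (max_lt k₁ k₂)

/-- Two reductions of a word by stable rules, the first of them at its beginning. -/
lemma SoundRun.convBelow_of_prefix (hc : SoundRun inv R c) {r₁ r₂ : Rule A}
    (h₁ : r₁ ∈ stableRules c) (h₂ : r₂ ∈ stableRules c) {x b₁ b₂ : Word A}
    (e : r₁.1 ++ b₁ = x ++ (r₂.1 ++ b₂)) :
    ConvBelow c (rk (r₁.1 ++ b₁)) (r₁.2 ++ b₁) (x ++ (r₂.2 ++ b₂)) := by
  have hdisj : ∀ y, x = r₁.1 ++ y → b₁ = y ++ (r₂.1 ++ b₂) →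
      ConvBelow c (rk (r₁.1 ++ b₁)) (r₁.2 ++ b₁) (x ++ (r₂.2 ++ b₂)) := by
    rintro y rfl rfl
    obtain ⟨-, T₁, k₁⟩ := id h₁
    obtain ⟨-, T₂, k₂⟩ := id h₂
    have l₁ := ElemRed.of_mem (k₁ _ (le_max_left T₁ T₂))
    have l₂ := ElemRed.of_mem (k₂ _ (le_max_right T₁ T₂))
    have l₁' := l₁.context [] (y ++ (r₂.2 ++ b₂))
    have l₂' := l₂.context (r₁.2 ++ y) b₂
    have m₁ := l₁.context [] (y ++ (r₂.1 ++ b₂))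
    have m₂ := l₂.context (r₁.1 ++ y) b₂
    simp only [List.nil_append, List.append_assoc] at l₁' l₂' m₁ m₂ ⊢
    have hor := hc.live_oriented (max T₁ T₂)
    have o₁' := hor.rk_lt l₁'
    have p₁ := hor.rk_lt m₁
    have p₂ := hor.rk_lt m₂
    exact ⟨max T₁ T₂, (Conv.of_elemRed l₂' p₁ (o₁'.trans p₂)).trans
      (Conv.of_elemRed l₁' p₂ (o₁'.trans p₂)).symm⟩
  rcases List.append_eq_append_iff.1 e with ⟨y, hx, hb⟩ | ⟨z, hr, hb⟩
  · exact hdisj y hx hb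
  · rcases eq_or_ne z [] with rfl | hz
    · rw [List.append_nil] at hr
      exact hdisj [] (by rw [hr, List.append_nil]) (by rw [hb]; rfl)
    · have hover : ∀ y, r₂.1 = z ++ y → b₁ = y ++ b₂ →
          ConvBelow c (rk (r₁.1 ++ b₁)) (r₁.2 ++ b₁) (x ++ (r₂.2 ++ b₂)) := by
        rintro y hy rfl
        have := (hc.convBelow_of_overlap h₁ h₂ hz hr hy).context [] b₂
        simp only [hr, List.nil_append, List.append_assoc] at this ⊢
        exact this
      rcases List.append_eq_append_iff.1 hb with ⟨y, hz', hb'⟩ | ⟨y, hy, hb'⟩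
      · -- The left-hand side of `r₂` lies inside that of the permanent rule `r₁`.
        rw [hz'] at hr
        by_cases hne : r₂.1 = r₁.1
        · have hl := congrArg List.length hr
          simp only [hne, List.length_append] at hl
          obtain rfl := List.eq_nil_of_length_eq_zero (show y.length = 0 by omega)
          exact hover [] (by rw [hz', List.append_nil, List.append_nil]) hb'.symm
        · obtain ⟨-, T, hT⟩ := id h₂
          obtain ⟨t, ht, hi⟩ := h₁.1.2 r₂.1 ⟨x, y, by rw [hr, List.append_assoc]⟩ hne T
          exact absurd (List.infix_refl _) (hi r₂ (live_subset_rulesOf _ (hT t ht)))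
      · exact hover y hy hb'

lemma SoundRun.convBelow_of_peak (hc : SoundRun inv R c) {w u v : Word A}
    (hu : ElemRed (stableRules c) w u) (hv : ElemRed (stableRules c) w v) :
    ConvBelow c (rk w) u v := by
  obtain ⟨r₁, h₁, a₁, b₁, rfl, rfl⟩ := hu
  obtain ⟨r₂, h₂, a₂, b₂, e, rfl⟩ := hv
  rw [List.append_assoc, List.append_assoc] at e
  rcases List.append_eq_append_iff.1 e with ⟨x, rfl, he⟩ | ⟨x, rfl, he⟩
  · have := (hc.convBelow_of_prefix h₁ h₂ he).context a₁ []
    simpa only [List.append_nil, List.append_assoc] using this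
  · have := (hc.convBelow_of_prefix h₂ h₁ he).context a₂ []
    simp only [List.append_nil, List.append_assoc] at this e ⊢
    rw [e]
    exact this.symm

lemma exists_fullyReduces {S : Set (Rule A)} (hS : Oriented S) (w : Word A) :
    ∃ n, FullyReduces S w n := by
  induction w using (InvImage.wf (rk (A := A)) wellFounded_lt).induction with
  | _ w ih =>
    by_cases h : Irreducible S w
    · exact ⟨w, Relation.ReflTransGen.refl, h⟩
    · obtain ⟨v, hv⟩ := not_irreducible_iff.1 h
      obtain ⟨n, hn⟩ := ih v (hS.rk_lt hv)
      exact ⟨n, hn.1.head hv, hn.2⟩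

lemma FullyReduces.cases {S : Set (Rule A)} {w n : Word A} (h : FullyReduces S w n) :
    w = n ∨ ∃ a, ElemRed S w a ∧ FullyReduces S a n := by
  rcases Relation.ReflTransGen.cases_head h.1 with h' | ⟨a, ha, h'⟩
  · exact Or.inl h'
  · exact Or.inr ⟨a, ha, h', h.2⟩

/-- Words which are convertible by live rules have the same normal form by stable rules. The proof is
by induction on the bound for the words in the conversion: each step of the conversion is replaced,
by `SoundRun.exists_stable`, by a stable reduction followed by a conversion with a lower bound, and
two stable reductions of a word lead to words convertible below it. -/
lemma SoundRun.fullyReduces_unique (hc : SoundRun inv R c) (m : ℕ) :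
    ∀ {x y n₁ n₂ : Word A}, rk x < m → rk y < m → ConvBelow c m x y →
      FullyReduces (stableRules c) x n₁ → FullyReduces (stableRules c) y n₂ → n₁ = n₂ := by
  induction m using Nat.strong_induction_on with
  | _ m ih =>
    have hS := hc.stable_oriented
    have self : ∀ {z n₁ n₂ : Word A}, rk z < m → FullyReduces (stableRules c) z n₁ →
        FullyReduces (stableRules c) z n₂ → n₁ = n₂ := by
      intro z n₁ n₂ hz h₁ h₂
      rcases h₁.cases with rfl | ⟨a, ha, h₁'⟩
      · rcases h₂.cases with rfl | ⟨b, hb, -⟩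
        · rfl
        · exact absurd h₁.2 (not_irreducible_iff.2 ⟨b, hb⟩)
      · rcases h₂.cases with rfl | ⟨b, hb, h₂'⟩
        · exact absurd h₂.2 (not_irreducible_iff.2 ⟨a, ha⟩)
        · exact ih _ hz (hS.rk_lt ha) (hS.rk_lt hb) (hc.convBelow_of_peak ha hb) h₁' h₂'
    have step : ∀ {t : ℕ} {x y n₁ n₂ : Word A}, rk x < m → ElemRed (c t).1.live x y →
        FullyReduces (stableRules c) x n₁ → FullyReduces (stableRules c) y n₂ → n₁ = n₂ := by
      rintro t x y n₁ n₂ hx hxy h₁ h₂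
      have hyx := (hc.live_oriented t).rk_lt hxy
      obtain ⟨r, hr, a, b, rfl, rfl⟩ := hxy
      obtain ⟨d, hd, hconv⟩ := hc.exists_stable r t hr
      have hd := hd.context a b
      obtain ⟨n, hn⟩ := exists_fullyReduces hS (a ++ d ++ b)
      rw [self hx h₁ ⟨hn.1.head hd, hn.2⟩]
      exact (ih _ hx hyx (hS.rk_lt hd) (hconv.context a b) h₂ hn).symm
    rintro x y n₁ n₂ - hy ⟨t, h⟩ h₁ h₂
    induction h using Relation.ReflTransGen.head_induction_on generalizing n₁ with
    | refl => exact self hy h₁ h₂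
    | head hs _ ih' =>
      obtain ⟨k₁, k₂, k⟩ := hs
      obtain ⟨n, hn⟩ := exists_fullyReduces hS _
      rw [← ih' hn]
      rcases k with k | k
      · exact step k₁ k h₁ hn
      · exact (step k₂ k hn h₁).symm

end Confluence

/-! ### Termination of `Aut`-reduction -/

section AutReduction

variable [LinearOrder A] [Fintype A] {inv : A → A} {R : Finset (Rule A)} {d : Data A}

lemma exists_leastWord {P : Set (Word A)} (hP : P.Nonempty) : ∃ v, LeastWord P v := by
  refine ⟨Function.argminOn rk P hP, Function.argminOn_mem _ _ _, fun w hw => ?_⟩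
  rcases (Function.argminOn_le rk P hw).lt_or_eq with h | h
  · exact Or.inr (rk_lt.1 h)
  · exact Or.inl (rk_inj.1 h).symm

lemma exists_autStep {w : Word A} (hw : AutReducible d.rules w) : ∃ q, AutStep (d, w) q := by
  have hmin : ∃ l, l <:+: w ∧ AutReducible d.rules l ∧ ¬ ProperSubwordReducible d.rules l := by
    induction w using (InvImage.wf (rk (A := A)) wellFounded_lt).induction with
    | _ w ih =>
      by_cases h : ProperSubwordReducible d.rules w
      · obtain ⟨s, hs, hne, h⟩ := h
        obtain ⟨l, hl, hl'⟩ := ih s (rk_infix_lt hs hne) h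
        exact ⟨l, hl.trans hs, hl'⟩
      · exact ⟨w, List.infix_refl _, hw, h⟩
  obtain ⟨l, ⟨a, b, rfl⟩, hl, hproper⟩ := hmin
  by_cases hst : ∃ σ, (l, σ) ∈ d.store
  · obtain ⟨ρ, hρ⟩ := exists_leastWord (P := {σ | (l, σ) ∈ d.store}) hst
    exact ⟨_, AutStep.stored d a l b ρ hl hproper hρ⟩
  · push Not at hst
    obtain ⟨r, hr, hrl⟩ : ∃ r ∈ SetOfRules d.rules, r.1 <:+: l := by
      have := hl
      unfold AutReducible Irreducible at this
      push Not at this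
      exact this
    have hrl' : r.1 = l := by
      by_contra hne
      exact hproper ⟨r.1, hrl, hne, fun hi => hi r hr (List.infix_refl _)⟩
    subst hrl'
    obtain ⟨ρ, hρ⟩ := exists_leastWord (P := {σ | (r.1, σ) ∈ SetOfRules d.rules}) ⟨r.2, hr⟩
    exact ⟨_, AutStep.found d a r.1 b ρ hl hproper hst hρ⟩

lemma DataSound.acc_autStep (hd : DataSound inv R d) (w : Word A) :
    Acc (fun q p => AutStep p q) (d, w) := by
  induction w using (InvImage.wf (rk (A := A)) wellFounded_lt).induction generalizing d with
  | _ w ih =>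
    refine Acc.intro _ fun q hq => ?_
    exact ih q.2 (hq.rk_lt hd) (hd.found (hq.spec hd).1)

lemma DataSound.exists_autReduces (hd : DataSound inv R d) (w : Word A) :
    ∃ d' w', AutReduces d w d' w' := by
  induction w using (InvImage.wf (rk (A := A)) wellFounded_lt).induction generalizing d with
  | _ w ih =>
    by_cases h : AutReducible d.rules w
    · obtain ⟨q, hq⟩ := exists_autStep h
      obtain ⟨d', w', h'⟩ := ih q.2 (hq.rk_lt hd) (hd.found (hq.spec hd).1)
      exact ⟨d', w', h'.1.head hq, h'.2⟩
    · exact ⟨d, w, Relation.ReflTransGen.refl, h⟩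

end AutReduction

/-! ### Normal forms -/

section NormalForms

variable [LinearOrder A] [Fintype A] {inv : A → A} {R : Finset (Rule A)} {c : ℕ → Config A}

lemma IsRun.soundRun (hinv : Function.Involutive inv) (hR : ∀ r ∈ R, r ∈ SL2)
    (hc : IsRun inv R c) : SoundRun inv R c :=
  ⟨hc.configInv hinv hR, hc.2⟩

/-- Words with the same value are convertible at time `0`, hence always, by live rules. -/
lemma IsRun.exists_conv (hinv : Function.Involutive inv) (hR : ∀ r ∈ R, r ∈ SL2)
    (hc : IsRun inv R c) {u w : Word A} (h : value inv R u = value inv R w) :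
    ∃ n, ∀ t, Conv (c t).1.live n u w := by
  have hs := hc.soundRun hinv hR
  have hmem : ∀ r, r ∈ (c 0).1.rulesOf ↔ r ∈ initialRules inv R := fun r => by
    rw [← hc.1.store_eq]
    rfl
  have := thue_of_value_eq hinv (S := (c 0).1.rulesOf)
    (fun x => (hmem _).2 (mem_initialRules.2 (Or.inr ⟨x, rfl⟩)))
    (fun r hr => (hmem _).2 (mem_initialRules.2 (Or.inl hr))) h
  obtain ⟨n, hn⟩ := Conv.exists_of_thue this
  have := Conv.subst (fun r hr _ => (hs.inv_at 0).data.store_conv r hr) hn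
  exact ⟨n, fun t => hs.conv_mono t.zero_le this⟩

lemma IsRun.thueEquiv_iff (hinv : Function.Involutive inv) (hR : ∀ r ∈ R, r ∈ SL2)
    (hc : IsRun inv R c) (t : ℕ) {u w : Word A} :
    ThueEquiv (c t).store u w ↔ value inv R u = value inv R w := by
  refine ⟨fun h => (hc.configInv hinv hR t).data.valid.thue h, fun h => ?_⟩
  obtain ⟨n, hn⟩ := hc.exists_conv hinv hR h
  exact ((hn t).mono (live_subset_rulesOf _) le_rfl).thue

/-- Words with the same value have the same normal form by stable rules. -/
lemma IsRun.eq_of_fullyReduces (hinv : Function.Involutive inv) (hR : ∀ r ∈ R, r ∈ SL2)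
    (hc : IsRun inv R c) {x y n₁ n₂ : Word A} (h : value inv R x = value inv R y)
    (h₁ : FullyReduces (stableRules c) x n₁) (h₂ : FullyReduces (stableRules c) y n₂) :
    n₁ = n₂ := by
  obtain ⟨n, hn⟩ := hc.exists_conv hinv hR h
  refine (hc.soundRun hinv hR).fullyReduces_unique (max n (max (rk x) (rk y) + 1)) ?_ ?_
    ⟨0, (hn 0).mono subset_rfl (le_max_left _ _)⟩ h₁ h₂ <;> omega

lemma IsRun.stable_valid (hinv : Function.Involutive inv) (hR : ∀ r ∈ R, r ∈ SL2)
    (hc : IsRun inv R c) : Valid inv R (stableRules c) := by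
  rintro r ⟨-, T, hT⟩
  exact (hc.configInv hinv hR T).data.valid r (live_subset_rulesOf _ (hT T le_rfl))

lemma IsRun.fullyReduces_normalForm (hinv : Function.Involutive inv) (hR : ∀ r ∈ R, r ∈ SL2)
    (hc : IsRun inv R c) {u v : Word A} (hv : IsNormalForm inv R u v) :
    FullyReduces (stableRules c) u v := by
  have hS := (hc.soundRun hinv hR).stable_oriented
  have hirr : Irreducible (stableRules c) v := by
    by_contra h
    obtain ⟨w, hw⟩ := not_irreducible_iff.1 h
    have hlt := hS.rk_lt hw
    have hval := (hc.stable_valid hinv hR).elemRed hw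
    rcases hv.2 w (hval.symm.trans hv.1) with rfl | h
    · exact lt_irrefl _ hlt
    · exact absurd (rk_lt.2 h) (by omega)
  obtain ⟨n, hn⟩ := exists_fullyReduces hS u
  obtain rfl := hc.eq_of_fullyReduces hinv hR hv.1 ⟨Relation.ReflTransGen.refl, hirr⟩ hn
  exact hn

lemma eventually_permanentRed {u v : Word A}
    (h : Relation.ReflTransGen (ElemRed (stableRules c)) u v) :
    ∃ t₀, ∀ t ≥ t₀, Relation.ReflTransGen (PermanentRed c t) u v := by
  induction h with
  | refl => exact ⟨0, fun t _ => Relation.ReflTransGen.refl⟩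
  | tail _ hs ih =>
    obtain ⟨t₀, h₀⟩ := ih
    obtain ⟨r, ⟨hp, T, hT⟩, hr⟩ := hs
    refine ⟨max t₀ T, fun t ht => (h₀ t (by omega)).tail ⟨r, ⟨?_, hp⟩, hr⟩⟩
    exact live_subset_rulesOf _ (hT t (by omega))

/-- From some time on, words up to `n` which are not `Aut`-reducible are irreducible by the stable
rules, as there are only finitely many such words. -/
lemma SoundRun.eventually_irreducible (hc : SoundRun inv R c) (n : ℕ) :
    ∃ t₀, ∀ t ≥ t₀, ∀ w, rk w ≤ n → ¬ AutReducible (c t).1.rules w →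
      Irreducible (stableRules c) w := by
  have : ∀ᶠ t in Filter.atTop, ∀ w ∈ {w : Word A | rk w ≤ n},
      ¬ AutReducible (c t).1.rules w → Irreducible (stableRules c) w := by
    rw [Filter.eventually_all_finite (finite_rk_le n)]
    intro w _
    by_cases h : Irreducible (stableRules c) w
    · exact Filter.Eventually.of_forall fun t _ => h
    · unfold Irreducible at h
      push Not at h
      obtain ⟨r, ⟨-, T, hT⟩, hrw⟩ := h
      obtain ⟨t₀, h₀⟩ := hc.eventually_autReducible (t := T) (w := w)
        (fun hi => hi r (live_subset_rulesOf _ (hT T le_rfl)) hrw)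
      exact Filter.eventually_atTop.2 ⟨t₀, fun t ht h' => absurd (h₀ t ht) h'⟩
  exact Filter.eventually_atTop.1 this

end NormalForms

end KnuthBendix

theorem mainTheorem2 {A : Type*} [Fintype A] [LinearOrder A] (inv : A → A)
    (hinv : Function.Involutive inv) (R : Finset (KnuthBendix.Rule A))
    (hR : ∀ r ∈ R, r ∈ KnuthBendix.SL2) (c : ℕ → KnuthBendix.Config A)
    (hc : KnuthBendix.IsRun inv R c) (u v : KnuthBendix.Word A) (s : ℕ)
    (hv : KnuthBendix.LeastWord {w | KnuthBendix.ThueEquiv (c s).store u w} v) :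
    (∃ t₀, ∀ t ≥ t₀, Relation.ReflTransGen (KnuthBendix.PermanentRed c t) u v) ∧
    (∃ t₀, ∀ t ≥ t₀, KnuthBendix.AutReductionAlwaysGives (c t).1 u v) ∧
    KnuthBendix.IsNormalForm inv R u v := by
  have hset : {w | KnuthBendix.ThueEquiv (c s).store u w} =
      {w | KnuthBendix.value inv R w = KnuthBendix.value inv R u} := by
    ext w
    exact (hc.thueEquiv_iff hinv hR s).trans eq_comm
  rw [hset] at hv
  have hnf : KnuthBendix.IsNormalForm inv R u v := hv
  have hred := hc.fullyReduces_normalForm hinv hR hnf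
  refine ⟨KnuthBendix.eventually_permanentRed hred.1, ?_, hnf⟩
  obtain ⟨t₀, h₀⟩ := (hc.soundRun hinv hR).eventually_irreducible (KnuthBendix.rk u)
  refine ⟨t₀, fun t ht => ?_⟩
  have hd := (hc.configInv hinv hR t).data
  have huniq : ∀ d' w, KnuthBendix.AutReduces (c t).1 u d' w → w = v := by
    intro d' w h
    obtain ⟨-, hrk, -, hval, hirr⟩ := h.spec hd
    exact hc.eq_of_fullyReduces hinv hR hval.symm
      ⟨Relation.ReflTransGen.refl, h₀ t ht w hrk hirr⟩ hred
  obtain ⟨d', w, h⟩ := hd.exists_autReduces u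
  exact ⟨hd.acc_autStep u, ⟨d', huniq d' w h ▸ h⟩, huniq⟩
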